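/- Let $J\subseteq\mathbb R$ be an open interval containing $0$, let $r_0,v_0\in\mathbb R^3$, and set $$\alpha=|r_0|^2,\quad \beta=r_0\cdot v_0,\quad b=|v_0|,\quad \chi(t)=\alpha+2\beta t+b^2t^2,\qquad a=\beta/b,\quad c=|r_0\wedge v_0|/b .$$ Consider the equation of motion $$\ddot r=\hat h\,r\wedge\dot r,\qquad r(0)=r_0,\ \dot r(0)=v_0,\tag{1}$$ on $J$, where the real coefficient $\hat h=\hat h(t,r^2)$ may depend on $r^2=|r|^2$ (for instance $\hat h=\hat h(r^2)$) and on $t$. Put $h(t)=\hat h(t,\chi(t))$. **(i)** Every solution of (1) satisfies on $J$: $|\dot r(t)|=b$, $|r(t)|^2=\chi(t)$, $r(t)\cdot\dot r(t)=\beta+b^2t$. In (ii)–(iv) assume that $h$ is differentiable and nowhere zero on $J$. **(ii)** The equation $\dddot F=(\dot h/h)\ddot F+h^2\left[\tfrac12\dot\chi F-\chi\dot F\right]$ has on $J$ solutions $F_0,F_1,F_2$ with $(F,\dot F,\ddot F)(0)=(1,0,0)$, $(0,1,0)$, $(0,0,h(0))$ respectively, and for any such $F_0,F_1,F_2$ a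 function $r$ on $J$ solves (1) if and only if $$r(t)=r_0F_0(t)+v_0F_1(t)+(r_0\wedge v_0)F_2(t)\qquad(t\in J).\tag{2}$$ **(iii)** Let $r_0\wedge v_0\ne0$. The linear problem $$\ddot f=\frac{\dot h}{h}\dot f+\left[-\chi\frac{h^2}{4}+\frac{ibh}{2}\right]f,\qquad f(0)=1,\quad \dot f(0)=\frac{i\,a\,h(0)}{2}\tag{3}$$ has exactly one solution $f:J\to\mathbb C$. With $g=-[(a+bt)f+i(2/h)\dot f]/c$, the pair $(f,g)$ is the solution of $\dot f=\tfrac{ih}{2}[(a+bt)f+cg]$, $\dot g=\tfrac{ih}{2}[-(a+bt)g+cf]$, $f(0)=1$, $g(0)=0$ (and every solution of this system arises so), $|f|^2+|g|^2=1$, and the functions $F_j$ of (ii), which give the solution of (1) by (2), are $$F_0=\tfrac1{2c}\{-2(a+bt)[fg+f^*g^*]+c[f^2+f^{*2}-g^2-g^{*2}]\}=\tfrac1{2c^2h^2}\{h^2[c^2+(a+bt)^2][f^2+f^{*2}]+4[\dot f^2+\dot f^{*2}]\},$$ $$F_1=\tfrac1b\{-aF_0+(a+bt)[ff^*-gg^*]+c[fg^*+f^*g]\}=\tfrac1b\{-(a+bt)-aF_0+\tfrac{2i}{h}[f\dot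 f^*-f^*\dot f]\},$$ $$F_2=-\tfrac{i}{2cb}\{2(a+bt)[fg-f^*g^*]-c[f^2-f^{*2}-g^2+g^{*2}]\}=\tfrac{i}{2bc^2h^2}\{h^2[c^2+(a+bt)^2][f^2-f^{*2}]+4[\dot f^2-\dot f^{*2}]\}.$$ **(iv)** If $h$ is moreover twice differentiable on $J$ and $f=h^{1/2}\varphi$ (principal root), then $f$ solves (3) if and only if $$\ddot\varphi=\varphi\left[\tfrac{ibh}2-\chi\tfrac{h^2}4+\tfrac34\left(\tfrac{\dot h}h\right)^2-\tfrac12\tfrac{\ddot h}h\right],\quad \varphi(0)=h(0)^{-1/2},\quad \dot\varphi(0)=\tfrac12h(0)^{-3/2}[i\,a\,h(0)^2-\dot h(0)].\tag{4}$$ In (v)–(vii) let $r_0\wedge v_0\neq0$ and let $k\ne0$ be real. For functions $u,w$ write $\mathrm{Wr}=uw'-wu'$. **(v)** Let $\hat h=k$. Put $p=-\left(1+\frac{ikc^2}{4b}\right)$, $\tau(t)=(ikb)^{1/2}(t+\beta/b^2)$, $\tilde k=\frac a2(ik/b)^{1/2}$, $u(\tau)=D_p(\tau)$, $w(\tau)=D_p(-\tau)$,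 where $D_p$ is the parabolic cylinder function. Then $\mathrm{Wr}$ has no zero and $f$ solves (3) on $J$ if and only if $f(t)=A\,u(\tau(t))+B\,w(\tau(t))$ on $J$, with $A=\frac{w'-\tilde k w}{\mathrm{Wr}}$ and $B=\frac{\tilde k u-u'}{\mathrm{Wr}}$ evaluated at $\tau(0)$. **(vi)** Let $\hat h=k/r^2$, so $h=k/\chi$. Under the substitution $t=-(2ibcz+\beta-ibc)/b^2$, $f(t)=\hat f(z)$ with $\hat f$ holomorphic near the points $z(t)$, $t\in J$, the differential equation in (3) becomes $z(1-z)\hat f''+(1-2z)\hat f'-\frac{k(k-2ib)}{(2b)^2}\hat f=0$. Let $F$ be the hypergeometric function $F\left(-\frac{ik}{2b},1+\frac{ik}{2b};1;z\right)$, continued analytically to $\mathbb C\setminus[1,\infty)$. Then $F(z)$ and $F(1-z)$ solve this equation on $\mathbb C\setminus((-\infty,0]\cup[1,\infty))$ with nowhere vanishing Wronskian, and $f$ solves (3) on $J$ if and only if $f(t)=A\,F(z(t))+B\,F(1-z(t))$ on $J$, where $A,B$ are the constants for which $AF(z)+BF(1-z)$ has value $1$ and derivative $ack/(b\alpha)$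 at $z=z(0)$. **(vii)** Let $\hat h=h(t)=2k/(1+2\omega t)$ with $\omega\neq0$ real and $1+2\omega t\ne0$ on $J$. Put $\lambda=\frac{2b\omega^2-ik(b^2-2\beta\omega)}{4b\omega^2}$ and let $\mu\in\mathbb C$ satisfy $\mu^2=\frac{k^2(4\beta\omega-b^2-4\alpha\omega^2)}{16\omega^4}$. Under the substitution $t=(2i\omega^2z-bk)/(2bk\omega)$, $\varphi(t)=\hat\varphi(z)$ with $\hat\varphi$ holomorphic near the points $z(t)$, $t\in J$, the differential equation in (4) becomes Whittaker's equation $\hat\varphi''+\left[\frac14\left(\frac1{z^2}-1\right)+\frac\lambda z-\frac{\mu^2}{z^2}\right]\hat\varphi=0$. The functions $u(z)=W_{\lambda,\mu}(z)$ and $w(z)=W_{-\lambda,\mu}(-z)$ (principal branches) solve it for $\operatorname{Im}z\ne0$ with nowhere vanishing Wronskian, and $f$ solves (3) on $J$ if and only if $f(t)=h(t)^{1/2}[A\,u(z(t))+B\,w(z(t))]$ on $J$, where $A,B$ are the constants for which $Au+Bw$ has value $\varphi(0)$ and derivative $\dot\varphi(0)\,i\omega/(bk)$ at $z=z(0)$,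 with $\varphi(0),\dot\varphi(0)$ as in (4). -/

import Mathlib

noncomputable section

namespace VectorNewton

open Complex ComplexConjugate

/-- Ordinary three-dimensional space with its Euclidean norm. -/
abbrev E3 := EuclideanSpace ℝ (Fin 3)

/-- The vector product `x ∧ y` in `ℝ³`. -/
def wedge (x y : E3) : E3 := WithLp.toLp 2 (crossProduct x.ofLp y.ofLp)

/-- `r` is, on the (open) set `J`, a solution of `r̈ = H(t, |r|²) r ∧ ṙ`.  The autonomous equation
`r̈ = ĥ(r²) r ∧ ṙ` is the case `H t s = ĥ s`, the equation `r̈ = h(t) r ∧ ṙ` the case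
`H t s = h t`. -/
def IsMotion (H : ℝ → ℝ → ℝ) (J : Set ℝ) (r : ℝ → E3) : Prop :=
  ∀ t ∈ J, DifferentiableAt ℝ r t ∧
    HasDerivAt (deriv r) (H t (‖r t‖ ^ 2) • wedge (r t) (deriv r t)) t

/-! ### Constants attached to initial data `r(0) = r₀`, `ṙ(0) = v₀` -/

/-- `α = |r(0)|²` -/
def alpha (r₀ : E3) : ℝ := ‖r₀‖ ^ 2

/-- `β = r(0) · ṙ(0)` -/
def beta (r₀ v₀ : E3) : ℝ := inner ℝ r₀ v₀

/-- `b = |ṙ(0)|` -/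
def speed (v₀ : E3) : ℝ := ‖v₀‖

/-- `a = r(0) · ṙ(0) / |ṙ(0)|` -/
def parA (r₀ v₀ : E3) : ℝ := beta r₀ v₀ / speed v₀

/-- `c = |r(0) ∧ ṙ(0)| / |ṙ(0)|` -/
def parC (r₀ v₀ : E3) : ℝ := ‖wedge r₀ v₀‖ / speed v₀

/-- `χ(t) = α + 2 β t + b² t²` -/
def chi (r₀ v₀ : E3) (t : ℝ) : ℝ := alpha r₀ + 2 * beta r₀ v₀ * t + speed v₀ ^ 2 * t ^ 2

/-! ### The third-order linear equation for `F₀, F₁, F₂` -/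

/-- On `J` the function `F` solves
`F⃛ = (ḣ/h) F̈ + h² (½ χ̇ F - χ Ḟ)`, with `F(0) = x₀`, `Ḟ(0) = x₁`, `F̈(0) = x₂`. -/
def SolvesThirdOrder (h : ℝ → ℝ) (r₀ v₀ : E3) (J : Set ℝ) (x₀ x₁ x₂ : ℝ) (F : ℝ → ℝ) : Prop :=
  (∀ t ∈ J, DifferentiableAt ℝ F t ∧ DifferentiableAt ℝ (deriv F) t ∧
    HasDerivAt (deriv (deriv F))
      (deriv h t / h t * deriv (deriv F) t
        + h t ^ 2 * (1 / 2 * deriv (chi r₀ v₀) t * F t - chi r₀ v₀ t * deriv F t)) t) ∧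
  F 0 = x₀ ∧ deriv F 0 = x₁ ∧ deriv (deriv F) 0 = x₂

/-! ### The linear second-order equation for `f` -/

/-- On `J` the function `f` solves `f̈ = (ḣ/h) ḟ + [-χ (h/2)² + i b h/2] f`. -/
def SolvesLinear (h : ℝ → ℝ) (r₀ v₀ : E3) (J : Set ℝ) (f : ℝ → ℂ) : Prop :=
  ∀ t ∈ J, DifferentiableAt ℝ f t ∧
    HasDerivAt (deriv f)
      (((deriv h t / h t : ℝ) : ℂ) * deriv f t
        + (-(chi r₀ v₀ t : ℂ) * ((h t : ℂ) / 2) ^ 2 + I * speed v₀ * h t / 2) * f t) t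

/-- `f` solves the linear equation with `f(0) = 1`, `ḟ(0) = i a h(0)/2`. -/
def IsGenerating (h : ℝ → ℝ) (r₀ v₀ : E3) (J : Set ℝ) (f : ℝ → ℂ) : Prop :=
  SolvesLinear h r₀ v₀ J f ∧ f 0 = 1 ∧ deriv f 0 = I * parA r₀ v₀ * h 0 / 2

/-- The companion function `g = -[(a + b t) f + i (2/h) ḟ] / c`. -/
def companion (h : ℝ → ℝ) (r₀ v₀ : E3) (f : ℝ → ℂ) (t : ℝ) : ℂ :=
  -(((parA r₀ v₀ + speed v₀ * t : ℝ) : ℂ) * f t + I * (2 / (h t : ℂ)) * deriv f t) / parC r₀ v₀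

/-- The first-order system
`ḟ = i (h/2) [(a + b t) f + c g]`, `ġ = i (h/2) [-(a + b t) g + c f]`, `f(0) = 1`, `g(0) = 0`. -/
def SolvesSystem (h : ℝ → ℝ) (r₀ v₀ : E3) (J : Set ℝ) (f g : ℝ → ℂ) : Prop :=
  (∀ t ∈ J,
    HasDerivAt f (I * ((h t : ℂ) / 2) *
      (((parA r₀ v₀ + speed v₀ * t : ℝ) : ℂ) * f t + parC r₀ v₀ * g t)) t ∧
    HasDerivAt g (I * ((h t : ℂ) / 2) *
      (-((parA r₀ v₀ + speed v₀ * t : ℝ) : ℂ) * g t + parC r₀ v₀ * f t)) t) ∧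
  f 0 = 1 ∧ g 0 = 0

/-! The expressions of `F₀, F₁, F₂` through `f` and `g` (with `z`, `w` the values `f(t)`, `g(t)`). -/

/-- `F₀ = (1/2c) {-2 (a+bt) [f g + f* g*] + c [f² + f*² - g² - g*²]}` -/
def pairF0 (r₀ v₀ : E3) (t : ℝ) (z w : ℂ) : ℂ :=
  1 / (2 * (parC r₀ v₀ : ℂ)) *
    (-2 * ((parA r₀ v₀ + speed v₀ * t : ℝ) : ℂ) * (z * w + conj z * conj w)
      + parC r₀ v₀ * (z ^ 2 + conj z ^ 2 - w ^ 2 - conj w ^ 2))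

/-- `F₁ = (1/b) {-a F₀ + (a+bt) [f f* - g g*] + c [f g* + f* g]}` -/
def pairF1 (r₀ v₀ : E3) (t : ℝ) (z w : ℂ) : ℂ :=
  1 / (speed v₀ : ℂ) *
    (-(parA r₀ v₀ : ℂ) * pairF0 r₀ v₀ t z w
      + ((parA r₀ v₀ + speed v₀ * t : ℝ) : ℂ) * (z * conj z - w * conj w)
      + parC r₀ v₀ * (z * conj w + conj z * w))

/-- `F₂ = -(i/2cb) {2 (a+bt) [f g - f* g*] - c [f² - f*² - g² + g*²]}` -/
def pairF2 (r₀ v₀ : E3) (t : ℝ) (z w : ℂ) : ℂ :=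
  -(I / (2 * parC r₀ v₀ * speed v₀)) *
    (2 * ((parA r₀ v₀ + speed v₀ * t : ℝ) : ℂ) * (z * w - conj z * conj w)
      - parC r₀ v₀ * (z ^ 2 - conj z ^ 2 - w ^ 2 + conj w ^ 2))

/-! The expressions of `F₀, F₁, F₂` through `f` alone (`η`, `z`, `z'` are the values `h(t)`, `f(t)`,
`ḟ(t)`). -/

/-- `F₀ = (1/2c²h²) {h² [c² + (a+bt)²] [f² + f*²] + 4 [ḟ² + ḟ*²]}` -/
def singleF0 (r₀ v₀ : E3) (t : ℝ) (η : ℝ) (z z' : ℂ) : ℂ :=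
  1 / (2 * (parC r₀ v₀ : ℂ) ^ 2 * (η : ℂ) ^ 2) *
    ((η : ℂ) ^ 2 * ((parC r₀ v₀ ^ 2 + (parA r₀ v₀ + speed v₀ * t) ^ 2 : ℝ) : ℂ)
        * (z ^ 2 + conj z ^ 2)
      + 4 * (z' ^ 2 + conj z' ^ 2))

/-- `F₁ = (1/b) {-(a+bt) - a F₀ + i (2/h) [f ḟ* - f* ḟ]}` -/
def singleF1 (r₀ v₀ : E3) (t : ℝ) (η : ℝ) (z z' : ℂ) : ℂ :=
  1 / (speed v₀ : ℂ) *
    (-((parA r₀ v₀ + speed v₀ * t : ℝ) : ℂ) - parA r₀ v₀ * singleF0 r₀ v₀ t η z z'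
      + I * (2 / (η : ℂ)) * (z * conj z' - conj z * z'))

/-- `F₂ = (i/2bc²h²) {h² [c² + (a+bt)²] [f² - f*²] + 4 [ḟ² - ḟ*²]}` -/
def singleF2 (r₀ v₀ : E3) (t : ℝ) (η : ℝ) (z z' : ℂ) : ℂ :=
  I / (2 * speed v₀ * (parC r₀ v₀ : ℂ) ^ 2 * (η : ℂ) ^ 2) *
    ((η : ℂ) ^ 2 * ((parC r₀ v₀ ^ 2 + (parA r₀ v₀ + speed v₀ * t) ^ 2 : ℝ) : ℂ)
        * (z ^ 2 - conj z ^ 2)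
      + 4 * (z' ^ 2 - conj z' ^ 2))

/-! ### The Schrödinger form -/

/-- On `J` the function `φ` solves
`φ̈ = φ [i b h/2 - χ (h/2)² + (3/4) (ḣ/h)² - (1/2) ḧ/h]`. -/
def SolvesSchroedinger (h : ℝ → ℝ) (r₀ v₀ : E3) (J : Set ℝ) (φ : ℝ → ℂ) : Prop :=
  ∀ t ∈ J, DifferentiableAt ℝ φ t ∧
    HasDerivAt (deriv φ)
      (φ t * (I * speed v₀ * h t / 2 - (chi r₀ v₀ t : ℂ) * ((h t : ℂ) / 2) ^ 2
        + 3 / 4 * ((deriv h t / h t : ℝ) : ℂ) ^ 2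
        - 1 / 2 * ((deriv (deriv h) t / h t : ℝ) : ℂ))) t

/-- The initial value `φ(0) = h(0)^(-1/2)`. -/
def phiInit (h : ℝ → ℝ) : ℂ := (h 0 : ℂ) ^ (-1 / 2 : ℂ)

/-- The initial value `φ̇(0) = h(0)^(-3/2) [i a h(0)² - ḣ(0)] / 2`. -/
def phiDerivInit (h : ℝ → ℝ) (r₀ v₀ : E3) : ℂ :=
  (h 0 : ℂ) ^ (-3 / 2 : ℂ) * (I * parA r₀ v₀ * (h 0 : ℂ) ^ 2 - ((deriv h 0 : ℝ) : ℂ)) / 2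

/-! ### Solving for the coefficients of a linear combination -/

/-- The Wronskian `u w' - w u'` at `z`. -/
def wronsk (u w : ℂ → ℂ) (z : ℂ) : ℂ := u z * deriv w z - w z * deriv u z

/-- The coefficient of `u` in the combination of `u` and `w` with value `x` and derivative `y`
at `z`. -/
def coeffFst (u w : ℂ → ℂ) (z x y : ℂ) : ℂ := (x * deriv w z - y * w z) / wronsk u w z

/-- The coefficient of `w` in the combination of `u` and `w` with value `x` and derivative `y`
at `z`. -/
def coeffSnd (u w : ℂ → ℂ) (z x y : ℂ) : ℂ := (y * u z - x * deriv u z) / wronsk u w z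

/-! ### Special functions -/

/-- Kummer's confluent hypergeometric function `Φ(a, c; z) = ∑ (a)ₙ zⁿ / ((c)ₙ n!)`, for `c` not a
non-positive integer (Mathlib's function is the one divided by `Γ(c)`). -/
def kummer (a c z : ℂ) : ℂ := Gamma c * regularizedHGFun {a} {c} z

/-- The parabolic cylinder function
`D_p(z) = 2^(p/2) e^(-z²/4) [√π / Γ((1-p)/2) Φ(-p/2, 1/2; z²/2)
  - √(2π) z / Γ(-p/2) Φ((1-p)/2, 3/2; z²/2)]`. -/
def parabolicCylinder (p z : ℂ) : ℂ :=
  (2 : ℂ) ^ (p / 2) * exp (-z ^ 2 / 4) *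
    ((Real.sqrt Real.pi : ℂ) / Gamma ((1 - p) / 2) * kummer (-p / 2) (1 / 2) (z ^ 2 / 2)
      - (Real.sqrt (2 * Real.pi) : ℂ) * z / Gamma (-p / 2)
        * kummer ((1 - p) / 2) (3 / 2) (z ^ 2 / 2))

/-- `F` is the Gauss hypergeometric function `F(a, b; c; ·)`, that is, the analytic continuation of
the hypergeometric series from the unit disc to `ℂ` cut along `[1, ∞)`. -/
def IsGaussHypergeometric (a b c : ℂ) (F : ℂ → ℂ) : Prop :=
  DifferentiableOn ℂ F {z | 1 - z ∈ slitPlane} ∧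
    ∀ z : ℂ, ‖z‖ < 1 → F z = ordinaryHypergeometric a b c z

/-- The Whittaker function `M_{λ,μ}(z) = z^(μ+1/2) e^(-z/2) Φ(μ-λ+1/2, 2μ+1; z)`. -/
def whittakerM (l m z : ℂ) : ℂ :=
  z ^ (m + 1 / 2) * exp (-z / 2) * kummer (m - l + 1 / 2) (2 * m + 1) z

/-- The Whittaker function `W_{λ,μ}(z)`, for `2μ` not an integer. -/
def whittakerW (l m z : ℂ) : ℂ :=
  Gamma (-2 * m) / Gamma (1 / 2 - m - l) * whittakerM l m z
    + Gamma (2 * m) / Gamma (1 / 2 + m - l) * whittakerM l (-m) z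

/-! ### The three explicit cases: parameters and changes of variable -/

/-- `p = -(1 + i k c² / (4 b))` -/
def cylP (k : ℝ) (r₀ v₀ : E3) : ℂ := -(1 + I * k * (parC r₀ v₀ : ℂ) ^ 2 / (4 * speed v₀))

/-- `τ(t) = (i k b)^(1/2) (t + β / b²)` -/
def cylTau (k : ℝ) (r₀ v₀ : E3) (t : ℝ) : ℂ :=
  (I * k * speed v₀) ^ (1 / 2 : ℂ) * ((t + beta r₀ v₀ / speed v₀ ^ 2 : ℝ) : ℂ)

/-- `k̃ = (a/2) (i k / b)^(1/2)` -/
def cylK (k : ℝ) (r₀ v₀ : E3) : ℂ := (parA r₀ v₀ : ℂ) / 2 * (I * k / speed v₀) ^ (1 / 2 : ℂ)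

/-- `z(t)`, the solution of `t = -(2 i b c z + β - i b c) / b²`. -/
def hypZ (r₀ v₀ : E3) (t : ℝ) : ℂ :=
  (I * speed v₀ * parC r₀ v₀ - beta r₀ v₀ - (speed v₀ : ℂ) ^ 2 * t)
    / (2 * I * speed v₀ * parC r₀ v₀)

/-- The hypergeometric equation
`z (1 - z) u'' + (1 - 2 z) u' - k (k - 2 i b) (2 b)⁻² u = 0` at the point `z`. -/
def HypEqAt (k b : ℝ) (u : ℂ → ℂ) (z : ℂ) : Prop :=
  z * (1 - z) * deriv (deriv u) z + (1 - 2 * z) * deriv u z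
    - k * (k - 2 * I * b) * ((2 * b : ℂ) ^ 2)⁻¹ * u z = 0

/-- `z(t)`, the solution of `t = (2 i ω² z - b k) / (2 b k ω)`. -/
def whitZ (k ω : ℝ) (v₀ : E3) (t : ℝ) : ℂ :=
  (2 * speed v₀ * k * ω * t + speed v₀ * k) / (2 * I * (ω : ℂ) ^ 2)

/-- `λ = [2 b ω² - i k (b² - 2 β ω)] / (4 b ω²)` -/
def whitL (k ω : ℝ) (r₀ v₀ : E3) : ℂ :=
  (2 * speed v₀ * (ω : ℂ) ^ 2 - I * k * ((speed v₀ : ℂ) ^ 2 - 2 * beta r₀ v₀ * ω))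
    / (4 * speed v₀ * (ω : ℂ) ^ 2)

/-- `μ² = k² (4 β ω - b² - 4 α ω²) / (16 ω⁴)` -/
def whitMuSq (k ω : ℝ) (r₀ v₀ : E3) : ℝ :=
  k ^ 2 * (4 * beta r₀ v₀ * ω - speed v₀ ^ 2 - 4 * alpha r₀ * ω ^ 2) / (16 * ω ^ 4)

/-- The Whittaker equation `u'' + [(1/4) (1/z² - 1) + λ/z - μ²/z²] u = 0` at the point `z`. -/
def WhittakerEqAt (l m : ℂ) (u : ℂ → ℂ) (z : ℂ) : Prop :=
  deriv (deriv u) z + (1 / 4 * (1 / z ^ 2 - 1) + l / z - m ^ 2 / z ^ 2) * u z = 0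

end VectorNewton

end

open VectorNewton

/-!
Along a motion, `r̈` is orthogonal to both `r` and `ṙ`, which yields the conservation laws and
hence `|r|² = χ`, so that the coefficient of the equation is the known function `h`. The triple
`(r, ṙ, r ∧ ṙ)` then solves a linear system whose scalar counterpart is the third-order equation:
by uniqueness for linear systems `r = F₀ r₀ + F₁ v₀ + F₂ (r₀ ∧ v₀)`.

The system for `(f, g)` is the spinor form of the same rotation. Its matrix is `i h / 2` times a
real symmetric traceless one, so `|f|² + |g|²` is conserved, and the products of `f, g, f*, g*`
satisfy the equations of the `F_j`: the combination `F₀ - i b F₂` is a quadratic form and `a F₀ +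
b F₁` a Hermitian form in `(f, g)`. Eliminating `g` gives the second-order equation for `f`, and
the factor `h^(1/2)` removes its first-order term.

For the three explicit coefficients an affine substitution turns the equation for `f` or `φ` into
a classical one, and what remains is to show that the two special functions satisfy it and are
independent. For Weber's and Whittaker's equations the Wronskian is constant and is computed from
the coefficients of the two functions in a basis of power series solutions. For the hypergeometric
equation with parameters `-p, 1 + p; 1`, proportionality of `F(z)` and `F(1 - z)` would extend `F`
to an entire function, although its series has radius of convergence `1`. The continuation of `F`
to the cut plane comes from Euler's integral; since `Re p = 0`, the exponents of the integral for
`F` itself are not admissible, and `F` is recovered from the integrals for contiguous parameters.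
-/

namespace VectorNewton

open Complex ComplexConjugate

/-! ### Linear differential equations on an interval -/

section LinearODE

open Set Filter Topology MeasureTheory
open scoped Nat

variable {E : Type*} [NormedAddCommGroup E] [NormedSpace ℝ E] {J : Set ℝ} {t₀ : ℝ}

lemma eq_zero_of_norm_deriv_le_of_le (hJc : J.OrdConnected) (ht₀ : t₀ ∈ J)
    {x x' : ℝ → E} {K : ℝ → ℝ} (hK : ContinuousOn K J) (hx : ∀ t ∈ J, HasDerivAt x (x' t) t)
    (hle : ∀ t ∈ J, ‖x' t‖ ≤ K t * ‖x t‖) (h₀ : x t₀ = 0) {t : ℝ} (ht : t ∈ J) (htt : t₀ ≤ t) :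
    x t = 0 := by
  have hsub : Icc t₀ t ⊆ J := hJc.out ht₀ ht
  obtain ⟨C, hC⟩ := isCompact_Icc.bddAbove_image (hK.mono hsub)
  have hmem : ∀ s ∈ Ico t₀ t, s ∈ J := fun s hs => hsub (Ico_subset_Icc_self hs)
  refine eq_zero_of_abs_deriv_le_mul_abs_self_of_eq_zero_right (f' := x') (K := C)
    (fun s hs => (hx s (hsub hs)).continuousAt.continuousWithinAt)
    (fun s hs => (hx s (hmem s hs)).hasDerivWithinAt) h₀
    (fun s hs => (hle s (hmem s hs)).trans ?_) t ⟨htt, le_rfl⟩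
  gcongr
  exact hC (mem_image_of_mem _ (Ico_subset_Icc_self hs))

lemma eq_zero_of_norm_deriv_le (hJc : J.OrdConnected) (ht₀ : t₀ ∈ J)
    {x x' : ℝ → E} {K : ℝ → ℝ} (hK : ContinuousOn K J) (hx : ∀ t ∈ J, HasDerivAt x (x' t) t)
    (hle : ∀ t ∈ J, ‖x' t‖ ≤ K t * ‖x t‖) (h₀ : x t₀ = 0) {t : ℝ} (ht : t ∈ J) : x t = 0 := by
  rcases le_total t₀ t with htt | htt
  · exact eq_zero_of_norm_deriv_le_of_le hJc ht₀ hK hx hle h₀ ht htt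
  · have hreflect : ∀ s ∈ Neg.neg ⁻¹' J, HasDerivAt (fun s => x (-s)) (-x' (-s)) s := fun s hs => by
      simpa using! (hx (-s) hs).scomp s (hasDerivAt_neg s)
    have hzero := eq_zero_of_norm_deriv_le_of_le (J := Neg.neg ⁻¹' J) (t₀ := -t₀) (t := -t)
      (hJc.preimage_anti fun _ _ => neg_le_neg) (by simpa using ht₀)
      (hK.comp continuous_neg.continuousOn fun _ hs => hs) hreflect
      (fun s hs => by simpa using hle (-s) hs) (by simpa using h₀) (by simpa using ht)
      (neg_le_neg htt)
    simpa using hzero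

lemma eqOn_of_hasDerivAt_eq (hJc : J.OrdConnected) (ht₀ : t₀ ∈ J) {x y x' : ℝ → E}
    (hx : ∀ t ∈ J, HasDerivAt x (x' t) t) (hy : ∀ t ∈ J, HasDerivAt y (x' t) t)
    (h₀ : x t₀ = y t₀) : EqOn x y J := fun _ ht =>
  sub_eq_zero.1 <| eq_zero_of_norm_deriv_le hJc ht₀ (x := x - y) (x' := 0) (K := 0)
    continuousOn_const (fun t ht => by simpa using! (hx t ht).sub (hy t ht)) (by simp)
    (sub_eq_zero.2 h₀) ht

lemma eqOn_of_hasDerivAt_clm (hJc : J.OrdConnected) (ht₀ : t₀ ∈ J)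
    {A : ℝ → E →L[ℝ] E} (hA : ContinuousOn A J) {x y : ℝ → E}
    (hx : ∀ t ∈ J, HasDerivAt x (A t (x t)) t) (hy : ∀ t ∈ J, HasDerivAt y (A t (y t)) t)
    (h₀ : x t₀ = y t₀) : EqOn x y J := fun _ ht =>
  sub_eq_zero.1 <| eq_zero_of_norm_deriv_le hJc ht₀ (x := x - y) (x' := fun t => A t (x t - y t))
    hA.norm (fun t ht => by simpa only [map_sub] using (hx t ht).sub (hy t ht))
    (fun t _ => (A t).le_opNorm _) (sub_eq_zero.2 h₀) ht

/-- The `n`-th term of the Peano–Baker series, whose sum solves `x' = A x`, `x t₀ = x₀`. -/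
noncomputable def peanoBaker (A : ℝ → E →L[ℝ] E) (t₀ : ℝ) (x₀ : E) : ℕ → ℝ → E
  | 0 => fun _ => x₀
  | n + 1 => fun t => ∫ s in t₀..t, A s (peanoBaker A t₀ x₀ n s)

variable {A : ℝ → E →L[ℝ] E} {x₀ : E}

lemma norm_peanoBaker_le {a b C : ℝ} (ht₀ : t₀ ∈ Icc a b) (hC : ∀ t ∈ Icc a b, ‖A t‖ ≤ C)
    (n : ℕ) : ∀ t ∈ Icc a b, ‖peanoBaker A t₀ x₀ n t‖ ≤ (C * |t - t₀|) ^ n / n ! * ‖x₀‖ := by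
  have hC0 : 0 ≤ C := (norm_nonneg _).trans (hC t₀ ht₀)
  induction n with
  | zero => intro t _; simp [peanoBaker]
  | succ n ih =>
    intro t ht
    have hintegrand : ∀ s ∈ uIoc t₀ t,
        ‖A s (peanoBaker A t₀ x₀ n s)‖ ≤ C ^ (n + 1) * |s - t₀| ^ n / n ! * ‖x₀‖ := by
      intro s hs
      have hs' : s ∈ Icc a b := uIcc_subset_Icc ht₀ ht (uIoc_subset_uIcc hs)
      calc ‖A s (peanoBaker A t₀ x₀ n s)‖
          ≤ ‖A s‖ * ‖peanoBaker A t₀ x₀ n s‖ := (A s).le_opNorm _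
        _ ≤ C * ((C * |s - t₀|) ^ n / n ! * ‖x₀‖) := by
          gcongr
          exacts [hC s hs', ih s hs']
        _ = C ^ (n + 1) * |s - t₀| ^ n / n ! * ‖x₀‖ := by ring
    calc ‖peanoBaker A t₀ x₀ (n + 1) t‖
        ≤ ∫ s in uIoc t₀ t, C ^ (n + 1) * |s - t₀| ^ n / n ! * ‖x₀‖ := by
          rw [peanoBaker, intervalIntegral.norm_intervalIntegral_eq]
          exact norm_integral_le_of_norm_le (Continuous.integrableOn_uIoc (by fun_prop))
            (ae_restrict_mem measurableSet_uIoc |>.mono hintegrand)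
      _ = (C * |t - t₀|) ^ (n + 1) / (n + 1)! * ‖x₀‖ := by
          rw [integral_mul_const, integral_div, integral_const_mul, integral_pow_abs_sub_uIoc,
            Nat.factorial_succ, mul_pow]
          push_cast
          field_simp

lemma exists_mem_Ioo_Icc_subset (hJ : IsOpen J) (hJc : J.OrdConnected) {s t : ℝ} (hs : s ∈ J)
    (ht : t ∈ J) : ∃ a b, s ∈ Ioo a b ∧ t ∈ Ioo a b ∧ Icc a b ⊆ J := by
  have hnhds : ∀ r ∈ J, ∃ a ∈ J, ∃ b ∈ J, r ∈ Ioo a b := fun r hr => by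
    obtain ⟨l, u, ⟨hl, hu⟩, hsub⟩ := mem_nhds_iff_exists_Ioo_subset.1 (hJ.mem_nhds hr)
    obtain ⟨a, hla, har⟩ := exists_between hl
    obtain ⟨b, hrb, hbu⟩ := exists_between hu
    exact ⟨a, hsub ⟨hla, har.trans hu⟩, b, hsub ⟨hl.trans hrb, hbu⟩, har, hrb⟩
  obtain ⟨a₁, ha₁, b₁, hb₁, has, hsb⟩ := hnhds s hs
  obtain ⟨a₂, ha₂, b₂, hb₂, hat, htb⟩ := hnhds t ht
  refine ⟨min a₁ a₂, max b₁ b₂, ⟨min_lt_of_left_lt has, lt_max_of_lt_left hsb⟩,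
    ⟨min_lt_of_right_lt hat, lt_max_of_lt_right htb⟩, hJc.out ?_ ?_⟩
  · rcases min_choice a₁ a₂ with h | h <;> rwa [h]
  · rcases max_choice b₁ b₂ with h | h <;> rwa [h]

variable [CompleteSpace E]

lemma hasDerivAt_integral_of_continuousOn (hJ : IsOpen J) (hJc : J.OrdConnected) (ht₀ : t₀ ∈ J)
    {v : ℝ → E} (hv : ContinuousOn v J) {t : ℝ} (ht : t ∈ J) :
    HasDerivAt (fun t => ∫ s in t₀..t, v s) (v t) t :=
  intervalIntegral.integral_hasDerivAt_right
    (hv.mono (hJc.uIcc_subset ht₀ ht)).intervalIntegrable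
    (hv.stronglyMeasurableAtFilter hJ t ht) (hv.continuousAt (hJ.mem_nhds ht))

lemma continuousOn_peanoBaker (hJ : IsOpen J) (hJc : J.OrdConnected) (ht₀ : t₀ ∈ J)
    (hA : ContinuousOn A J) (n : ℕ) : ContinuousOn (peanoBaker A t₀ x₀ n) J := by
  induction n with
  | zero => exact continuousOn_const
  | succ n ih => exact fun t ht => (hasDerivAt_integral_of_continuousOn hJ hJc ht₀
      (hA.clm_apply ih) ht).continuousAt.continuousWithinAt

lemma hasDerivAt_tsum_peanoBaker (hJ : IsOpen J) (hJc : J.OrdConnected) (ht₀ : t₀ ∈ J)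
    (hA : ContinuousOn A J) {t : ℝ} (ht : t ∈ J) :
    HasDerivAt (fun t => ∑' n, peanoBaker A t₀ x₀ n t) (A t (∑' n, peanoBaker A t₀ x₀ n t)) t := by
  obtain ⟨a, b, ht₀ab, htab, hsub⟩ := exists_mem_Ioo_Icc_subset hJ hJc ht₀ ht
  have hIcc : ∀ s ∈ Ioo a b, s ∈ Icc a b := fun s hs => Ioo_subset_Icc_self hs
  obtain ⟨C, hC⟩ := isCompact_Icc.bddAbove_image (hA.norm.mono hsub)
  replace hC : ∀ s ∈ Icc a b, ‖A s‖ ≤ C := fun s hs => hC (mem_image_of_mem _ hs)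
  have hC0 : 0 ≤ C := (norm_nonneg _).trans (hC t₀ (hIcc t₀ ht₀ab))
  have hle : ∀ n, ∀ s ∈ Icc a b,
      ‖peanoBaker A t₀ x₀ n s‖ ≤ (C * (b - a)) ^ n / n ! * ‖x₀‖ := fun n s hs => by
    refine (norm_peanoBaker_le (hIcc t₀ ht₀ab) hC n s hs).trans ?_
    gcongr
    exact abs_sub_le_iff.2 ⟨by linarith [hs.2, ht₀ab.1], by linarith [hs.1, ht₀ab.2]⟩
  have hmajorant : Summable fun n : ℕ => (C * (b - a)) ^ n / n ! * ‖x₀‖ :=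
    (Real.summable_pow_div_factorial _).mul_right _
  have hsummable : ∀ s ∈ Ioo a b, Summable fun n => peanoBaker A t₀ x₀ n s := fun s hs =>
    .of_norm_bounded hmajorant fun n => hle n s (hIcc s hs)
  have htail : HasDerivAt (fun s => ∑' n, peanoBaker A t₀ x₀ (n + 1) s)
      (∑' n, A t (peanoBaker A t₀ x₀ n t)) t := by
    refine hasDerivAt_tsum_of_isPreconnected (𝕜 := ℝ)
      (g' := fun n s => A s (peanoBaker A t₀ x₀ n s))
      (hmajorant.mul_left C) isOpen_Ioo isPreconnected_Ioo (fun n s hs => ?_) (fun n s hs => ?_)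
      ht₀ab ((summable_nat_add_iff 1).2 (hsummable t₀ ht₀ab)) htab
    · exact hasDerivAt_integral_of_continuousOn hJ hJc ht₀
        (hA.clm_apply (continuousOn_peanoBaker hJ hJc ht₀ hA n)) (hsub (hIcc s hs))
    · exact (A s).le_of_opNorm_le_of_le (hC s (hIcc s hs)) (hle n s (hIcc s hs))
  rw [← (A t).map_tsum (hsummable t htab)] at htail
  refine (htail.const_add x₀).congr_of_eventuallyEq ?_
  filter_upwards [isOpen_Ioo.mem_nhds htab] with s hs
  exact (hsummable s hs).tsum_eq_zero_add

lemma exists_hasDerivAt_clm (hJ : IsOpen J) (hJc : J.OrdConnected) (ht₀ : t₀ ∈ J)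
    (hA : ContinuousOn A J) (x₀ : E) :
    ∃ x : ℝ → E, x t₀ = x₀ ∧ ∀ t ∈ J, HasDerivAt x (A t (x t)) t := by
  refine ⟨fun t => ∑' n, peanoBaker A t₀ x₀ n t, ?_,
    fun t ht => hasDerivAt_tsum_peanoBaker hJ hJc ht₀ hA ht⟩
  refine (tsum_eq_single 0 fun n hn => ?_).trans rfl
  obtain ⟨m, rfl⟩ := Nat.exists_eq_succ_of_ne_zero hn
  exact intervalIntegral.integral_same

end LinearODE

section MatrixSystem

open Set
open scoped Kronecker

variable {𝕜 V ι κ : Type*} [RCLike 𝕜] [NormedAddCommGroup V] [NormedSpace ℝ V] [NormedSpace 𝕜 V]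
  [Fintype ι] {J : Set ℝ} {t₀ : ℝ} {M : ℝ → Matrix ι ι 𝕜}

/-- The linear system `X' = M X` on `J`, whose unknown `X` is a tuple of curves in a vector space:
scalar systems and the systems for vectors such as `r, ṙ, r ∧ ṙ` are both of this kind. -/
def SolvesMatrixSystem (M : ℝ → Matrix ι ι 𝕜) (J : Set ℝ) (X : ℝ → ι → V) : Prop :=
  ∀ t ∈ J, ∀ i, HasDerivAt (fun s => X s i) (∑ j, M t i j • X t j) t

variable (V) in
/-- The action of a matrix on tuples of vectors, as a continuous linear map. -/
noncomputable def matrixCLM [SMulCommClass ℝ 𝕜 V] [DecidableEq ι] (M : Matrix ι ι 𝕜) :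
    (ι → V) →L[ℝ] ι → V :=
  ∑ i, ∑ j, (ContinuousLinearMap.single ℝ (fun _ => V) i).comp
    (M i j • ContinuousLinearMap.proj (R := ℝ) (φ := fun _ : ι => V) j)

lemma matrixCLM_apply [SMulCommClass ℝ 𝕜 V] [DecidableEq ι] (M : Matrix ι ι 𝕜)
    (x : ι → V) (i : ι) :
    matrixCLM V M x i = ∑ j, M i j • x j := by
  simp [matrixCLM, Pi.single_apply, Finset.sum_ite_irrel]

lemma continuousOn_matrixCLM [SMulCommClass ℝ 𝕜 V] [DecidableEq ι]
    (hM : ∀ i j, ContinuousOn (fun t => M t i j) J) :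
    ContinuousOn (fun t => matrixCLM V (M t)) J := by
  unfold matrixCLM
  fun_prop

lemma solvesMatrixSystem_iff_matrixCLM [SMulCommClass ℝ 𝕜 V] [DecidableEq ι]
    {X : ℝ → ι → V} :
    SolvesMatrixSystem M J X ↔ ∀ t ∈ J, HasDerivAt X (matrixCLM V (M t) (X t)) t := by
  simp only [SolvesMatrixSystem, hasDerivAt_pi, matrixCLM_apply]

lemma SolvesMatrixSystem.eqOn [SMulCommClass ℝ 𝕜 V] (hJc : J.OrdConnected) (ht₀ : t₀ ∈ J)
    (hM : ∀ i j, ContinuousOn (fun t => M t i j) J) {X Y : ℝ → ι → V}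
    (hX : SolvesMatrixSystem M J X) (hY : SolvesMatrixSystem M J Y) (h₀ : X t₀ = Y t₀) :
    EqOn X Y J := by
  classical
  exact eqOn_of_hasDerivAt_clm hJc ht₀ (continuousOn_matrixCLM hM)
    (solvesMatrixSystem_iff_matrixCLM.1 hX) (solvesMatrixSystem_iff_matrixCLM.1 hY) h₀

lemma exists_solvesMatrixSystem [SMulCommClass ℝ 𝕜 V] [CompleteSpace V] (hJ : IsOpen J)
    (hJc : J.OrdConnected) (ht₀ : t₀ ∈ J) (hM : ∀ i j, ContinuousOn (fun t => M t i j) J)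
    (x₀ : ι → V) : ∃ X : ℝ → ι → V, X t₀ = x₀ ∧ SolvesMatrixSystem M J X := by
  classical
  simpa only [solvesMatrixSystem_iff_matrixCLM] using
    exists_hasDerivAt_clm hJ hJc ht₀ (continuousOn_matrixCLM (V := V) hM) x₀

lemma SolvesMatrixSystem.sum_smul_const [IsScalarTower ℝ 𝕜 V] [Fintype κ] {X : κ → ℝ → ι → 𝕜}
    (hX : ∀ k, SolvesMatrixSystem M J (X k)) (e : κ → V) :
    SolvesMatrixSystem M J fun t i => ∑ k, X k t i • e k := by
  intro t ht i
  refine (HasDerivAt.fun_sum fun k _ => (hX k t ht i).smul_const (e k)).congr_deriv ?_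
  simp only [Finset.sum_smul, Finset.smul_sum, smul_assoc]
  exact Finset.sum_comm

lemma SolvesMatrixSystem.add {X Y : ℝ → ι → V} (hX : SolvesMatrixSystem M J X)
    (hY : SolvesMatrixSystem M J Y) : SolvesMatrixSystem M J (X + Y) := by
  intro t ht i
  refine ((hX t ht i).add (hY t ht i)).congr_deriv ?_
  simp only [Pi.add_apply, smul_add, Finset.sum_add_distrib]

lemma SolvesMatrixSystem.clm_comp {E F : Type*} [NormedAddCommGroup E] [NormedSpace ℝ E]
    [NormedAddCommGroup F] [NormedSpace ℝ F] {M : ℝ → Matrix ι ι ℝ} {X : ℝ → ι → E}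
    (hX : SolvesMatrixSystem M J X) (L : E →L[ℝ] F) :
    SolvesMatrixSystem M J fun t i => L (X t i) := by
  intro t ht i
  refine (L.hasFDerivAt.comp_hasDerivAt t (hX t ht i)).congr_deriv ?_
  simp only [map_sum, map_smul]

variable {W : Type*} [NormedAddCommGroup W] [InnerProductSpace ℝ W]

/- The Gram matrix `Γ` of a solution satisfies `Γ' = M Γ + Γ Mᵀ`, a linear system whose matrix is
the Kronecker sum of two copies of `M`. -/
lemma SolvesMatrixSystem.inner_eq {M : ℝ → Matrix ι ι ℝ} (hJc : J.OrdConnected) (ht₀ : t₀ ∈ J)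
    (hM : ∀ i j, ContinuousOn (fun t => M t i j) J) {X : ℝ → ι → W}
    (hX : SolvesMatrixSystem M J X) {S : ℝ → ι → ι → ℝ}
    (hS : ∀ t ∈ J, ∀ i j,
      HasDerivAt (fun s => S s i j) (∑ l, M t i l * S t l j + ∑ l, M t j l * S t i l) t)
    (h₀ : ∀ i j, inner ℝ (X t₀ i) (X t₀ j) = S t₀ i j) {t : ℝ} (ht : t ∈ J) (i j : ι) :
    inner ℝ (X t i) (X t j) = S t i j := by
  classical
  let N : ℝ → Matrix (ι × ι) (ι × ι) ℝ := fun t => M t ⊗ₖ 1 + 1 ⊗ₖ M t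
  have hN : ∀ p q, ContinuousOn (fun t => N t p q) J := fun p q => by
    simp only [N, Matrix.add_apply]
    exact ((hM _ _).mul continuousOn_const).add (continuousOn_const.mul (hM _ _))
  have hNsum : ∀ (t : ℝ) (Γ : ι → ι → ℝ) (p : ι × ι), ∑ q, N t p q • Γ q.1 q.2 =
      ∑ l, M t p.1 l * Γ l p.2 + ∑ l, M t p.2 l * Γ p.1 l := fun t Γ p => by
    simp [N, Fintype.sum_prod_type, add_mul, Finset.sum_add_distrib, Matrix.one_apply]
  refine congrFun (SolvesMatrixSystem.eqOn (M := N) (V := ℝ) hJc ht₀ hN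
    (X := fun t p => inner ℝ (X t p.1) (X t p.2)) (Y := fun t p => S t p.1 p.2)
    (fun t ht p => ?_) (fun t ht p => ?_) (funext fun p => h₀ p.1 p.2) ht) (i, j)
  · refine ((hX t ht p.1).inner ℝ (hX t ht p.2)).congr_deriv ?_
    rw [hNsum t fun i j => inner ℝ (X t i) (X t j)]
    simp only [inner_sum, sum_inner, real_inner_smul_left, real_inner_smul_right]
    exact add_comm _ _
  · exact (hS t ht p.1 p.2).congr_deriv (hNsum t (S t) p).symm

end MatrixSystem

section Wedge

lemma wedge_zero_apply (x y : E3) : wedge x y 0 = x 1 * y 2 - x 2 * y 1 := by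
  simp [wedge, cross_apply]

lemma wedge_one_apply (x y : E3) : wedge x y 1 = x 2 * y 0 - x 0 * y 2 := by
  simp [wedge, cross_apply]

lemma wedge_two_apply (x y : E3) : wedge x y 2 = x 0 * y 1 - x 1 * y 0 := by
  simp [wedge, cross_apply]

lemma inner_E3 (x y : E3) : inner ℝ x y = x 0 * y 0 + x 1 * y 1 + x 2 * y 2 := by
  simp [PiLp.inner_apply, Fin.sum_univ_three, mul_comm]

lemma wedge_self (x : E3) : wedge x x = 0 := by
  simp [wedge]

lemma inner_wedge_left (x y : E3) : inner ℝ x (wedge x y) = 0 := by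
  rw [inner_E3, wedge_zero_apply, wedge_one_apply, wedge_two_apply]; ring

lemma inner_wedge_right (x y : E3) : inner ℝ y (wedge x y) = 0 := by
  rw [inner_E3, wedge_zero_apply, wedge_one_apply, wedge_two_apply]; ring

lemma inner_wedge_wedge (x y : E3) :
    inner ℝ (wedge x y) (wedge x y) = inner ℝ x x * inner ℝ y y - inner ℝ x y ^ 2 := by
  simp only [inner_E3, wedge_zero_apply, wedge_one_apply, wedge_two_apply]; ring

lemma wedge_wedge (x y : E3) :
    wedge x (wedge x y) = inner ℝ x y • x - inner ℝ x x • y := by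
  ext i
  fin_cases i <;>
    simp only [Fin.zero_eta, Fin.mk_one, Fin.reduceFinMk, inner_E3, wedge_zero_apply,
      wedge_one_apply, wedge_two_apply, PiLp.sub_apply, PiLp.smul_apply, smul_eq_mul] <;>
    ring

/-- The vector product as a continuous bilinear map. -/
noncomputable def wedgeL : E3 →L[ℝ] E3 →L[ℝ] E3 :=
  LinearMap.toContinuousBilinearMap (LinearMap.mk₂ ℝ wedge
    (fun x y z => by simp [wedge]) (fun c x y => by simp [wedge])
    (fun x y z => by simp [wedge]) (fun c x y => by simp [wedge]))

lemma wedgeL_apply (x y : E3) : wedgeL x y = wedge x y := rfl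

lemma hasDerivAt_wedge {x y : ℝ → E3} {x' y' : E3} {t : ℝ} (hx : HasDerivAt x x' t)
    (hy : HasDerivAt y y' t) :
    HasDerivAt (fun t => wedge (x t) (y t)) (wedge (x t) y' + wedge x' (y t)) t :=
  wedgeL.hasDerivAt_of_bilinear (fun _ => hx) (fun _ => hy)

end Wedge

section Chi

variable (r₀ v₀ : E3)

lemma norm_wedge_sq : ‖wedge r₀ v₀‖ ^ 2 = alpha r₀ * speed v₀ ^ 2 - beta r₀ v₀ ^ 2 := by
  rw [← real_inner_self_eq_norm_sq, inner_wedge_wedge, real_inner_self_eq_norm_sq,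
    real_inner_self_eq_norm_sq, alpha, speed, beta]

lemma hasDerivAt_chi (t : ℝ) :
    HasDerivAt (chi r₀ v₀) (2 * (beta r₀ v₀ + speed v₀ ^ 2 * t)) t := by
  refine ((((hasDerivAt_id t).const_mul (2 * beta r₀ v₀)).const_add (alpha r₀)).add
    (((hasDerivAt_id t).pow 2).const_mul (speed v₀ ^ 2))).congr_deriv ?_
  simp only [id, mul_one, Nat.cast_ofNat, Nat.add_one_sub_one, pow_one]
  ring

lemma deriv_chi (t : ℝ) : deriv (chi r₀ v₀) t = 2 * (beta r₀ v₀ + speed v₀ ^ 2 * t) :=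
  (hasDerivAt_chi r₀ v₀ t).deriv

lemma continuous_chi : Continuous (chi r₀ v₀) := by
  unfold chi
  fun_prop

end Chi

section Conservation

variable {J : Set ℝ} {r₀ v₀ : E3} {H : ℝ → ℝ → ℝ} {r : ℝ → E3}

lemma IsMotion.inner_deriv_self (hJc : J.OrdConnected) (hJ0 : (0 : ℝ) ∈ J) (hr : IsMotion H J r)
    (h₁ : deriv r 0 = v₀) {t : ℝ} (ht : t ∈ J) :
    inner ℝ (deriv r t) (deriv r t) = speed v₀ ^ 2 := by
  refine eqOn_of_hasDerivAt_eq (x := fun t => inner ℝ (deriv r t) (deriv r t))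
    (y := fun _ => speed v₀ ^ 2) hJc hJ0 (fun t ht => ?_) (fun t _ => hasDerivAt_const t _) ?_ ht
  · refine ((hr t ht).2.inner ℝ (hr t ht).2).congr_deriv ?_
    simp [real_inner_smul_right, inner_wedge_right, real_inner_comm]
  · rw [h₁, real_inner_self_eq_norm_sq, speed]

lemma IsMotion.inner_deriv (hJc : J.OrdConnected) (hJ0 : (0 : ℝ) ∈ J) (hr : IsMotion H J r)
    (h₀ : r 0 = r₀) (h₁ : deriv r 0 = v₀) {t : ℝ} (ht : t ∈ J) :
    inner ℝ (r t) (deriv r t) = beta r₀ v₀ + speed v₀ ^ 2 * t := by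
  refine eqOn_of_hasDerivAt_eq (x := fun t => inner ℝ (r t) (deriv r t))
    (y := fun t => beta r₀ v₀ + speed v₀ ^ 2 * t) (x' := fun _ => speed v₀ ^ 2)
    hJc hJ0 (fun t ht => ?_) (fun t _ => ?_) (by simp [h₀, h₁, beta]) ht
  · refine ((hr t ht).1.hasDerivAt.inner ℝ (hr t ht).2).congr_deriv ?_
    rw [real_inner_smul_right, inner_wedge_left, hr.inner_deriv_self hJc hJ0 h₁ ht]
    simp
  · simpa using ((hasDerivAt_id t).const_mul (speed v₀ ^ 2)).const_add (beta r₀ v₀)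

lemma IsMotion.norm_sq (hJc : J.OrdConnected) (hJ0 : (0 : ℝ) ∈ J) (hr : IsMotion H J r)
    (h₀ : r 0 = r₀) (h₁ : deriv r 0 = v₀) {t : ℝ} (ht : t ∈ J) : ‖r t‖ ^ 2 = chi r₀ v₀ t := by
  refine eqOn_of_hasDerivAt_eq (x := fun t => ‖r t‖ ^ 2) hJc hJ0 (fun t ht => ?_)
    (fun t _ => hasDerivAt_chi r₀ v₀ t) (by simp [h₀, chi, alpha]) ht
  rw [← hr.inner_deriv hJc hJ0 h₀ h₁ ht]
  exact (hr t ht).1.hasDerivAt.norm_sq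

theorem IsMotion.conservation (hJc : J.OrdConnected) (hJ0 : (0 : ℝ) ∈ J) (hr : IsMotion H J r)
    (h₀ : r 0 = r₀) (h₁ : deriv r 0 = v₀) {t : ℝ} (ht : t ∈ J) :
    ‖deriv r t‖ = speed v₀ ∧ ‖r t‖ ^ 2 = chi r₀ v₀ t ∧
      inner ℝ (r t) (deriv r t) = beta r₀ v₀ + speed v₀ ^ 2 * t := by
  refine ⟨?_, hr.norm_sq hJc hJ0 h₀ h₁ ht, hr.inner_deriv hJc hJ0 h₀ h₁ ht⟩
  refine (sq_eq_sq₀ (norm_nonneg _) (norm_nonneg _)).1 ?_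
  rw [← real_inner_self_eq_norm_sq, hr.inner_deriv_self hJc hJ0 h₁ ht, speed]

end Conservation

section ThirdOrder

open Set Filter Topology

lemma deriv_eventuallyEq_of_isOpen {𝕜 E : Type*} [NontriviallyNormedField 𝕜]
    [NormedAddCommGroup E] [NormedSpace 𝕜 E] {J : Set 𝕜} (hJ : IsOpen J) {x x' : 𝕜 → E}
    (hx : ∀ t ∈ J, HasDerivAt x (x' t) t) {t : 𝕜} (ht : t ∈ J) : deriv x =ᶠ[𝓝 t] x' := by
  filter_upwards [hJ.mem_nhds ht] with s hs using (hx s hs).deriv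

variable {V : Type*} [NormedAddCommGroup V] [NormedSpace ℝ V]
  {J : Set ℝ} {r₀ v₀ : E3} {h : ℝ → ℝ}

/-- The matrix of the third-order equation, written as a first-order system for `F`, `Ḟ` and
`F̈ / h`. -/
noncomputable def thirdOrderMatrix (h : ℝ → ℝ) (r₀ v₀ : E3) (t : ℝ) : Matrix (Fin 3) (Fin 3) ℝ :=
  !![0, 1, 0; 0, 0, h t; h t * (beta r₀ v₀ + speed v₀ ^ 2 * t), -(h t * chi r₀ v₀ t), 0]

lemma continuousOn_thirdOrderMatrix (hh : ContinuousOn h J) (i j : Fin 3) :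
    ContinuousOn (fun t => thirdOrderMatrix h r₀ v₀ t i j) J := by
  have hχ := (continuous_chi r₀ v₀).continuousOn (s := J)
  fin_cases i <;> fin_cases j <;>
    simp only [thirdOrderMatrix, Fin.zero_eta, Fin.mk_one, Fin.reduceFinMk, Matrix.of_apply,
      Matrix.cons_val] <;>
    fun_prop

lemma solvesMatrixSystem_thirdOrderMatrix_iff {F D G : ℝ → V} :
    SolvesMatrixSystem (thirdOrderMatrix h r₀ v₀) J (fun t => ![F t, D t, G t]) ↔
      ∀ t ∈ J, HasDerivAt F (D t) t ∧ HasDerivAt D (h t • G t) t ∧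
        HasDerivAt G (h t • ((beta r₀ v₀ + speed v₀ ^ 2 * t) • F t - chi r₀ v₀ t • D t)) t := by
  simp [SolvesMatrixSystem, Fin.forall_fin_succ, Fin.sum_univ_three, thirdOrderMatrix, smul_smul,
    sub_eq_add_neg]

lemma SolvesThirdOrder.solvesMatrixSystem (hh : ∀ t ∈ J, DifferentiableAt ℝ h t ∧ h t ≠ 0)
    {x₀ x₁ x₂ : ℝ} {F : ℝ → ℝ} (hF : SolvesThirdOrder h r₀ v₀ J x₀ x₁ x₂ F) :
    SolvesMatrixSystem (thirdOrderMatrix h r₀ v₀) J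
      (fun t => ![F t, deriv F t, deriv (deriv F) t / h t]) := by
  refine solvesMatrixSystem_thirdOrderMatrix_iff.2 fun t ht => ?_
  obtain ⟨hF₁, hF₂, hF₃⟩ := hF.1 t ht
  obtain ⟨hd, hne⟩ := hh t ht
  refine ⟨hF₁.hasDerivAt, hF₂.hasDerivAt.congr_deriv ?_,
    (hF₃.div hd.hasDerivAt hne).congr_deriv ?_⟩
  · simp only [smul_eq_mul]
    field_simp
  · simp only [smul_eq_mul, deriv_chi]
    field_simp
    ring

lemma solvesThirdOrder_of_solvesMatrixSystem (hJ : IsOpen J) (hJ0 : (0 : ℝ) ∈ J)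
    (hh : ∀ t ∈ J, DifferentiableAt ℝ h t ∧ h t ≠ 0) {X : ℝ → Fin 3 → ℝ}
    (hX : SolvesMatrixSystem (thirdOrderMatrix h r₀ v₀) J X) {x₀ x₁ x₂ : ℝ}
    (hX₀ : X 0 = ![x₀, x₁, x₂ / h 0]) : SolvesThirdOrder h r₀ v₀ J x₀ x₁ x₂ (X · 0) := by
  have hXeta : X = fun t => ![X t 0, X t 1, X t 2] := funext fun t => List.ofFn_inj.1 rfl
  rw [hXeta, solvesMatrixSystem_thirdOrderMatrix_iff] at hX
  have hD : ∀ t ∈ J, deriv (X · 0) =ᶠ[𝓝 t] (X · 1) := fun t ht =>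
    deriv_eventuallyEq_of_isOpen hJ (fun s hs => (hX s hs).1) ht
  have hG : ∀ t ∈ J, deriv (deriv (X · 0)) =ᶠ[𝓝 t] fun t => h t * X t 2 := fun t ht =>
    (hD t ht).deriv.trans (deriv_eventuallyEq_of_isOpen hJ (fun s hs => (hX s hs).2.1) ht)
  refine ⟨fun t ht => ⟨(hX t ht).1.differentiableAt,
    (hX t ht).2.1.differentiableAt.congr_of_eventuallyEq (hD t ht), ?_⟩,
    congrFun hX₀ 0, (hD 0 hJ0).self_of_nhds.trans (congrFun hX₀ 1), ?_⟩
  · obtain ⟨hd, hne⟩ := hh t ht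
    refine ((hd.hasDerivAt.mul (hX t ht).2.2).congr_deriv ?_).congr_of_eventuallyEq (hG t ht)
    rw [(hG t ht).self_of_nhds, (hD t ht).self_of_nhds, deriv_chi]
    simp only [smul_eq_mul]
    field_simp
  · exact (hG 0 hJ0).self_of_nhds.trans
      ((congrArg (h 0 * ·) (congrFun hX₀ 2)).trans (mul_div_cancel₀ _ (hh 0 hJ0).2))

theorem exists_solvesThirdOrder (hJ : IsOpen J) (hJc : J.OrdConnected) (hJ0 : (0 : ℝ) ∈ J)
    (hh : ∀ t ∈ J, DifferentiableAt ℝ h t ∧ h t ≠ 0) (x₀ x₁ x₂ : ℝ) :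
    ∃ F : ℝ → ℝ, SolvesThirdOrder h r₀ v₀ J x₀ x₁ x₂ F := by
  have hhc : ContinuousOn h J := fun t ht => (hh t ht).1.continuousAt.continuousWithinAt
  obtain ⟨X, hX₀, hX⟩ := exists_solvesMatrixSystem (𝕜 := ℝ) hJ hJc hJ0
    (continuousOn_thirdOrderMatrix (r₀ := r₀) (v₀ := v₀) hhc) ![x₀, x₁, x₂ / h 0]
  exact ⟨_, solvesThirdOrder_of_solvesMatrixSystem hJ hJ0 hh hX hX₀⟩

end ThirdOrder

section Motion

open Set Filter Topology

variable {J : Set ℝ} {r₀ v₀ : E3} {h : ℝ → ℝ} {H : ℝ → ℝ → ℝ}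

lemma IsMotion.solvesMatrixSystem (hJc : J.OrdConnected) (hJ0 : (0 : ℝ) ∈ J)
    (hH : ∀ t ∈ J, h t = H t (chi r₀ v₀ t)) {r : ℝ → E3} (hr : IsMotion H J r)
    (h₀ : r 0 = r₀) (h₁ : deriv r 0 = v₀) :
    SolvesMatrixSystem (thirdOrderMatrix h r₀ v₀) J
      (fun t => ![r t, deriv r t, wedge (r t) (deriv r t)]) := by
  refine solvesMatrixSystem_thirdOrderMatrix_iff.2 fun t ht => ?_
  have hnorm := hr.norm_sq hJc hJ0 h₀ h₁ ht
  obtain ⟨hr₁, hr₂⟩ := hr t ht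
  rw [hnorm, ← hH t ht] at hr₂
  refine ⟨hr₁.hasDerivAt, hr₂, (hasDerivAt_wedge hr₁.hasDerivAt hr₂).congr_deriv ?_⟩
  rw [wedge_self, add_zero, ← wedgeL_apply, map_smul, wedgeL_apply, wedge_wedge,
    hr.inner_deriv hJc hJ0 h₀ h₁ ht, real_inner_self_eq_norm_sq, hnorm]

lemma IsMotion.congr (hJ : IsOpen J) {r s : ℝ → E3} (hs : IsMotion H J s) (hrs : EqOn r s J) :
    IsMotion H J r := by
  intro t ht
  have heq : r =ᶠ[𝓝 t] s := hrs.eventuallyEq_of_mem (hJ.mem_nhds ht)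
  obtain ⟨hs₁, hs₂⟩ := hs t ht
  refine ⟨hs₁.congr_of_eventuallyEq heq, ?_⟩
  rw [heq.self_of_nhds, heq.deriv_eq]
  exact hs₂.congr_of_eventuallyEq heq.deriv

/-- The Gram matrix of `r, ṙ, r ∧ ṙ` along a motion. -/
noncomputable def gramMatrix (r₀ v₀ : E3) (t : ℝ) : Matrix (Fin 3) (Fin 3) ℝ :=
  !![chi r₀ v₀ t, beta r₀ v₀ + speed v₀ ^ 2 * t, 0;
    beta r₀ v₀ + speed v₀ ^ 2 * t, speed v₀ ^ 2, 0;
    0, 0, alpha r₀ * speed v₀ ^ 2 - beta r₀ v₀ ^ 2]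

lemma hasDerivAt_gramMatrix (h : ℝ → ℝ) (r₀ v₀ : E3) (t : ℝ) (i j : Fin 3) :
    HasDerivAt (fun s => gramMatrix r₀ v₀ s i j)
      (∑ l, thirdOrderMatrix h r₀ v₀ t i l * gramMatrix r₀ v₀ t l j +
        ∑ l, thirdOrderMatrix h r₀ v₀ t j l * gramMatrix r₀ v₀ t i l) t := by
  have hχ := hasDerivAt_chi r₀ v₀ t
  have hχ' : HasDerivAt (fun s => beta r₀ v₀ + speed v₀ ^ 2 * s) (speed v₀ ^ 2) t := by
    simpa using ((hasDerivAt_id t).const_mul (speed v₀ ^ 2)).const_add (beta r₀ v₀)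
  have hconst := fun c : ℝ => hasDerivAt_const t c
  fin_cases i <;> fin_cases j <;>
    simp only [Fin.sum_univ_three, thirdOrderMatrix, gramMatrix, Fin.zero_eta, Fin.mk_one,
      Fin.reduceFinMk, Matrix.of_apply, Matrix.cons_val]
  · exact hχ.congr_deriv (by ring)
  · exact hχ'.congr_deriv (by ring)
  · exact (hconst 0).congr_deriv (by simp only [chi]; ring)
  · exact hχ'.congr_deriv (by ring)
  · exact (hconst _).congr_deriv (by ring)
  · exact (hconst 0).congr_deriv (by simp only [chi]; ring)
  · exact (hconst 0).congr_deriv (by simp only [chi]; ring)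
  · exact (hconst 0).congr_deriv (by simp only [chi]; ring)
  · exact (hconst _).congr_deriv (by ring)

section Frame

variable {F D G : ℝ → E3} (hJc : J.OrdConnected) (hJ0 : (0 : ℝ) ∈ J) (hh : ContinuousOn h J)
  (hF : SolvesMatrixSystem (thirdOrderMatrix h r₀ v₀) J fun t => ![F t, D t, G t])
  (hF₀ : F 0 = r₀) (hD₀ : D 0 = v₀) (hG₀ : G 0 = wedge r₀ v₀)

include hJc hJ0 hh hF hF₀ hD₀ hG₀

lemma inner_eq_gramMatrix {t : ℝ} (ht : t ∈ J) (i j : Fin 3) :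
    inner ℝ (![F t, D t, G t] i) (![F t, D t, G t] j) = gramMatrix r₀ v₀ t i j := by
  refine hF.inner_eq hJc hJ0 (continuousOn_thirdOrderMatrix hh)
    (fun t _ => hasDerivAt_gramMatrix h r₀ v₀ t) (fun i j => ?_) ht i j
  fin_cases i <;> fin_cases j <;>
    simp [gramMatrix, hF₀, hD₀, hG₀, inner_wedge_left, inner_wedge_right,
      norm_wedge_sq, real_inner_comm, chi, alpha, beta, speed]

lemma eq_wedge_of_solvesMatrixSystem {t : ℝ} (ht : t ∈ J) : G t = wedge (F t) (D t) := by
  have hF' := solvesMatrixSystem_thirdOrderMatrix_iff.1 hF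
  have hFc : ContinuousOn F J := fun t ht => (hF' t ht).1.continuousAt.continuousWithinAt
  have hA : ContinuousOn (fun t => -(h t • wedgeL (F t))) J := by fun_prop
  refine sub_eq_zero.1 (eqOn_of_hasDerivAt_clm (x := fun t => G t - wedge (F t) (D t))
    (y := fun _ => 0) hJc hJ0 hA (fun t ht => ?_)
    (fun t _ => (hasDerivAt_const t 0).congr_deriv (map_zero _).symm) ?_ ht)
  · obtain ⟨hF₁, hF₂, hF₃⟩ := hF' t ht
    have hgram := inner_eq_gramMatrix hJc hJ0 hh hF hF₀ hD₀ hG₀ ht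
    have hFF : inner ℝ (F t) (F t) = chi r₀ v₀ t := hgram 0 0
    have hFD : inner ℝ (F t) (D t) = beta r₀ v₀ + speed v₀ ^ 2 * t := hgram 0 1
    refine (hF₃.sub (hasDerivAt_wedge hF₁ hF₂)).congr_deriv ?_
    rw [wedge_self, add_zero, ← hFF, ← hFD, ← wedge_wedge]
    simp only [← wedgeL_apply, neg_apply, smul_apply, map_smul, map_sub]
    abel
  · simp only [hF₀, hD₀, hG₀, sub_self]

lemma isMotion_of_solvesMatrixSystem (hJ : IsOpen J) (hH : ∀ t ∈ J, h t = H t (chi r₀ v₀ t)) :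
    IsMotion H J F ∧ F 0 = r₀ ∧ deriv F 0 = v₀ := by
  have hF' := solvesMatrixSystem_thirdOrderMatrix_iff.1 hF
  have hD : ∀ t ∈ J, deriv F =ᶠ[𝓝 t] D := fun t ht =>
    deriv_eventuallyEq_of_isOpen hJ (fun s hs => (hF' s hs).1) ht
  refine ⟨fun t ht => ⟨(hF' t ht).1.differentiableAt, ?_⟩, hF₀, (hD 0 hJ0).self_of_nhds.trans hD₀⟩
  have hFF : inner ℝ (F t) (F t) = chi r₀ v₀ t :=
    inner_eq_gramMatrix hJc hJ0 hh hF hF₀ hD₀ hG₀ ht 0 0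
  rw [← real_inner_self_eq_norm_sq, hFF, ← hH t ht, (hD t ht).self_of_nhds,
    ← eq_wedge_of_solvesMatrixSystem hJc hJ0 hh hF hF₀ hD₀ hG₀ ht]
  exact (hF' t ht).2.1.congr_of_eventuallyEq (hD t ht)

end Frame

section Combination

variable (hJc : J.OrdConnected) (hJ0 : (0 : ℝ) ∈ J)
  (hh : ∀ t ∈ J, DifferentiableAt ℝ h t ∧ h t ≠ 0) {F₀ F₁ F₂ : ℝ → ℝ}
  (hF₀ : SolvesThirdOrder h r₀ v₀ J 1 0 0 F₀) (hF₁ : SolvesThirdOrder h r₀ v₀ J 0 1 0 F₁)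
  (hF₂ : SolvesThirdOrder h r₀ v₀ J 0 0 (h 0) F₂)

include hJ0 hh hF₀ hF₁ hF₂

lemma exists_solvesMatrixSystem_combination : ∃ D G : ℝ → E3,
    SolvesMatrixSystem (thirdOrderMatrix h r₀ v₀) J
      (fun t => ![F₀ t • r₀ + F₁ t • v₀ + F₂ t • wedge r₀ v₀, D t, G t]) ∧
    F₀ 0 • r₀ + F₁ 0 • v₀ + F₂ 0 • wedge r₀ v₀ = r₀ ∧ D 0 = v₀ ∧ G 0 = wedge r₀ v₀ := by
  let comb : ℝ → ℝ → ℝ → E3 := fun x y z => x • r₀ + y • v₀ + z • wedge r₀ v₀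
  refine ⟨fun t => comb (deriv F₀ t) (deriv F₁ t) (deriv F₂ t),
    fun t => comb (deriv (deriv F₀) t / h t) (deriv (deriv F₁) t / h t)
      (deriv (deriv F₂) t / h t), ?_, ?_, ?_, ?_⟩
  · have hsys : ∀ k, SolvesMatrixSystem (thirdOrderMatrix h r₀ v₀) J
        fun t => ![![F₀, F₁, F₂] k t, deriv (![F₀, F₁, F₂] k) t,
          deriv (deriv (![F₀, F₁, F₂] k)) t / h t] := by
      rw [Fin.forall_fin_succ, Fin.forall_fin_two]
      exact ⟨hF₀.solvesMatrixSystem hh, hF₁.solvesMatrixSystem hh, hF₂.solvesMatrixSystem hh⟩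
    convert! SolvesMatrixSystem.sum_smul_const hsys ![r₀, v₀, wedge r₀ v₀] using 3 with t i
    fin_cases i <;> simp [comb, Fin.sum_univ_three]
  · simp [hF₀.2.1, hF₁.2.1, hF₂.2.1]
  · simp [comb, hF₀.2.2.1, hF₁.2.2.1, hF₂.2.2.1]
  · simp [comb, hF₀.2.2.2, hF₁.2.2.2, hF₂.2.2.2, (hh 0 hJ0).2]

include hJc in
theorem isMotion_iff_eq_combination (hJ : IsOpen J) (hH : ∀ t ∈ J, h t = H t (chi r₀ v₀ t))
    (r : ℝ → E3) : (IsMotion H J r ∧ r 0 = r₀ ∧ deriv r 0 = v₀) ↔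
      ∀ t ∈ J, r t = F₀ t • r₀ + F₁ t • v₀ + F₂ t • wedge r₀ v₀ := by
  have hhc : ContinuousOn h J := fun t ht => (hh t ht).1.continuousAt.continuousWithinAt
  obtain ⟨D, G, hR, hR₀, hD₀, hG₀⟩ := exists_solvesMatrixSystem_combination hJ0 hh hF₀ hF₁ hF₂
  constructor
  · rintro ⟨hr, h₀, h₁⟩ t ht
    have heq := (hr.solvesMatrixSystem hJc hJ0 hH h₀ h₁).eqOn hJc hJ0
      (continuousOn_thirdOrderMatrix hhc) hR (by simp only [h₀, h₁, hR₀, hD₀, hG₀]) ht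
    exact congrFun heq 0
  · intro hr
    obtain ⟨hmotion, h₀, h₁⟩ := isMotion_of_solvesMatrixSystem hJc hJ0 hhc hR hR₀ hD₀ hG₀ hJ hH
    have heq := EqOn.eventuallyEq_of_mem (s := J) hr (hJ.mem_nhds hJ0)
    exact ⟨hmotion.congr hJ hr, heq.self_of_nhds.trans h₀, heq.deriv_eq.trans h₁⟩

end Combination

end Motion

/-! ### The generating function -/

section NonDegenerate

variable {r₀ v₀ : E3} (hw : wedge r₀ v₀ ≠ 0)

include hw

lemma speed_pos : 0 < speed v₀ := by
  refine norm_pos_iff.2 fun h0 => hw ?_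
  rw [h0, ← wedgeL_apply, map_zero]

lemma parC_pos : 0 < parC r₀ v₀ := div_pos (norm_pos_iff.2 hw) (speed_pos hw)

lemma speed_mul_parA : speed v₀ * parA r₀ v₀ = beta r₀ v₀ :=
  mul_div_cancel₀ _ (speed_pos hw).ne'

lemma parC_sq_add_parA_sq : parC r₀ v₀ ^ 2 + parA r₀ v₀ ^ 2 = alpha r₀ := by
  have hb := (speed_pos hw).ne'
  rw [parC, parA, div_pow, norm_wedge_sq]
  field_simp
  ring

lemma chi_eq (t : ℝ) :
    chi r₀ v₀ t = parC r₀ v₀ ^ 2 + (parA r₀ v₀ + speed v₀ * t) ^ 2 := by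
  rw [chi, ← parC_sq_add_parA_sq hw, ← speed_mul_parA hw]
  ring

lemma chi_pos (t : ℝ) : 0 < chi r₀ v₀ t := by
  have hc := parC_pos hw
  rw [chi_eq hw]
  positivity

end NonDegenerate

section System

open Set Filter Topology

variable {J : Set ℝ} {r₀ v₀ : E3} {h : ℝ → ℝ} {f g f₁ g₁ : ℝ → ℂ} {t : ℝ}

/-- The coefficient matrix of the first-order system for `(f, g)`. -/
noncomputable def systemMatrix (h : ℝ → ℝ) (r₀ v₀ : E3) (t : ℝ) : Matrix (Fin 2) (Fin 2) ℂ :=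
  (I * ((h t : ℂ) / 2)) • !![((parA r₀ v₀ + speed v₀ * t : ℝ) : ℂ), (parC r₀ v₀ : ℂ);
    (parC r₀ v₀ : ℂ), -((parA r₀ v₀ + speed v₀ * t : ℝ) : ℂ)]

lemma continuousOn_systemMatrix (hh : ContinuousOn h J) (i j : Fin 2) :
    ContinuousOn (fun t => systemMatrix h r₀ v₀ t i j) J := by
  have hh' : ContinuousOn (fun t => (h t : ℂ)) J := continuous_ofReal.comp_continuousOn hh
  fin_cases i <;> fin_cases j <;>
    simp only [systemMatrix, Fin.zero_eta, Fin.mk_one, Matrix.smul_apply, Matrix.of_apply,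
      Matrix.cons_val, smul_eq_mul] <;>
    fun_prop

lemma solvesSystem_iff_solvesMatrixSystem :
    SolvesSystem h r₀ v₀ J f g ↔
      SolvesMatrixSystem (systemMatrix h r₀ v₀) J (fun t => ![f t, g t]) ∧ f 0 = 1 ∧ g 0 = 0 := by
  simp only [SolvesSystem, SolvesMatrixSystem, systemMatrix, Fin.forall_fin_two,
    Fin.sum_univ_two, Matrix.smul_apply, Matrix.of_apply, Matrix.cons_val, smul_eq_mul, mul_add,
    mul_assoc, add_comm (I * (_ * (-_ * _)))]

lemma exists_solvesSystem (hJ : IsOpen J) (hJc : J.OrdConnected) (hJ0 : (0 : ℝ) ∈ J)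
    (hh : ContinuousOn h J) : ∃ f g : ℝ → ℂ, SolvesSystem h r₀ v₀ J f g := by
  obtain ⟨X, hX0, hX⟩ := exists_solvesMatrixSystem hJ hJc hJ0
    (continuousOn_systemMatrix (r₀ := r₀) (v₀ := v₀) hh) (![1, 0] : Fin 2 → ℂ)
  refine ⟨fun t => X t 0, fun t => X t 1, solvesSystem_iff_solvesMatrixSystem.2 ⟨?_, ?_, ?_⟩⟩
  · convert hX using 2 with t
    ext i
    fin_cases i <;> rfl
  · simp [hX0]
  · simp [hX0]

lemma SolvesSystem.eqOn (hJc : J.OrdConnected) (hJ0 : (0 : ℝ) ∈ J) (hh : ContinuousOn h J)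
    (hf : SolvesSystem h r₀ v₀ J f g) (hf₁ : SolvesSystem h r₀ v₀ J f₁ g₁) : EqOn f f₁ J := by
  rw [solvesSystem_iff_solvesMatrixSystem] at hf hf₁
  have heq := SolvesMatrixSystem.eqOn hJc hJ0 (continuousOn_systemMatrix hh) hf.1 hf₁.1
    (by simp [hf.2, hf₁.2])
  exact fun t ht => congrFun (heq ht) 0

lemma hasDerivAt_affine_ofReal (a b t : ℝ) :
    HasDerivAt (fun t : ℝ => ((a + b * t : ℝ) : ℂ)) (b : ℂ) t := by
  simpa using (((hasDerivAt_id t).const_mul b).const_add a).ofReal_comp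

lemma eq_companion_iff (hw : wedge r₀ v₀ ≠ 0) (hne : h t ≠ 0) (w : ℂ) :
    w = companion h r₀ v₀ f t ↔ deriv f t = I * ((h t : ℂ) / 2) *
      (((parA r₀ v₀ + speed v₀ * t : ℝ) : ℂ) * f t + parC r₀ v₀ * w) := by
  have hc : (parC r₀ v₀ : ℂ) ≠ 0 := ofReal_ne_zero.2 (parC_pos hw).ne'
  have hη : (h t : ℂ) ≠ 0 := ofReal_ne_zero.2 hne
  rw [companion, eq_div_iff hc]
  constructor <;> intro heq
  · field_simp at heq
    linear_combination (-I / 2) * heq + deriv f t * I_sq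
  · rw [heq]
    field_simp
    linear_combination
      (((parA r₀ v₀ + speed v₀ * t : ℝ) : ℂ) * f t + parC r₀ v₀ * w) * I_sq

lemma hasDerivAt_companion (hw : wedge r₀ v₀ ≠ 0) (hd : DifferentiableAt ℝ h t) (hne : h t ≠ 0)
    (hf : SolvesLinear h r₀ v₀ J f) (ht : t ∈ J) :
    HasDerivAt (companion h r₀ v₀ f) (I * ((h t : ℂ) / 2) *
      (-((parA r₀ v₀ + speed v₀ * t : ℝ) : ℂ) * companion h r₀ v₀ f t + parC r₀ v₀ * f t)) t := by
  have hc : (parC r₀ v₀ : ℂ) ≠ 0 := ofReal_ne_zero.2 (parC_pos hw).ne'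
  have hη : (h t : ℂ) ≠ 0 := ofReal_ne_zero.2 hne
  have hs := hasDerivAt_affine_ofReal (parA r₀ v₀) (speed v₀) t
  have hq := ((hasDerivAt_const t (2 : ℂ)).fun_div hd.hasDerivAt.ofReal_comp hη).const_mul I
  refine ((hs.mul (hf t ht).1.hasDerivAt).add (hq.mul (hf t ht).2)).neg.div_const
    (parC r₀ v₀ : ℂ) |>.congr_deriv ?_
  rw [companion, chi_eq hw]
  push_cast
  field_simp
  ring_nf
  simp only [I_sq]
  ring

lemma IsGenerating.solvesSystem (hJ : IsOpen J) (hJ0 : (0 : ℝ) ∈ J) (hw : wedge r₀ v₀ ≠ 0)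
    (hh : ∀ t ∈ J, DifferentiableAt ℝ h t ∧ h t ≠ 0) (hf : IsGenerating h r₀ v₀ J f)
    (hg : EqOn g (companion h r₀ v₀ f) J) : SolvesSystem h r₀ v₀ J f g := by
  obtain ⟨hf, h0, h1⟩ := hf
  refine ⟨fun t ht => ⟨?_, ?_⟩, h0, ?_⟩
  · exact (hf t ht).1.hasDerivAt.congr_deriv ((eq_companion_iff hw (hh t ht).2 _).1 (hg ht))
  · rw [hg ht]
    exact (hasDerivAt_companion hw (hh t ht).1 (hh t ht).2 hf ht).congr_of_eventuallyEq
      (hg.eventuallyEq_of_mem (hJ.mem_nhds ht))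
  · rw [hg hJ0, eq_comm, eq_companion_iff hw (hh 0 hJ0).2, h0, h1]
    push_cast
    ring

lemma SolvesSystem.isGenerating (hJ : IsOpen J) (hJ0 : (0 : ℝ) ∈ J) (hw : wedge r₀ v₀ ≠ 0)
    (hh : ∀ t ∈ J, DifferentiableAt ℝ h t ∧ h t ≠ 0) (hf : SolvesSystem h r₀ v₀ J f g) :
    IsGenerating h r₀ v₀ J f ∧ EqOn g (companion h r₀ v₀ f) J := by
  have hd := fun t (ht : t ∈ J) => (hf.1 t ht).1.deriv
  refine ⟨⟨fun t ht => ⟨(hf.1 t ht).1.differentiableAt, ?_⟩, hf.2.1, ?_⟩,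
    fun t ht => (eq_companion_iff hw (hh t ht).2 _).2 (hd t ht)⟩
  · have hη : (h t : ℂ) ≠ 0 := ofReal_ne_zero.2 (hh t ht).2
    have hs := hasDerivAt_affine_ofReal (parA r₀ v₀) (speed v₀) t
    have hd' := (((hh t ht).1.hasDerivAt.ofReal_comp.div_const 2).const_mul I).mul
      ((hs.mul (hf.1 t ht).1).add ((hf.1 t ht).2.const_mul (parC r₀ v₀ : ℂ)))
    refine (hd'.congr_deriv ?_).congr_of_eventuallyEq
      (deriv_eventuallyEq_of_isOpen hJ (fun s hs => (hf.1 s hs).1) ht)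
    rw [hd t ht, chi_eq hw]
    simp only [Pi.add_apply, Pi.mul_apply]
    push_cast
    field_simp
    ring_nf
    simp only [I_sq]
    ring
  · rw [hd 0 hJ0, hf.2.1, hf.2.2]
    push_cast
    ring

theorem solvesSystem_iff (hJ : IsOpen J) (hJ0 : (0 : ℝ) ∈ J) (hw : wedge r₀ v₀ ≠ 0)
    (hh : ∀ t ∈ J, DifferentiableAt ℝ h t ∧ h t ≠ 0) (f g : ℝ → ℂ) :
    SolvesSystem h r₀ v₀ J f g ↔
      IsGenerating h r₀ v₀ J f ∧ EqOn g (companion h r₀ v₀ f) J :=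
  ⟨fun hf => hf.isGenerating hJ hJ0 hw hh, fun hf => hf.1.solvesSystem hJ hJ0 hw hh hf.2⟩

lemma exists_isGenerating (hJ : IsOpen J) (hJc : J.OrdConnected) (hJ0 : (0 : ℝ) ∈ J)
    (hw : wedge r₀ v₀ ≠ 0) (hh : ∀ t ∈ J, DifferentiableAt ℝ h t ∧ h t ≠ 0) :
    ∃ f : ℝ → ℂ, IsGenerating h r₀ v₀ J f := by
  obtain ⟨f, g, hfg⟩ := exists_solvesSystem (r₀ := r₀) (v₀ := v₀) hJ hJc hJ0
    fun t ht => (hh t ht).1.continuousAt.continuousWithinAt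
  exact ⟨f, (hfg.isGenerating hJ hJ0 hw hh).1⟩

lemma IsGenerating.eqOn (hJ : IsOpen J) (hJc : J.OrdConnected) (hJ0 : (0 : ℝ) ∈ J)
    (hw : wedge r₀ v₀ ≠ 0) (hh : ∀ t ∈ J, DifferentiableAt ℝ h t ∧ h t ≠ 0)
    (hf : IsGenerating h r₀ v₀ J f) (hf₁ : IsGenerating h r₀ v₀ J f₁) : EqOn f f₁ J :=
  (hf.solvesSystem hJ hJ0 hw hh (eqOn_refl _ _)).eqOn hJc hJ0
    (fun t ht => (hh t ht).1.continuousAt.continuousWithinAt)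
    (hf₁.solvesSystem hJ hJ0 hw hh (eqOn_refl _ _))

lemma IsGenerating.congr (hJ : IsOpen J) (hJ0 : (0 : ℝ) ∈ J) (hf : IsGenerating h r₀ v₀ J f)
    (he : EqOn f₁ f J) : IsGenerating h r₀ v₀ J f₁ := by
  have hev : ∀ t ∈ J, f₁ =ᶠ[𝓝 t] f := fun t ht => he.eventuallyEq_of_mem (hJ.mem_nhds ht)
  refine ⟨fun t ht => ⟨(hf.1 t ht).1.congr_of_eventuallyEq (hev t ht), ?_⟩, ?_, ?_⟩
  · rw [he ht, (hev t ht).deriv_eq]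
    exact (hf.1 t ht).2.congr_of_eventuallyEq (hev t ht).deriv
  · rw [he hJ0, hf.2.1]
  · rw [(hev 0 hJ0).deriv_eq, hf.2.2]

lemma isGenerating_iff_eqOn (hJ : IsOpen J) (hJc : J.OrdConnected) (hJ0 : (0 : ℝ) ∈ J)
    (hw : wedge r₀ v₀ ≠ 0) (hh : ∀ t ∈ J, DifferentiableAt ℝ h t ∧ h t ≠ 0)
    (hf₁ : IsGenerating h r₀ v₀ J f₁) (f : ℝ → ℂ) :
    IsGenerating h r₀ v₀ J f ↔ EqOn f f₁ J :=
  ⟨fun hf => hf.eqOn hJ hJc hJ0 hw hh hf₁, fun he => hf₁.congr hJ hJ0 he⟩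

end System

section BasicSolutions

open Set

variable {J : Set ℝ} {r₀ v₀ : E3}
  {h : ℝ → ℝ} {f g : ℝ → ℂ}

/-- The combination `F₀ - i b F₂` of the basic solutions, in terms of the values `z` of `f` and `w`
of `g`: it is quadratic in them without conjugates. -/
noncomputable def quadraticF (r₀ v₀ : E3) (t : ℝ) (z w : ℂ) : ℂ :=
  z ^ 2 - w ^ 2 - 2 * ((parA r₀ v₀ + speed v₀ * t : ℝ) : ℂ) / parC r₀ v₀ * (z * w)

/-- The combination `a F₀ + b F₁` of the basic solutions, in terms of the values `z` of `f` and `w`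
of `g`: it is a Hermitian form in them. -/
noncomputable def hermitianF (r₀ v₀ : E3) (t : ℝ) (z w : ℂ) : ℂ :=
  ((parA r₀ v₀ + speed v₀ * t : ℝ) : ℂ) * (z * conj z - w * conj w)
    + parC r₀ v₀ * (z * conj w + conj z * w)

section Expressions

variable (t : ℝ) (z w : ℂ)

lemma re_quadraticF (hw : wedge r₀ v₀ ≠ 0) :
    ((quadraticF r₀ v₀ t z w).re : ℂ) = pairF0 r₀ v₀ t z w := by
  have hc : (parC r₀ v₀ : ℂ) ≠ 0 := ofReal_ne_zero.2 (parC_pos hw).ne'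
  rw [re_eq_add_conj, quadraticF, pairF0]
  simp only [map_sub, map_mul, map_div₀, map_pow, map_ofNat, conj_ofReal]
  field_simp
  ring

lemma re_hermitianF_sub_quadraticF (hw : wedge r₀ v₀ ≠ 0) :
    (((speed v₀)⁻¹ * (hermitianF r₀ v₀ t z w).re
      + -parA r₀ v₀ / speed v₀ * (quadraticF r₀ v₀ t z w).re : ℝ) : ℂ) = pairF1 r₀ v₀ t z w := by
  push_cast
  rw [re_quadraticF t z w hw, re_eq_add_conj, hermitianF, pairF1]
  simp only [map_add, map_sub, map_mul, conj_ofReal, conj_conj]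
  ring

lemma im_quadraticF (hw : wedge r₀ v₀ ≠ 0) :
    ((-(speed v₀)⁻¹ * (quadraticF r₀ v₀ t z w).im : ℝ) : ℂ) = pairF2 r₀ v₀ t z w := by
  have hc : (parC r₀ v₀ : ℂ) ≠ 0 := ofReal_ne_zero.2 (parC_pos hw).ne'
  have hb : (speed v₀ : ℂ) ≠ 0 := ofReal_ne_zero.2 (speed_pos hw).ne'
  push_cast
  rw [im_eq_sub_conj, quadraticF, pairF2]
  simp only [map_sub, map_mul, map_div₀, map_pow, map_ofNat, conj_ofReal]
  field_simp
  linear_combination (2 * ((parA r₀ v₀ + speed v₀ * t : ℝ) : ℂ) * (z * w - conj z * conj w)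
    - parC r₀ v₀ * (z ^ 2 - conj z ^ 2 - w ^ 2 + conj w ^ 2)) * I_sq

variable {t z w} {η : ℝ} {z' : ℂ}
  (hz : z' = I * ((η : ℂ) / 2) * (((parA r₀ v₀ + speed v₀ * t : ℝ) : ℂ) * z + parC r₀ v₀ * w))

include hz

lemma singleF0_eq_pairF0 (hw : wedge r₀ v₀ ≠ 0) (hη : η ≠ 0) :
    singleF0 r₀ v₀ t η z z' = pairF0 r₀ v₀ t z w := by
  have hc : (parC r₀ v₀ : ℂ) ≠ 0 := ofReal_ne_zero.2 (parC_pos hw).ne'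
  have hη' : (η : ℂ) ≠ 0 := ofReal_ne_zero.2 hη
  rw [singleF0, pairF0, hz]
  simp only [map_mul, map_add, conj_ofReal, conj_I, map_div₀, map_ofNat]
  push_cast
  field_simp
  ring_nf
  simp only [I_sq]
  ring

lemma singleF1_eq_pairF1 (hw : wedge r₀ v₀ ≠ 0) (hη : η ≠ 0)
    (hn : w * conj w = 1 - z * conj z) :
    singleF1 r₀ v₀ t η z z' = pairF1 r₀ v₀ t z w := by
  have hη' : (η : ℂ) ≠ 0 := ofReal_ne_zero.2 hη
  rw [singleF1, pairF1, singleF0_eq_pairF0 hz hw hη, hn, hz]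
  congr 1
  simp only [map_mul, map_add, conj_ofReal, conj_I, map_div₀, map_ofNat]
  field_simp
  ring_nf
  simp only [I_sq]
  ring

lemma singleF2_eq_pairF2 (hw : wedge r₀ v₀ ≠ 0) (hη : η ≠ 0) :
    singleF2 r₀ v₀ t η z z' = pairF2 r₀ v₀ t z w := by
  have hc : (parC r₀ v₀ : ℂ) ≠ 0 := ofReal_ne_zero.2 (parC_pos hw).ne'
  have hb : (speed v₀ : ℂ) ≠ 0 := ofReal_ne_zero.2 (speed_pos hw).ne'
  have hη' : (η : ℂ) ≠ 0 := ofReal_ne_zero.2 hη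
  rw [singleF2, pairF2, hz]
  simp only [map_mul, map_add, conj_ofReal, conj_I, map_div₀, map_ofNat]
  push_cast
  field_simp
  ring_nf
  simp only [I_sq]
  ring

end Expressions

lemma solvesMatrixSystem_quadraticF (hw : wedge r₀ v₀ ≠ 0) (hf : SolvesSystem h r₀ v₀ J f g) :
    SolvesMatrixSystem (thirdOrderMatrix h r₀ v₀) J fun t => ![quadraticF r₀ v₀ t (f t) (g t),
      -(2 * speed v₀ / parC r₀ v₀) * (f t * g t), -I * speed v₀ * (f t ^ 2 + g t ^ 2)] := by
  refine solvesMatrixSystem_thirdOrderMatrix_iff.2 fun t ht => ?_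
  obtain ⟨hf', hg'⟩ := hf.1 t ht
  have hc : (parC r₀ v₀ : ℂ) ≠ 0 := ofReal_ne_zero.2 (parC_pos hw).ne'
  have hs := ((hasDerivAt_affine_ofReal (parA r₀ v₀) (speed v₀) t).const_mul 2).div_const
    (parC r₀ v₀ : ℂ)
  refine ⟨(((hf'.fun_pow 2).sub (hg'.fun_pow 2)).sub (hs.mul (hf'.fun_mul hg'))).congr_deriv ?_,
    ((hf'.fun_mul hg').const_mul _).congr_deriv ?_,
    (((hf'.fun_pow 2).add (hg'.fun_pow 2)).const_mul _).congr_deriv ?_⟩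
  · push_cast
    field_simp
    ring
  · simp only [real_smul]
    field_simp
    ring
  · simp only [real_smul, chi_eq hw, ← speed_mul_parA hw, quadraticF]
    push_cast
    field_simp
    ring_nf
    simp only [I_sq]
    ring

lemma solvesMatrixSystem_hermitianF (hw : wedge r₀ v₀ ≠ 0) (hf : SolvesSystem h r₀ v₀ J f g) :
    SolvesMatrixSystem (thirdOrderMatrix h r₀ v₀) J fun t => ![hermitianF r₀ v₀ t (f t) (g t),
      speed v₀ * (f t * conj (f t) - g t * conj (g t)),
      I * speed v₀ * parC r₀ v₀ * (g t * conj (f t) - f t * conj (g t))] := by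
  refine solvesMatrixSystem_thirdOrderMatrix_iff.2 fun t ht => ?_
  obtain ⟨hf', hg'⟩ := hf.1 t ht
  have hs := hasDerivAt_affine_ofReal (parA r₀ v₀) (speed v₀) t
  have hd := (hf'.fun_mul hf'.star).fun_sub (hg'.fun_mul hg'.star)
  refine ⟨((hs.mul hd).add (((hf'.fun_mul hg'.star).add (hf'.star.fun_mul hg')).const_mul
      (parC r₀ v₀ : ℂ))).congr_deriv ?_, (hd.const_mul _).congr_deriv ?_,
    (((hg'.fun_mul hf'.star).sub (hf'.fun_mul hg'.star)).const_mul _).congr_deriv ?_⟩ <;>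
  simp only [star_def, map_mul, map_add, map_neg, map_div₀, map_ofNat, conj_ofReal, conj_I,
    real_smul, chi_eq hw, ← speed_mul_parA hw, hermitianF]
  · ring
  · ring
  · push_cast
    ring_nf
    simp only [I_sq]
    ring

lemma SolvesSystem.mul_conj_eq (hJc : J.OrdConnected) (hJ0 : (0 : ℝ) ∈ J)
    (hf : SolvesSystem h r₀ v₀ J f g) {t : ℝ} (ht : t ∈ J) :
    g t * conj (g t) = 1 - f t * conj (f t) := by
  suffices EqOn (fun t => f t * conj (f t) + g t * conj (g t)) (fun _ => 1) J from
    eq_sub_of_add_eq' (this ht)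
  refine eqOn_of_hasDerivAt_eq hJc hJ0 (x' := fun _ => 0) (fun t ht => ?_)
    (fun t _ => hasDerivAt_const t 1) (by simp [hf.2])
  obtain ⟨hf', hg'⟩ := hf.1 t ht
  refine ((hf'.fun_mul hf'.star).fun_add (hg'.fun_mul hg'.star)).congr_deriv ?_
  simp only [star_def, map_mul, map_add, map_neg, map_div₀, map_ofNat, conj_ofReal, conj_I]
  ring

lemma SolvesSystem.exists_solvesThirdOrder_pairF (hJ : IsOpen J) (hJ0 : (0 : ℝ) ∈ J)
    (hw : wedge r₀ v₀ ≠ 0) (hh : ∀ t ∈ J, DifferentiableAt ℝ h t ∧ h t ≠ 0)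
    (hf : SolvesSystem h r₀ v₀ J f g) :
    ∃ F₀ F₁ F₂ : ℝ → ℝ, SolvesThirdOrder h r₀ v₀ J 1 0 0 F₀ ∧
      SolvesThirdOrder h r₀ v₀ J 0 1 0 F₁ ∧ SolvesThirdOrder h r₀ v₀ J 0 0 (h 0) F₂ ∧
      ∀ t, (F₀ t : ℂ) = pairF0 r₀ v₀ t (f t) (g t) ∧ (F₁ t : ℂ) = pairF1 r₀ v₀ t (f t) (g t) ∧
        (F₂ t : ℂ) = pairF2 r₀ v₀ t (f t) (g t) := by
  have hb := (speed_pos hw).ne'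
  have hquad := solvesMatrixSystem_quadraticF hw hf
  have hherm := solvesMatrixSystem_hermitianF hw hf
  refine ⟨fun t => (quadraticF r₀ v₀ t (f t) (g t)).re, fun t =>
    (speed v₀)⁻¹ * (hermitianF r₀ v₀ t (f t) (g t)).re
      + -parA r₀ v₀ / speed v₀ * (quadraticF r₀ v₀ t (f t) (g t)).re,
    fun t => -(speed v₀)⁻¹ * (quadraticF r₀ v₀ t (f t) (g t)).im, ?_, ?_, ?_, fun t =>
    ⟨re_quadraticF t _ _ hw, re_hermitianF_sub_quadraticF t _ _ hw, im_quadraticF t _ _ hw⟩⟩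
  · refine solvesThirdOrder_of_solvesMatrixSystem hJ hJ0 hh (hquad.clm_comp reCLM) ?_
    ext i
    fin_cases i <;> simp [quadraticF, hf.2, pow_two]
  · refine solvesThirdOrder_of_solvesMatrixSystem hJ hJ0 hh
      ((hherm.clm_comp ((speed v₀)⁻¹ • reCLM)).add
        (hquad.clm_comp ((-parA r₀ v₀ / speed v₀) • reCLM))) ?_
    ext i
    fin_cases i <;> simp [quadraticF, hermitianF, hf.2, pow_two, hb, div_eq_inv_mul]
  · refine solvesThirdOrder_of_solvesMatrixSystem hJ hJ0 hh
      (hquad.clm_comp ((-(speed v₀)⁻¹) • imCLM)) ?_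
    ext i
    fin_cases i <;> simp [quadraticF, hf.2, pow_two, hb, (hh 0 hJ0).2]

theorem IsGenerating.exists_basicSolutions (hJ : IsOpen J) (hJc : J.OrdConnected)
    (hJ0 : (0 : ℝ) ∈ J) (hw : wedge r₀ v₀ ≠ 0)
    (hh : ∀ t ∈ J, DifferentiableAt ℝ h t ∧ h t ≠ 0) (hf : IsGenerating h r₀ v₀ J f)
    (hg : g = companion h r₀ v₀ f) :
    (∀ t ∈ J, g t * conj (g t) = 1 - f t * conj (f t)) ∧
    ∃ F₀ F₁ F₂ : ℝ → ℝ,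
      (∀ t ∈ J, (F₀ t : ℂ) = pairF0 r₀ v₀ t (f t) (g t) ∧
        (F₁ t : ℂ) = pairF1 r₀ v₀ t (f t) (g t) ∧ (F₂ t : ℂ) = pairF2 r₀ v₀ t (f t) (g t) ∧
        (F₀ t : ℂ) = singleF0 r₀ v₀ t (h t) (f t) (deriv f t) ∧
        (F₁ t : ℂ) = singleF1 r₀ v₀ t (h t) (f t) (deriv f t) ∧
        (F₂ t : ℂ) = singleF2 r₀ v₀ t (h t) (f t) (deriv f t)) ∧
      SolvesThirdOrder h r₀ v₀ J 1 0 0 F₀ ∧ SolvesThirdOrder h r₀ v₀ J 0 1 0 F₁ ∧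
      SolvesThirdOrder h r₀ v₀ J 0 0 (h 0) F₂ := by
  have hs := (solvesSystem_iff hJ hJ0 hw hh f g).2 ⟨hf, fun t _ => congrFun hg t⟩
  have hn : ∀ t ∈ J, g t * conj (g t) = 1 - f t * conj (f t) := fun t ht =>
    hs.mul_conj_eq hJc hJ0 ht
  obtain ⟨F₀, F₁, F₂, h₀, h₁, h₂, hF⟩ := hs.exists_solvesThirdOrder_pairF hJ hJ0 hw hh
  refine ⟨hn, F₀, F₁, F₂, fun t ht => ?_, h₀, h₁, h₂⟩
  have hd := (hs.1 t ht).1.deriv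
  have hη := (hh t ht).2
  obtain ⟨e₀, e₁, e₂⟩ := hF t
  exact ⟨e₀, e₁, e₂, e₀.trans (singleF0_eq_pairF0 hd hw hη).symm,
    e₁.trans (singleF1_eq_pairF1 hd hw hη (hn t ht)).symm,
    e₂.trans (singleF2_eq_pairF2 hd hw hη).symm⟩

end BasicSolutions

section NormalForm

open Set

variable {J : Set ℝ} {ρ r r' p q f φ : ℝ → ℂ}

lemma hasDerivAt_deriv_mul (hJ : IsOpen J) (hρ : ∀ t ∈ J, HasDerivAt ρ (r t * ρ t) t)
    (hr : ∀ t ∈ J, HasDerivAt r (r' t) t) (hf : ∀ t ∈ J, f t = ρ t * φ t)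
    (hφ : ∀ t ∈ J, DifferentiableAt ℝ φ t ∧
      HasDerivAt (deriv φ) (p t * deriv φ t + q t * φ t) t) :
    ∀ t ∈ J, DifferentiableAt ℝ f t ∧ HasDerivAt (deriv f)
      ((p t + 2 * r t) * deriv f t + (q t - p t * r t - r t ^ 2 + r' t) * f t) t := by
  have hd : ∀ t ∈ J, HasDerivAt f (ρ t * (r t * φ t + deriv φ t)) t := fun t ht =>
    (((hρ t ht).mul (hφ t ht).1.hasDerivAt).congr_deriv (by ring)).congr_of_eventuallyEq
      (Filter.eventuallyEq_of_mem (hJ.mem_nhds ht) hf)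
  refine fun t ht => ⟨(hd t ht).differentiableAt, (((hρ t ht).fun_mul
    (((hr t ht).fun_mul (hφ t ht).1.hasDerivAt).fun_add (hφ t ht).2)).congr_deriv
    ?_).congr_of_eventuallyEq (deriv_eventuallyEq_of_isOpen hJ hd ht)⟩
  rw [(hd t ht).deriv, hf t ht]
  ring

lemma hasDerivAt_deriv_mul_iff (hJ : IsOpen J) (hρ : ∀ t ∈ J, HasDerivAt ρ (r t * ρ t) t)
    (hρ₀ : ∀ t ∈ J, ρ t ≠ 0) (hr : ∀ t ∈ J, HasDerivAt r (r' t) t)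
    (hf : ∀ t ∈ J, f t = ρ t * φ t) :
    (∀ t ∈ J, DifferentiableAt ℝ f t ∧ HasDerivAt (deriv f)
        ((p t + 2 * r t) * deriv f t + (q t - p t * r t - r t ^ 2 + r' t) * f t) t) ↔
      ∀ t ∈ J, DifferentiableAt ℝ φ t ∧
        HasDerivAt (deriv φ) (p t * deriv φ t + q t * φ t) t := by
  refine ⟨fun h => ?_, hasDerivAt_deriv_mul hJ hρ hr hf⟩
  have hρ_inv : ∀ t ∈ J, HasDerivAt (fun t => (ρ t)⁻¹) (-r t * (ρ t)⁻¹) t := fun t ht =>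
    ((hρ t ht).fun_inv (hρ₀ t ht)).congr_deriv (by field [hρ₀ t ht])
  refine fun t ht => (hasDerivAt_deriv_mul (f := φ) hJ hρ_inv (fun t ht => (hr t ht).fun_neg)
    (fun t ht => ?_) h t ht).imp_right fun h' => h'.congr_deriv (by ring)
  rw [hf t ht, inv_mul_cancel_left₀ (hρ₀ t ht)]

end NormalForm

section Schroedinger

variable {J : Set ℝ} {r₀ v₀ : E3} {h : ℝ → ℝ} {f φ : ℝ → ℂ}

lemma cpow_half_sq (x : ℂ) : (x ^ (1 / 2 : ℂ)) ^ 2 = x := by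
  rw [← cpow_nat_mul]
  norm_num

lemma cpow_half_ne_zero {x : ℂ} (hx : x ≠ 0) : x ^ (1 / 2 : ℂ) ≠ 0 := by
  simp [cpow_eq_zero_iff, hx]

lemma cpow_neg_half (x : ℂ) : x ^ (-1 / 2 : ℂ) = (x ^ (1 / 2 : ℂ))⁻¹ := by
  rw [← cpow_neg, neg_div]

lemma cpow_neg_three_half (x : ℂ) : x ^ (-3 / 2 : ℂ) = ((x ^ (1 / 2 : ℂ)) ^ 3)⁻¹ := by
  rw [← cpow_nat_mul, ← cpow_neg]
  norm_num

lemma hasDerivAt_ofReal_cpow_half {h' t : ℝ} (hh : HasDerivAt h h' t) (h₀ : h t ≠ 0) :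
    HasDerivAt (fun t => (h t : ℂ) ^ (1 / 2 : ℂ))
      (((h' / (2 * h t) : ℝ) : ℂ) * (h t : ℂ) ^ (1 / 2 : ℂ)) t := by
  have hne : (h t : ℂ) ≠ 0 := ofReal_ne_zero.2 h₀
  refine ((hasDerivAt_ofReal_cpow_const (r := 1 / 2) h₀ (by norm_num)).scomp t hh).congr_deriv ?_
  rw [cpow_sub _ _ hne, cpow_one, real_smul]
  push_cast
  field_simp

lemma hasDerivAt_half_logDeriv {t : ℝ} (hh : DifferentiableAt ℝ h t)
    (hh' : DifferentiableAt ℝ (deriv h) t) (h₀ : h t ≠ 0) :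
    HasDerivAt (fun t => ((deriv h t / (2 * h t) : ℝ) : ℂ))
      (((deriv (deriv h) t * h t - deriv h t ^ 2) / (2 * h t ^ 2) : ℝ) : ℂ) t :=
  ((hh'.hasDerivAt.div (hh.hasDerivAt.const_mul 2)
    (mul_ne_zero two_ne_zero h₀)).congr_deriv (by field)).ofReal_comp

lemma solvesLinear_iff_solvesSchroedinger (hJ : IsOpen J)
    (hh : ∀ t ∈ J, DifferentiableAt ℝ h t ∧ DifferentiableAt ℝ (deriv h) t ∧ h t ≠ 0)
    (hfφ : ∀ t ∈ J, f t = (h t : ℂ) ^ (1 / 2 : ℂ) * φ t) :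
    SolvesLinear h r₀ v₀ J f ↔ SolvesSchroedinger h r₀ v₀ J φ := by
  have hη : ∀ t ∈ J, (h t : ℂ) ≠ 0 := fun t ht => ofReal_ne_zero.2 (hh t ht).2.2
  refine Iff.trans ?_ ((hasDerivAt_deriv_mul_iff (p := 0)
    (q := fun t => I * speed v₀ * h t / 2 - (chi r₀ v₀ t : ℂ) * ((h t : ℂ) / 2) ^ 2
      + 3 / 4 * ((deriv h t / h t : ℝ) : ℂ) ^ 2
      - 1 / 2 * ((deriv (deriv h) t / h t : ℝ) : ℂ)) hJ
    (fun t ht => hasDerivAt_ofReal_cpow_half (hh t ht).1.hasDerivAt (hh t ht).2.2)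
    (fun t ht => cpow_half_ne_zero (hη t ht))
    (fun t ht => hasDerivAt_half_logDeriv (hh t ht).1 (hh t ht).2.1 (hh t ht).2.2) hfφ).trans
    (forall₂_congr fun t _ => and_congr_right fun _ => ?_))
  · refine forall₂_congr fun t ht => and_congr_right fun _ => ?_
    have := hη t ht
    congr! 1
    push_cast [Pi.zero_apply]
    field_simp
    ring
  · rw [Pi.zero_apply, zero_mul, zero_add, mul_comm]

theorem isGenerating_iff_solvesSchroedinger (hJ : IsOpen J) (hJ0 : (0 : ℝ) ∈ J)
    (hh : ∀ t ∈ J, DifferentiableAt ℝ h t ∧ DifferentiableAt ℝ (deriv h) t ∧ h t ≠ 0)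
    (hfφ : ∀ t ∈ J, f t = (h t : ℂ) ^ (1 / 2 : ℂ) * φ t) :
    IsGenerating h r₀ v₀ J f ↔
      SolvesSchroedinger h r₀ v₀ J φ ∧ φ 0 = phiInit h ∧ deriv φ 0 = phiDerivInit h r₀ v₀ := by
  rw [IsGenerating, solvesLinear_iff_solvesSchroedinger hJ hh hfφ]
  refine and_congr_right fun hφ => ?_
  have hη : (h 0 : ℂ) ≠ 0 := ofReal_ne_zero.2 (hh 0 hJ0).2.2
  have hρ := cpow_half_ne_zero hη
  have hf' := (((hasDerivAt_ofReal_cpow_half (hh 0 hJ0).1.hasDerivAt (hh 0 hJ0).2.2).mul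
    (hφ 0 hJ0).1.hasDerivAt).congr_of_eventuallyEq
      (Filter.eventuallyEq_of_mem (hJ.mem_nhds hJ0) hfφ)).deriv
  have hsq := cpow_half_sq (h 0)
  rw [hfφ 0 hJ0, hf', phiInit, phiDerivInit, cpow_neg_half, cpow_neg_three_half]
  generalize (h 0 : ℂ) ^ (1 / 2 : ℂ) = ρ at hρ hsq
  rw [← eq_inv_mul_iff_mul_eq₀ hρ, mul_one]
  refine and_congr_right fun h₀ => ?_
  rw [h₀, ← eq_sub_iff_add_eq', ← eq_inv_mul_iff_mul_eq₀ hρ]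
  congr! 1
  push_cast
  rw [← hsq]
  field_simp

end Schroedinger

/-! ### Power series solutions of the hypergeometric equations -/

section Taylor

open Set Filter Topology Metric
open scoped Nat

/-- The Taylor coefficients of `f` at `0`, through which power series solutions of linear
differential equations are compared. -/
noncomputable def taylorCoeff (f : ℂ → ℂ) (n : ℕ) : ℂ := iteratedDeriv n f 0 / n !

variable {f g : ℂ → ℂ} {R : ℝ} {z : ℂ}

lemma hasSum_taylorCoeff (hf : DifferentiableOn ℂ f (ball 0 R)) (hz : z ∈ ball (0 : ℂ) R) :
    HasSum (fun n => taylorCoeff f n * z ^ n) (f z) := by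
  refine (hasSum_taylorSeries_on_ball hf hz).congr_fun fun n => ?_
  simp only [taylorCoeff, smul_eq_mul, sub_zero]
  ring

lemma taylorCoeff_zero (f : ℂ → ℂ) : taylorCoeff f 0 = f 0 := by simp [taylorCoeff]

lemma taylorCoeff_deriv (f : ℂ → ℂ) (n : ℕ) :
    taylorCoeff (deriv f) n = (n + 1) * taylorCoeff f (n + 1) := by
  have hn : (n : ℂ) + 1 ≠ 0 := Nat.cast_add_one_ne_zero n
  rw [taylorCoeff, taylorCoeff, iteratedDeriv_succ', Nat.factorial_succ]
  push_cast
  field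

lemma taylorCoeff_congr (h : f =ᶠ[𝓝 0] g) (n : ℕ) : taylorCoeff f n = taylorCoeff g n := by
  rw [taylorCoeff, taylorCoeff, h.iteratedDeriv_eq]

lemma taylorCoeff_eq_coeff {p : FormalMultilinearSeries ℂ ℂ ℂ} (h : HasFPowerSeriesAt f p 0)
    (n : ℕ) : taylorCoeff f n = p.coeff n := by
  rw [h.eq_formalMultilinearSeries h.analyticAt.hasFPowerSeriesAt,
    FormalMultilinearSeries.coeff_ofScalars, taylorCoeff]

lemma taylorCoeff_eq_of_hasSum {c : ℕ → ℂ}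
    (h : ∀ᶠ z in 𝓝 (0 : ℂ), HasSum (fun n => c n * z ^ n) (f z)) (n : ℕ) :
    taylorCoeff f n = c n := by
  have hp : HasFPowerSeriesAt f (.ofScalars ℂ c) 0 := by
    rw [hasFPowerSeriesAt_iff]
    filter_upwards [h] with z hz
    simpa [FormalMultilinearSeries.coeff_ofScalars, mul_comm] using hz
  rw [taylorCoeff_eq_coeff hp, FormalMultilinearSeries.coeff_ofScalars]

lemma eqOn_ball_of_taylorCoeff_eq (hf : DifferentiableOn ℂ f (ball 0 R))
    (hg : DifferentiableOn ℂ g (ball 0 R)) (h : ∀ n, taylorCoeff f n = taylorCoeff g n) :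
    EqOn f g (ball 0 R) := fun z hz => by
  have hfz := hasSum_taylorCoeff hf hz
  simp_rw [h] at hfz
  exact hfz.unique (hasSum_taylorCoeff hg hz)

lemma hasSum_mul_id {c : ℕ → ℂ} {s : ℂ} (h : HasSum (fun n => c (n + 1) * z ^ n) s)
    (h₀ : c 0 = 0) : HasSum (fun n => c n * z ^ n) (z * s) := by
  rw [← hasSum_nat_add_iff' 1]
  simp only [Finset.range_one, Finset.sum_singleton, h₀, zero_mul, sub_zero]
  exact (h.mul_left z).congr_fun fun n => by ring

lemma hasSum_deriv (hf : DifferentiableOn ℂ f (ball 0 R)) (hz : z ∈ ball (0 : ℂ) R) :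
    HasSum (fun n : ℕ => (n + 1) * taylorCoeff f (n + 1) * z ^ n) (deriv f z) := by
  simpa only [taylorCoeff_deriv] using hasSum_taylorCoeff (hf.deriv isOpen_ball) hz

lemma hasSum_id_mul_deriv (hf : DifferentiableOn ℂ f (ball 0 R)) (hz : z ∈ ball (0 : ℂ) R) :
    HasSum (fun n : ℕ => n * taylorCoeff f n * z ^ n) (z * deriv f z) := by
  refine hasSum_mul_id (c := fun n : ℕ => n * taylorCoeff f n) ?_ (by simp)
  simpa using hasSum_deriv hf hz

lemma hasSum_id_mul_deriv_deriv (hf : DifferentiableOn ℂ f (ball 0 R))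
    (hz : z ∈ ball (0 : ℂ) R) :
    HasSum (fun n : ℕ => n * ((n + 1) * taylorCoeff f (n + 1)) * z ^ n)
      (z * deriv (deriv f) z) := by
  simpa only [taylorCoeff_deriv] using hasSum_id_mul_deriv (hf.deriv isOpen_ball) hz

lemma hasSum_sq_mul_deriv_deriv (hf : DifferentiableOn ℂ f (ball 0 R))
    (hz : z ∈ ball (0 : ℂ) R) :
    HasSum (fun n : ℕ => n * (n - 1) * taylorCoeff f n * z ^ n)
      (z * (z * deriv (deriv f) z)) := by
  refine hasSum_mul_id (c := fun n : ℕ => n * (n - 1) * taylorCoeff f n) ?_ (by simp)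
  refine (hasSum_id_mul_deriv_deriv hf hz).congr_fun fun n => ?_
  push_cast
  ring

lemma hasSum_kummer_operator (hf : DifferentiableOn ℂ f (ball 0 R)) (hz : z ∈ ball (0 : ℂ) R)
    (a c : ℂ) :
    HasSum (fun n : ℕ => ((n + 1) * (n + c) * taylorCoeff f (n + 1) - (n + a) * taylorCoeff f n)
      * z ^ n) (z * deriv (deriv f) z + (c - z) * deriv f z - a * f z) := by
  rw [show z * deriv (deriv f) z + (c - z) * deriv f z - a * f z =
    z * deriv (deriv f) z + c * deriv f z - z * deriv f z - a * f z by ring]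
  refine ((((hasSum_id_mul_deriv_deriv hf hz).add ((hasSum_deriv hf hz).mul_left c)).sub
    (hasSum_id_mul_deriv hf hz)).sub ((hasSum_taylorCoeff hf hz).mul_left a)).congr_fun
    fun n => ?_
  ring

lemma hasSum_gauss_operator (hf : DifferentiableOn ℂ f (ball 0 R)) (hz : z ∈ ball (0 : ℂ) R)
    (a b c : ℂ) :
    HasSum (fun n : ℕ => ((n + 1) * (n + c) * taylorCoeff f (n + 1)
        - (n + a) * (n + b) * taylorCoeff f n) * z ^ n)
      (z * (1 - z) * deriv (deriv f) z + (c - (a + b + 1) * z) * deriv f z - a * b * f z) := by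
  rw [show z * (1 - z) * deriv (deriv f) z + (c - (a + b + 1) * z) * deriv f z - a * b * f z =
    z * deriv (deriv f) z - z * (z * deriv (deriv f) z) + c * deriv f z
      - (a + b + 1) * (z * deriv f z) - a * b * f z by ring]
  refine (((((hasSum_id_mul_deriv_deriv hf hz).sub (hasSum_sq_mul_deriv_deriv hf hz)).add
    ((hasSum_deriv hf hz).mul_left c)).sub
    ((hasSum_id_mul_deriv hf hz).mul_left (a + b + 1))).sub
    ((hasSum_taylorCoeff hf hz).mul_left (a * b))).congr_fun fun n => ?_
  ring

end Taylor

section Kummer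

open Filter

variable {a c : ℂ}

lemma hasFPowerSeriesOnBall_regularizedHGFun (a c : ℂ) :
    HasFPowerSeriesOnBall (regularizedHGFun {a} {c}) (regularizedHGFunSeries {a} {c}) 0 ⊤ := by
  have hr : (regularizedHGFunSeries {a} {c}).radius = ⊤ :=
    radius_regularizedHGFunSeries_eq_top (by simp)
  have h := (regularizedHGFunSeries {a} {c}).hasFPowerSeriesOnBall (by rw [hr]; simp)
  rwa [hr] at h

lemma differentiable_kummer (a c : ℂ) : Differentiable ℂ (kummer a c) := by
  have h : Differentiable ℂ (regularizedHGFun {a} {c}) := fun z =>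
    ((hasFPowerSeriesOnBall_regularizedHGFun a c).analyticAt_of_mem (by simp)).differentiableAt
  exact h.const_mul _

lemma taylorCoeff_kummer (a c : ℂ) (n : ℕ) :
    taylorCoeff (kummer a c) n = Gamma c * regularizedHGFunCoeff {a} {c} n := by
  have hcoeff : (Gamma c • regularizedHGFunSeries {a} {c}).coeff n =
      Gamma c * (regularizedHGFunSeries {a} {c}).coeff n := rfl
  rw [← regularizedHGFunSeries_coeff, ← hcoeff]
  exact taylorCoeff_eq_coeff
    ((hasFPowerSeriesOnBall_regularizedHGFun a c).hasFPowerSeriesAt.const_smul (c := Gamma c)) n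

lemma kummer_zero (hc : ∀ n : ℕ, c ≠ -n) : kummer a c 0 = 1 := by
  rw [← taylorCoeff_zero (kummer a c), taylorCoeff_kummer]
  simp [regularizedHGFunCoeff, Gamma_ne_zero hc]

lemma taylorCoeff_kummer_succ (hc : ∀ n : ℕ, c ≠ -n) (n : ℕ) :
    (n + 1) * (n + c) * taylorCoeff (kummer a c) (n + 1) =
      (n + a) * taylorCoeff (kummer a c) n := by
  have hnc : c + n ≠ 0 := fun h => hc n (eq_neg_of_add_eq_zero_left h)
  have hn : (n : ℂ) + 1 ≠ 0 := Nat.cast_add_one_ne_zero n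
  rw [taylorCoeff_kummer, taylorCoeff_kummer, regularizedHGFunCoeff_add_one (by simpa using hc n)]
  simp only [Multiset.map_singleton, Multiset.prod_singleton]
  field

theorem kummer_equation (hc : ∀ n : ℕ, c ≠ -n) (z : ℂ) :
    z * deriv (deriv (kummer a c)) z + (c - z) * deriv (kummer a c) z - a * kummer a c z = 0 := by
  have h := hasSum_kummer_operator (R := ‖z‖ + 1) (z := z)
    (differentiable_kummer a c).differentiableOn (by simp) a c
  simp only [taylorCoeff_kummer_succ hc, sub_self, zero_mul] at h
  exact h.unique hasSum_zero

lemma taylorCoeff_succ_of_kummer_equation {y : ℂ → ℂ} (hy : Differentiable ℂ y)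
    (he : ∀ z, z * deriv (deriv y) z + (c - z) * deriv y z - a * y z = 0) (n : ℕ) :
    (n + 1) * (n + c) * taylorCoeff y (n + 1) = (n + a) * taylorCoeff y n := by
  have hseries : taylorCoeff (fun _ => (0 : ℂ)) n = _ :=
    taylorCoeff_eq_of_hasSum (Eventually.of_forall fun z => by
      have h := hasSum_kummer_operator (R := ‖z‖ + 1) (z := z) hy.differentiableOn (by simp) a c
      rwa [he z] at h) n
  have hzero : taylorCoeff (fun _ => (0 : ℂ)) n = 0 :=
    taylorCoeff_eq_of_hasSum (c := fun _ => 0)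
      (Eventually.of_forall fun z => by simp [hasSum_zero]) n
  exact sub_eq_zero.1 (hseries.symm.trans hzero)

theorem eq_smul_kummer_of_equation (hc : ∀ n : ℕ, c ≠ -n) {y : ℂ → ℂ} (hy : Differentiable ℂ y)
    (he : ∀ z, z * deriv (deriv y) z + (c - z) * deriv y z - a * y z = 0) :
    y = y 0 • kummer a c := by
  have hT : ∀ n, taylorCoeff y n = taylorCoeff (y 0 • kummer a c) n := by
    have hsmul : ∀ n, taylorCoeff (y 0 • kummer a c) n = y 0 * taylorCoeff (kummer a c) n :=
      fun n => by
        rw [taylorCoeff, taylorCoeff, iteratedDeriv_const_smul_field, smul_eq_mul, mul_div_assoc]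
    intro n
    rw [hsmul]
    induction n with
    | zero => rw [taylorCoeff_zero, taylorCoeff_zero, kummer_zero hc, mul_one]
    | succ n ih =>
      have hnc : (n : ℂ) + c ≠ 0 := fun h => hc n (eq_neg_of_add_eq_zero_right h)
      have hn : (n : ℂ) + 1 ≠ 0 := Nat.cast_add_one_ne_zero n
      apply mul_left_cancel₀ (mul_ne_zero hn hnc)
      rw [taylorCoeff_succ_of_kummer_equation hy he, mul_left_comm, taylorCoeff_kummer_succ hc, ih,
        mul_left_comm]
  ext z
  exact eqOn_ball_of_taylorCoeff_eq (R := ‖z‖ + 1) hy.differentiableOn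
    ((differentiable_kummer a c).const_smul _).differentiableOn hT (by simp)

lemma hasDerivAt_kummer (a c z : ℂ) : HasDerivAt (kummer a c) (deriv (kummer a c) z) z :=
  (differentiable_kummer a c z).hasDerivAt

lemma hasDerivAt_deriv_kummer (a c z : ℂ) :
    HasDerivAt (deriv (kummer a c)) (deriv (deriv (kummer a c)) z) z :=
  ((differentiable_kummer a c).deriv z).hasDerivAt

theorem exp_mul_kummer_neg (hc : ∀ n : ℕ, c ≠ -n) (a z : ℂ) :
    exp z * kummer (c - a) c (-z) = kummer a c z := by
  set y : ℂ → ℂ := fun z => exp z * kummer (c - a) c (-z) with hy_def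
  have hy : ∀ z, HasDerivAt y (exp z * (kummer (c - a) c (-z) - deriv (kummer (c - a) c) (-z))) z :=
    fun z => ((Complex.hasDerivAt_exp z).mul
      ((hasDerivAt_kummer (c - a) c (-z)).scomp z (hasDerivAt_neg z))).congr_deriv (by
        simp only [Function.comp_apply, smul_eq_mul]
        ring)
  have hy' : ∀ z, HasDerivAt (deriv y)
      (exp z * (kummer (c - a) c (-z) - 2 * deriv (kummer (c - a) c) (-z) +
        deriv (deriv (kummer (c - a) c)) (-z))) z := fun z => by
    rw [show deriv y = _ from funext fun z => (hy z).deriv]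
    refine ((Complex.hasDerivAt_exp z).mul
      (((hasDerivAt_kummer (c - a) c (-z)).scomp z (hasDerivAt_neg z)).sub
        ((hasDerivAt_deriv_kummer (c - a) c (-z)).scomp z (hasDerivAt_neg z)))).congr_deriv ?_
    simp only [Function.comp_apply, smul_eq_mul, Pi.sub_apply]
    ring
  have hy₀ : y 0 = 1 := by simp [hy_def, kummer_zero hc]
  have hsmul := eq_smul_kummer_of_equation (a := a) hc (fun z => (hy z).differentiableAt)
      fun z => by
    rw [(hy z).deriv, (hy' z).deriv]
    linear_combination -exp z * kummer_equation (a := c - a) hc (-z)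
  rw [hy₀, one_smul] at hsmul
  exact congrFun hsmul z

end Kummer

/-! ### Second-order linear equations in the complex domain -/

section Substitution

open Topology Filter

variable {U : Set ℂ} {y : ℂ → ℂ} {z : ℝ → ℂ} {ζ : ℂ} {t : ℝ}

lemma hasDerivAt_comp_affine (hz : ∀ t, HasDerivAt z ζ t) (hU : IsOpen U)
    (hy : DifferentiableOn ℂ y U) (ht : z t ∈ U) :
    HasDerivAt (fun t => y (z t)) (ζ * deriv y (z t)) t :=
  (hy.differentiableAt (hU.mem_nhds ht)).hasDerivAt.scomp t (hz t)

lemma hasDerivAt_deriv_comp_affine (hz : ∀ t, HasDerivAt z ζ t) (hU : IsOpen U)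
    (hy : DifferentiableOn ℂ y U) (ht : z t ∈ U) :
    HasDerivAt (deriv fun t => y (z t)) (ζ ^ 2 * deriv (deriv y) (z t)) t := by
  refine (((hasDerivAt_comp_affine hz hU (hy.deriv hU) ht).const_mul ζ).congr_deriv
    (by ring)).congr_of_eventuallyEq ?_
  filter_upwards [(hz t).continuousAt.preimage_mem_nhds (hU.mem_nhds ht)] with s hs
  exact (hasDerivAt_comp_affine hz hU hy hs).deriv

end Substitution

section LinearCombination

open Topology Filter

variable {U : Set ℂ} {u w : ℂ → ℂ} {z : ℂ}

lemma hasDerivAt_linearCombination (hU : IsOpen U) (hu : DifferentiableOn ℂ u U)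
    (hw : DifferentiableOn ℂ w U) (A B : ℂ) (hz : z ∈ U) :
    HasDerivAt (fun z => A * u z + B * w z) (A * deriv u z + B * deriv w z) z :=
  ((hu.differentiableAt (hU.mem_nhds hz)).hasDerivAt.const_mul A).add
    ((hw.differentiableAt (hU.mem_nhds hz)).hasDerivAt.const_mul B)

lemma hasDerivAt_deriv_linearCombination (hU : IsOpen U) (hu : DifferentiableOn ℂ u U)
    (hw : DifferentiableOn ℂ w U) (A B : ℂ) (hz : z ∈ U) :
    HasDerivAt (deriv fun z => A * u z + B * w z)
      (A * deriv (deriv u) z + B * deriv (deriv w) z) z := by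
  refine (hasDerivAt_linearCombination hU (hu.deriv hU) (hw.deriv hU) A B hz).congr_of_eventuallyEq
    ?_
  filter_upwards [hU.mem_nhds hz] with x hx
  exact (hasDerivAt_linearCombination hU hu hw A B hx).deriv

lemma coeff_value (hW : wronsk u w z ≠ 0) (x y : ℂ) :
    coeffFst u w z x y * u z + coeffSnd u w z x y * w z = x := by
  rw [coeffFst, coeffSnd]
  field_simp
  rw [wronsk]
  ring

lemma coeff_deriv (hW : wronsk u w z ≠ 0) (x y : ℂ) :
    coeffFst u w z x y * deriv u z + coeffSnd u w z x y * deriv w z = y := by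
  rw [coeffFst, coeffSnd]
  field_simp
  rw [wronsk]
  ring

lemma hasDerivAt_wronsk {p q : ℂ} (hU : IsOpen U) (hu : DifferentiableOn ℂ u U)
    (hw : DifferentiableOn ℂ w U) (hz : z ∈ U)
    (hu₂ : deriv (deriv u) z = p * deriv u z + q * u z)
    (hw₂ : deriv (deriv w) z = p * deriv w z + q * w z) :
    HasDerivAt (wronsk u w) (p * wronsk u w z) z := by
  have hd : ∀ {y : ℂ → ℂ}, DifferentiableOn ℂ y U → HasDerivAt y (deriv y z) z := fun hy =>
    (hy.differentiableAt (hU.mem_nhds hz)).hasDerivAt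
  refine (((hd hu).mul (hd (hw.deriv hU))).sub ((hd hw).mul (hd (hu.deriv hU)))).congr_deriv ?_
  rw [hu₂, hw₂, wronsk]
  ring

end LinearCombination

/-! ### The parabolic cylinder function and a constant coefficient -/

section Weber

variable {a c p : ℂ}

/-- The Gaussian multiple `e^(-z²/4) Φ(a, c; z²/2)` of Kummer's function. For `c = 1/2` it is the
even solution of Weber's equation, and for `c = 3/2` its product with `z` is the odd one. -/
noncomputable def gaussKummer (a c z : ℂ) : ℂ := exp (-z ^ 2 / 4) * kummer a c (z ^ 2 / 2)

lemma hasDerivAt_exp_neg_sq (z : ℂ) :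
    HasDerivAt (fun z : ℂ => exp (-z ^ 2 / 4)) (exp (-z ^ 2 / 4) * (-z / 2)) z :=
  (((hasDerivAt_pow 2 z).fun_neg.div_const 4).congr_deriv (by ring)).cexp

lemma hasDerivAt_sq_half (z : ℂ) : HasDerivAt (fun z : ℂ => z ^ 2 / 2) z z :=
  ((hasDerivAt_pow 2 z).div_const 2).congr_deriv (by ring)

lemma hasDerivAt_gaussKummer (a c z : ℂ) :
    HasDerivAt (gaussKummer a c)
      (exp (-z ^ 2 / 4) * (-z / 2 * kummer a c (z ^ 2 / 2) + z * deriv (kummer a c) (z ^ 2 / 2)))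
      z :=
  ((hasDerivAt_exp_neg_sq z).mul
    ((hasDerivAt_kummer a c _).comp z (hasDerivAt_sq_half z))).congr_deriv (by
      rw [Function.comp_apply]
      ring)

lemma differentiable_gaussKummer (a c : ℂ) : Differentiable ℂ (gaussKummer a c) :=
  fun z => (hasDerivAt_gaussKummer a c z).differentiableAt

lemma deriv_gaussKummer_zero (a c : ℂ) : deriv (gaussKummer a c) 0 = 0 := by
  rw [(hasDerivAt_gaussKummer a c 0).deriv]
  simp

lemma gaussKummer_zero (hc : ∀ n : ℕ, c ≠ -n) : gaussKummer a c 0 = 1 := by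
  simp [gaussKummer, kummer_zero hc]

lemma deriv_deriv_gaussKummer (hc : ∀ n : ℕ, c ≠ -n) (a z : ℂ) :
    deriv (deriv (gaussKummer a c)) z = (z ^ 2 / 4 - 1 / 2 + 2 * a) * gaussKummer a c z
      + (1 - 2 * c) * (exp (-z ^ 2 / 4) * deriv (kummer a c) (z ^ 2 / 2)) := by
  rw [show deriv (gaussKummer a c) = _ from funext fun z => (hasDerivAt_gaussKummer a c z).deriv]
  refine (((hasDerivAt_exp_neg_sq z).mul ((((hasDerivAt_id z).neg.div_const 2).mul
    ((hasDerivAt_kummer a c _).comp z (hasDerivAt_sq_half z))).add ((hasDerivAt_id z).mul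
      ((hasDerivAt_deriv_kummer a c _).comp z (hasDerivAt_sq_half z))))).congr_deriv ?_).deriv
  simp only [gaussKummer, Function.comp_apply, Pi.mul_apply, Pi.add_apply, Pi.neg_apply, id]
  linear_combination 2 * exp (-z ^ 2 / 4) * kummer_equation (a := a) hc (z ^ 2 / 2)

lemma ne_neg_natCast_of_re_pos (hc : 0 < c.re) (n : ℕ) : c ≠ -n := fun h => by
  have hre : c.re = -n := by simp [h]
  linarith [n.cast_nonneg (α := ℝ)]

lemma deriv_deriv_gaussKummer_half (a z : ℂ) :
    deriv (deriv (gaussKummer a (1 / 2))) z =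
      (z ^ 2 / 4 + 2 * a - 1 / 2) * gaussKummer a (1 / 2) z := by
  rw [deriv_deriv_gaussKummer (ne_neg_natCast_of_re_pos (by norm_num))]
  ring

lemma hasDerivAt_id_mul_gaussKummer (a c z : ℂ) :
    HasDerivAt (fun z => z * gaussKummer a c z)
      (gaussKummer a c z + z * deriv (gaussKummer a c) z) z :=
  ((hasDerivAt_id' z).fun_mul (differentiable_gaussKummer a c z).hasDerivAt).congr_deriv
    (by rw [one_mul])

lemma differentiable_id_mul_gaussKummer (a c : ℂ) :
    Differentiable ℂ fun z => z * gaussKummer a c z :=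
  fun z => (hasDerivAt_id_mul_gaussKummer a c z).differentiableAt

lemma deriv_deriv_id_mul_gaussKummer_three_half (a z : ℂ) :
    deriv (deriv fun z => z * gaussKummer a (3 / 2) z) z =
      (z ^ 2 / 4 + 2 * a - 3 / 2) * (z * gaussKummer a (3 / 2) z) := by
  have hd := (differentiable_gaussKummer a (3 / 2) z).hasDerivAt
  have hd' := ((differentiable_gaussKummer a (3 / 2)).deriv z).hasDerivAt
  rw [show deriv (fun z => z * gaussKummer a (3 / 2) z) = _ from
    funext fun z => (hasDerivAt_id_mul_gaussKummer a (3 / 2) z).deriv,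
    (hd.fun_add ((hasDerivAt_id' z).fun_mul hd')).deriv, (hasDerivAt_gaussKummer a _ z).deriv,
    deriv_deriv_gaussKummer (ne_neg_natCast_of_re_pos (by norm_num)), gaussKummer]
  ring

end Weber

section ParabolicCylinder

open Set

variable {p : ℂ}

/-- The value of the parabolic cylinder function `D_p` at `0`, which is the coefficient of its even
part. -/
noncomputable def cylEven (p : ℂ) : ℂ :=
  (2 : ℂ) ^ (p / 2) * ((Real.sqrt Real.pi : ℂ) / Gamma ((1 - p) / 2))

/-- The derivative of the parabolic cylinder function `D_p` at `0`, which is the coefficient of its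
odd part. -/
noncomputable def cylOdd (p : ℂ) : ℂ :=
  -((2 : ℂ) ^ (p / 2) * ((Real.sqrt (2 * Real.pi) : ℂ) / Gamma (-p / 2)))

lemma parabolicCylinder_eq (p : ℂ) : parabolicCylinder p = fun z =>
    cylEven p * gaussKummer (-p / 2) (1 / 2) z
      + cylOdd p * (z * gaussKummer ((1 - p) / 2) (3 / 2) z) := by
  ext z
  simp only [parabolicCylinder, cylEven, cylOdd, gaussKummer]
  ring

lemma differentiable_parabolicCylinder (p : ℂ) : Differentiable ℂ (parabolicCylinder p) := by
  rw [parabolicCylinder_eq]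
  exact ((differentiable_gaussKummer _ _).const_mul _).add
    ((differentiable_id_mul_gaussKummer _ _).const_mul _)

theorem deriv_deriv_parabolicCylinder (p z : ℂ) :
    deriv (deriv (parabolicCylinder p)) z = (z ^ 2 / 4 - p - 1 / 2) * parabolicCylinder p z := by
  rw [parabolicCylinder_eq, (hasDerivAt_deriv_linearCombination isOpen_univ
    (differentiable_gaussKummer _ _).differentiableOn
    (differentiable_id_mul_gaussKummer _ _).differentiableOn _ _
    (mem_univ z)).deriv, deriv_deriv_gaussKummer_half]
  have hodd := deriv_deriv_id_mul_gaussKummer_three_half ((1 - p) / 2) z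
  linear_combination cylOdd p * hodd

lemma parabolicCylinder_zero (p : ℂ) : parabolicCylinder p 0 = cylEven p := by
  simp only [parabolicCylinder_eq, gaussKummer_zero (ne_neg_natCast_of_re_pos (c := 1 / 2)
    (by norm_num))]
  ring

lemma deriv_parabolicCylinder_zero (p : ℂ) : deriv (parabolicCylinder p) 0 = cylOdd p := by
  rw [parabolicCylinder_eq, (((differentiable_gaussKummer _ _ 0).hasDerivAt.const_mul _).fun_add
    ((hasDerivAt_id_mul_gaussKummer _ _ 0).const_mul _)).deriv, deriv_gaussKummer_zero,
    deriv_gaussKummer_zero, gaussKummer_zero (ne_neg_natCast_of_re_pos (by norm_num))]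
  ring

lemma differentiable_parabolicCylinder_neg (p : ℂ) :
    Differentiable ℂ fun z => parabolicCylinder p (-z) :=
  (differentiable_parabolicCylinder p).comp differentiable_neg

lemma deriv_deriv_comp_neg (y : ℂ → ℂ) (z : ℂ) :
    deriv (deriv fun z => y (-z)) z = deriv (deriv y) (-z) := by
  rw [show deriv (fun z => y (-z)) = fun z => -deriv y (-z) from funext fun z => deriv_comp_neg y z,
    deriv.fun_neg, deriv_comp_neg, neg_neg]

lemma deriv_deriv_parabolicCylinder_neg (p z : ℂ) :
    deriv (deriv fun z => parabolicCylinder p (-z)) z =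
      (z ^ 2 / 4 - p - 1 / 2) * parabolicCylinder p (-z) := by
  rw [deriv_deriv_comp_neg, deriv_deriv_parabolicCylinder, neg_sq]

lemma wronsk_parabolicCylinder (p z : ℂ) :
    wronsk (parabolicCylinder p) (fun z => parabolicCylinder p (-z)) z =
      -2 * cylEven p * cylOdd p := by
  have hd : ∀ z, HasDerivAt (wronsk (parabolicCylinder p) fun z => parabolicCylinder p (-z)) 0 z :=
    fun z => (hasDerivAt_wronsk (p := 0) isOpen_univ
      (differentiable_parabolicCylinder p).differentiableOn
      (differentiable_parabolicCylinder_neg p).differentiableOn (mem_univ z)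
      (by rw [deriv_deriv_parabolicCylinder, zero_mul, zero_add])
      (by rw [deriv_deriv_parabolicCylinder_neg, zero_mul, zero_add])).congr_deriv (zero_mul _)
  rw [is_const_of_deriv_eq_zero (fun z => (hd z).differentiableAt) (fun z => (hd z).deriv) z 0,
    wronsk, deriv_comp_neg, neg_zero, parabolicCylinder_zero, deriv_parabolicCylinder_zero]
  ring

theorem wronsk_parabolicCylinder_ne_zero (hp : ∀ n : ℕ, p ≠ n) (z : ℂ) :
    wronsk (parabolicCylinder p) (fun z => parabolicCylinder p (-z)) z ≠ 0 := by
  have htwo : (2 : ℂ) ^ (p / 2) ≠ 0 := by simp [cpow_eq_zero_iff]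
  have hpi : (Real.sqrt Real.pi : ℂ) ≠ 0 := ofReal_ne_zero.2 (Real.sqrt_ne_zero'.2 Real.pi_pos)
  have heven : Gamma ((1 - p) / 2) ≠ 0 := Gamma_ne_zero fun n h => hp (2 * n + 1) <| by
    push_cast
    linear_combination -2 * h
  have hodd : Gamma (-p / 2) ≠ 0 := Gamma_ne_zero fun n h => hp (2 * n) <| by
    push_cast
    linear_combination -2 * h
  rw [wronsk_parabolicCylinder, cylEven, cylOdd]
  simp [htwo, hpi, heven, hodd]

end ParabolicCylinder

section ConstantCoefficient

open Set

variable {J : Set ℝ} {r₀ v₀ : E3} {k : ℝ}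

lemma cylP_im_ne_zero (hw : wedge r₀ v₀ ≠ 0) (hk : k ≠ 0) : (cylP k r₀ v₀).im ≠ 0 := by
  have hb := (speed_pos hw).ne'
  have hc := (parC_pos hw).ne'
  have h : cylP k r₀ v₀ =
      ((-1 : ℝ) : ℂ) + ((-(k * parC r₀ v₀ ^ 2 / (4 * speed v₀)) : ℝ) : ℂ) * I := by
    rw [cylP]
    push_cast
    ring
  rw [h, add_im, ofReal_im, zero_add, im_ofReal_mul, I_im, mul_one]
  simp [hb, hc, hk]

lemma hasDerivAt_cylTau (k : ℝ) (r₀ v₀ : E3) (t : ℝ) :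
    HasDerivAt (cylTau k r₀ v₀) ((I * k * speed v₀) ^ (1 / 2 : ℂ)) t :=
  (((hasDerivAt_id t).add_const (beta r₀ v₀ / speed v₀ ^ 2)).ofReal_comp.const_mul
    ((I * k * speed v₀) ^ (1 / 2 : ℂ))).congr_deriv (by simp)

lemma ofReal_mul_cpow {x : ℝ} (hx : 0 < x) {y : ℂ} (hy : y ≠ 0) (s : ℂ) :
    ((x : ℂ) * y) ^ s = (x : ℂ) ^ s * y ^ s := by
  have hx' : (x : ℂ) ≠ 0 := ofReal_ne_zero.2 hx.ne'
  rw [cpow_def_of_ne_zero (mul_ne_zero hx' hy), cpow_def_of_ne_zero hx', cpow_def_of_ne_zero hy,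
    log_ofReal_mul hx hy, ofReal_log hx.le, add_mul, exp_add]

lemma cpow_half_mul_cylK (hw : wedge r₀ v₀ ≠ 0) (hk : k ≠ 0) :
    (I * k * speed v₀) ^ (1 / 2 : ℂ) * cylK k r₀ v₀ = I * parA r₀ v₀ * k / 2 := by
  have hb := speed_pos hw
  have hb' : (speed v₀ : ℂ) ≠ 0 := ofReal_ne_zero.2 hb.ne'
  have hk' : I * k ≠ 0 := mul_ne_zero I_ne_zero (ofReal_ne_zero.2 hk)
  have hIk := ofReal_mul_cpow hb (div_ne_zero hk' hb') (1 / 2)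
  rw [mul_div_cancel₀ _ hb'] at hIk
  have hsq : ((speed v₀ : ℂ) ^ (1 / 2 : ℂ)) ^ 2 * ((I * k / speed v₀) ^ (1 / 2 : ℂ)) ^ 2 =
      I * k := by
    rw [cpow_half_sq, cpow_half_sq, mul_div_cancel₀ _ hb']
  rw [mul_comm _ (speed v₀ : ℂ), ofReal_mul_cpow hb hk', hIk, cylK]
  linear_combination (parA r₀ v₀ : ℂ) / 2 * hsq

lemma weber_potential (hw : wedge r₀ v₀ ≠ 0) (k t : ℝ) :
    I * k * speed v₀ * (cylTau k r₀ v₀ t ^ 2 / 4 - cylP k r₀ v₀ - 1 / 2) =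
      -(chi r₀ v₀ t : ℂ) * ((k : ℂ) / 2) ^ 2 + I * speed v₀ * k / 2 := by
  have hb : (speed v₀ : ℂ) ≠ 0 := ofReal_ne_zero.2 (speed_pos hw).ne'
  rw [cylTau, mul_pow, cpow_half_sq, cylP, chi_eq hw, ← speed_mul_parA hw]
  push_cast
  field_simp
  ring_nf
  simp only [I_sq]
  ring

lemma solvesLinear_const_of_weber (hw : wedge r₀ v₀ ≠ 0) {y : ℂ → ℂ} (hy : Differentiable ℂ y)
    (hweber : ∀ z, deriv (deriv y) z = (z ^ 2 / 4 - cylP k r₀ v₀ - 1 / 2) * y z) :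
    SolvesLinear (fun _ => k) r₀ v₀ J fun t => y (cylTau k r₀ v₀ t) := fun t _ => by
  refine ⟨(hasDerivAt_comp_affine (hasDerivAt_cylTau k r₀ v₀) isOpen_univ hy.differentiableOn
    (mem_univ _)).differentiableAt, (hasDerivAt_deriv_comp_affine (hasDerivAt_cylTau k r₀ v₀)
      isOpen_univ hy.differentiableOn (mem_univ _)).congr_deriv ?_⟩
  rw [hweber, cpow_half_sq, ← weber_potential hw, deriv_const, zero_div, ofReal_zero]
  ring

theorem isGenerating_parabolicCylinder (hw : wedge r₀ v₀ ≠ 0) (hk : k ≠ 0)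
    {u w : ℂ → ℂ} {A B : ℂ} (hu : u = parabolicCylinder (cylP k r₀ v₀))
    (hv : w = fun τ => parabolicCylinder (cylP k r₀ v₀) (-τ))
    (hA : A = coeffFst u w (cylTau k r₀ v₀ 0) 1 (cylK k r₀ v₀))
    (hB : B = coeffSnd u w (cylTau k r₀ v₀ 0) 1 (cylK k r₀ v₀)) :
    IsGenerating (fun _ => k) r₀ v₀ J
      (fun t => A * u (cylTau k r₀ v₀ t) + B * w (cylTau k r₀ v₀ t)) := by
  have hW : wronsk u w (cylTau k r₀ v₀ 0) ≠ 0 := by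
    rw [hu, hv]
    exact wronsk_parabolicCylinder_ne_zero (fun n h => cylP_im_ne_zero hw hk (by simp [h])) _
  have du : Differentiable ℂ u := hu ▸ differentiable_parabolicCylinder _
  have dw : Differentiable ℂ w := hv ▸ differentiable_parabolicCylinder_neg _
  have dy : Differentiable ℂ fun z => A * u z + B * w z := (du.const_mul A).add (dw.const_mul B)
  refine ⟨solvesLinear_const_of_weber hw dy fun z => ?_, hA ▸ hB ▸ coeff_value hW _ _, ?_⟩
  · rw [(hasDerivAt_deriv_linearCombination isOpen_univ du.differentiableOn dw.differentiableOn
      A B (mem_univ z)).deriv, hu, hv, deriv_deriv_parabolicCylinder,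
      deriv_deriv_parabolicCylinder_neg]
    ring
  · rw [(hasDerivAt_comp_affine (hasDerivAt_cylTau k r₀ v₀) isOpen_univ dy.differentiableOn
      (mem_univ _)).deriv, (hasDerivAt_linearCombination isOpen_univ du.differentiableOn
        dw.differentiableOn A B (mem_univ _)).deriv, hA, hB, coeff_deriv hW,
      cpow_half_mul_cylK hw hk]

theorem isGenerating_const_iff (hJ : IsOpen J) (hJc : J.OrdConnected) (hJ0 : (0 : ℝ) ∈ J)
    (hw : wedge r₀ v₀ ≠ 0) (hk : k ≠ 0) {u w : ℂ → ℂ} {A B : ℂ}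
    (hu : u = parabolicCylinder (cylP k r₀ v₀))
    (hv : w = fun τ => parabolicCylinder (cylP k r₀ v₀) (-τ))
    (hA : A = coeffFst u w (cylTau k r₀ v₀ 0) 1 (cylK k r₀ v₀))
    (hB : B = coeffSnd u w (cylTau k r₀ v₀ 0) 1 (cylK k r₀ v₀)) (f : ℝ → ℂ) :
    IsGenerating (fun _ => k) r₀ v₀ J f ↔
      ∀ t ∈ J, f t = A * u (cylTau k r₀ v₀ t) + B * w (cylTau k r₀ v₀ t) :=
  isGenerating_iff_eqOn hJ hJc hJ0 hw (fun _ _ => ⟨differentiableAt_const k, hk⟩)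
    (isGenerating_parabolicCylinder hw hk hu hv hA hB) f

end ConstantCoefficient

/-! ### Whittaker functions and the coefficient `2k / (1 + 2ωt)` -/

section WhittakerM

variable {l m z : ℂ}

/-- The entire factor `e^(-z/2) Φ(m-l+1/2, 2m+1; z)` of the Whittaker function `M_{l,m}(z)`. -/
noncomputable def whittakerFactor (l m z : ℂ) : ℂ :=
  exp (-z / 2) * kummer (m - l + 1 / 2) (2 * m + 1) z

lemma hasDerivAt_exp_neg_half (z : ℂ) :
    HasDerivAt (fun z : ℂ => exp (-z / 2)) (exp (-z / 2) * (-1 / 2)) z :=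
  ((hasDerivAt_id z).neg.div_const 2).cexp

lemma hasDerivAt_whittakerFactor (l m z : ℂ) :
    HasDerivAt (whittakerFactor l m)
      (exp (-z / 2) * (deriv (kummer (m - l + 1 / 2) (2 * m + 1)) z
        - kummer (m - l + 1 / 2) (2 * m + 1) z / 2)) z :=
  ((hasDerivAt_exp_neg_half z).mul (hasDerivAt_kummer _ _ z)).congr_deriv (by ring)

lemma differentiable_whittakerFactor (l m : ℂ) : Differentiable ℂ (whittakerFactor l m) :=
  fun z => (hasDerivAt_whittakerFactor l m z).differentiableAt

lemma two_mul_add_one_ne_neg_natCast (hm : ∀ n : ℤ, 2 * m ≠ n) (n : ℕ) : 2 * m + 1 ≠ -n :=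
  fun h => hm (-n - 1) <| by
    push_cast
    linear_combination h

lemma two_mul_neg_ne_intCast (hm : ∀ n : ℤ, 2 * m ≠ n) (n : ℤ) : 2 * -m ≠ n :=
  fun h => hm (-n) <| by
    push_cast
    linear_combination -h

lemma whittakerFactor_equation (hm : ∀ n : ℤ, 2 * m ≠ n) (l z : ℂ) :
    z * deriv (deriv (whittakerFactor l m)) z + (2 * m + 1) * deriv (whittakerFactor l m) z
      + (l - z / 4) * whittakerFactor l m z = 0 := by
  have hd := (hasDerivAt_exp_neg_half z).fun_mul
    ((hasDerivAt_deriv_kummer (m - l + 1 / 2) (2 * m + 1) z).fun_sub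
      ((hasDerivAt_kummer (m - l + 1 / 2) (2 * m + 1) z).div_const 2))
  rw [show deriv (whittakerFactor l m) = _ from
    funext fun z => (hasDerivAt_whittakerFactor l m z).deriv, hd.deriv, whittakerFactor]
  linear_combination exp (-z / 2) *
    kummer_equation (a := m - l + 1 / 2) (two_mul_add_one_ne_neg_natCast hm) z

lemma whittakerFactor_zero (hm : ∀ n : ℤ, 2 * m ≠ n) (l : ℂ) : whittakerFactor l m 0 = 1 := by
  simp [whittakerFactor, kummer_zero (two_mul_add_one_ne_neg_natCast hm)]

lemma whittakerFactor_neg (hm : ∀ n : ℤ, 2 * m ≠ n) (l z : ℂ) :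
    whittakerFactor (-l) m (-z) = whittakerFactor l m z := by
  rw [whittakerFactor, whittakerFactor,
    ← exp_mul_kummer_neg (two_mul_add_one_ne_neg_natCast hm) (m - l + 1 / 2) z,
    show 2 * m + 1 - (m - l + 1 / 2) = m - -l + 1 / 2 by ring, ← mul_assoc, ← exp_add]
  congr 2
  ring

lemma whittakerFactor_wronskian (hm : ∀ n : ℤ, 2 * m ≠ n) (l z : ℂ) :
    -2 * m * (whittakerFactor l m z * whittakerFactor l (-m) z)
      + z * wronsk (whittakerFactor l m) (whittakerFactor l (-m)) z = -2 * m := by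
  have hd : ∀ z, HasDerivAt (fun z => -2 * m * (whittakerFactor l m z * whittakerFactor l (-m) z)
      + z * wronsk (whittakerFactor l m) (whittakerFactor l (-m)) z) 0 z := fun z => by
    have hp := (differentiable_whittakerFactor l m z).hasDerivAt
    have hp' := ((differentiable_whittakerFactor l m).deriv z).hasDerivAt
    have hq := (differentiable_whittakerFactor l (-m) z).hasDerivAt
    have hq' := ((differentiable_whittakerFactor l (-m)).deriv z).hasDerivAt
    refine (((hp.fun_mul hq).const_mul (-2 * m)).fun_add
      ((hasDerivAt_id' z).fun_mul ((hp.fun_mul hq').fun_sub (hq.fun_mul hp')))).congr_deriv ?_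
    linear_combination whittakerFactor l m z *
        whittakerFactor_equation (two_mul_neg_ne_intCast hm) l z
      - whittakerFactor l (-m) z * whittakerFactor_equation hm l z
  have hconst := is_const_of_deriv_eq_zero (fun z => (hd z).differentiableAt)
    (fun z => (hd z).deriv) z 0
  simpa [whittakerFactor_zero hm, whittakerFactor_zero (two_mul_neg_ne_intCast hm)] using hconst

lemma whittakerM_eq (l m z : ℂ) :
    whittakerM l m z = z ^ (m + 1 / 2) * whittakerFactor l m z := by
  rw [whittakerM, whittakerFactor, mul_assoc]

lemma hasDerivAt_cpow_const (hz : z ∈ slitPlane) (s : ℂ) :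
    HasDerivAt (fun z : ℂ => z ^ s) (z ^ s * (s / z)) z := by
  refine ((hasDerivAt_id z).cpow_const hz).congr_deriv ?_
  rw [id, cpow_sub _ _ (slitPlane_ne_zero hz), cpow_one]
  ring

lemma hasDerivAt_whittakerM (hz : z ∈ slitPlane) (l m : ℂ) :
    HasDerivAt (whittakerM l m)
      (z ^ (m + 1 / 2) *
        ((m + 1 / 2) / z * whittakerFactor l m z + deriv (whittakerFactor l m) z)) z := by
  rw [show whittakerM l m = _ from funext (whittakerM_eq l m)]
  exact ((hasDerivAt_cpow_const hz _).mul
    (differentiable_whittakerFactor l m z).hasDerivAt).congr_deriv (by ring)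

lemma differentiableOn_whittakerM (l m : ℂ) : DifferentiableOn ℂ (whittakerM l m) slitPlane :=
  fun _ hz => (hasDerivAt_whittakerM hz l m).differentiableAt.differentiableWithinAt

theorem whittakerEqAt_whittakerM (hm : ∀ n : ℤ, 2 * m ≠ n) (l : ℂ) (hz : z ∈ slitPlane) :
    WhittakerEqAt l m (whittakerM l m) z := by
  have hz0 := slitPlane_ne_zero hz
  have hderiv := (deriv_eventuallyEq_of_isOpen isOpen_slitPlane
    (fun _ hx => hasDerivAt_whittakerM hx l m) hz).deriv_eq
  have hd := (hasDerivAt_cpow_const hz (m + 1 / 2)).fun_mul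
    (((((hasDerivAt_const z (m + 1 / 2)).fun_div (hasDerivAt_id' z) hz0)).fun_mul
      (differentiable_whittakerFactor l m z).hasDerivAt).fun_add
    ((differentiable_whittakerFactor l m).deriv z).hasDerivAt)
  rw [WhittakerEqAt, hderiv, hd.deriv, whittakerM_eq]
  generalize z ^ (m + 1 / 2) = x
  field_simp
  linear_combination 16 * x * z * whittakerFactor_equation hm l z

theorem wronsk_whittakerM (hm : ∀ n : ℤ, 2 * m ≠ n) (l : ℂ) (hz : z ∈ slitPlane) :
    wronsk (whittakerM l m) (whittakerM l (-m)) z = -2 * m := by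
  have hz0 := slitPlane_ne_zero hz
  have hpow : z ^ (m + 1 / 2) * z ^ (-m + 1 / 2) = z := by
    rw [← cpow_add _ _ hz0, add_add_add_comm, add_neg_cancel, zero_add, add_halves, cpow_one]
  rw [← whittakerFactor_wronskian hm l z, wronsk, wronsk, (hasDerivAt_whittakerM hz l m).deriv,
    (hasDerivAt_whittakerM hz l (-m)).deriv, whittakerM_eq, whittakerM_eq]
  generalize whittakerFactor l m = P, whittakerFactor l (-m) = Q,
    z ^ (m + 1 / 2) = x, z ^ (-m + 1 / 2) = x' at *
  field_simp
  linear_combination 2 * (-2 * m * P z * Q z + z * (P z * deriv Q z - Q z * deriv P z)) * hpow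

end WhittakerM

section WhittakerW

open Topology Filter

variable {l m z : ℂ}

lemma WhittakerEqAt.linearCombination {U : Set ℂ} {u w : ℂ → ℂ} (hU : IsOpen U)
    (hdu : DifferentiableOn ℂ u U) (hdw : DifferentiableOn ℂ w U) (hz : z ∈ U)
    (hu : WhittakerEqAt l m u z) (hw : WhittakerEqAt l m w z) (A B : ℂ) :
    WhittakerEqAt l m (fun z => A * u z + B * w z) z := by
  rw [WhittakerEqAt] at *
  rw [(hasDerivAt_deriv_linearCombination hU hdu hdw A B hz).deriv]
  linear_combination A * hu + B * hw

lemma WhittakerEqAt.comp_neg {u : ℂ → ℂ} (hu : WhittakerEqAt (-l) m u (-z)) :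
    WhittakerEqAt l m (fun z => u (-z)) z := by
  rw [WhittakerEqAt, deriv_deriv_comp_neg]
  rw [WhittakerEqAt, neg_sq, neg_div_neg_eq] at hu
  exact hu

lemma whittakerEqAt_neg_right {u : ℂ → ℂ} : WhittakerEqAt l (-m) u z ↔ WhittakerEqAt l m u z := by
  rw [WhittakerEqAt, WhittakerEqAt, neg_sq]

/-- The coefficient of `M_{l,m}` in `W_{l,m}`; that of `M_{l,-m}` is its value at `-m`. -/
noncomputable def whittakerCoeff (l m : ℂ) : ℂ := Gamma (-2 * m) / Gamma (1 / 2 - m - l)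

lemma whittakerW_eq (l m : ℂ) : whittakerW l m = fun z =>
    whittakerCoeff l m * whittakerM l m z + whittakerCoeff l (-m) * whittakerM l (-m) z := by
  ext z
  simp only [whittakerW, whittakerCoeff, sub_neg_eq_add, neg_mul_neg]

lemma differentiableOn_whittakerW (l m : ℂ) : DifferentiableOn ℂ (whittakerW l m) slitPlane := by
  rw [whittakerW_eq]
  exact ((differentiableOn_whittakerM l m).const_mul _).add
    ((differentiableOn_whittakerM l (-m)).const_mul _)

theorem whittakerEqAt_whittakerW (hm : ∀ n : ℤ, 2 * m ≠ n) (l : ℂ) (hz : z ∈ slitPlane) :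
    WhittakerEqAt l m (whittakerW l m) z := by
  rw [whittakerW_eq]
  exact .linearCombination isOpen_slitPlane (differentiableOn_whittakerM l m)
    (differentiableOn_whittakerM l (-m)) hz (whittakerEqAt_whittakerM hm l hz)
    (whittakerEqAt_neg_right.1 (whittakerEqAt_whittakerM (two_mul_neg_ne_intCast hm) l hz)) _ _

lemma isOpen_im_ne_zero : IsOpen {z : ℂ | z.im ≠ 0} := isOpen_ne_fun continuous_im continuous_const

lemma neg_mem_slitPlane_of_im_ne_zero (hz : z.im ≠ 0) : -z ∈ slitPlane :=
  .inr (by rwa [neg_im, neg_ne_zero])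

lemma differentiableOn_whittakerW_neg (l m : ℂ) :
    DifferentiableOn ℂ (fun z => whittakerW l m (-z)) {z | z.im ≠ 0} :=
  (differentiableOn_whittakerW l m).comp differentiable_neg.differentiableOn
    fun _ => neg_mem_slitPlane_of_im_ne_zero

theorem whittakerEqAt_whittakerW_neg (hm : ∀ n : ℤ, 2 * m ≠ n) (l : ℂ) (hz : z.im ≠ 0) :
    WhittakerEqAt l m (fun z => whittakerW (-l) m (-z)) z :=
  (whittakerEqAt_whittakerW hm (-l) (neg_mem_slitPlane_of_im_ne_zero hz)).comp_neg

lemma neg_cpow_of_im_pos (hz : 0 < z.im) (s : ℂ) :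
    (-z) ^ s = exp (-(Real.pi * s * I)) * z ^ s := by
  have hz0 : z ≠ 0 := fun h => hz.ne' (by simp [h])
  have hlog : log (-z) = log z - Real.pi * I := by
    rw [log, log, norm_neg, arg_neg_eq_arg_sub_pi_of_im_pos hz]
    push_cast
    ring
  rw [cpow_def_of_ne_zero (neg_ne_zero.2 hz0), cpow_def_of_ne_zero hz0, hlog, ← exp_add]
  congr 1
  ring

lemma whittakerM_neg_of_im_pos (hm : ∀ n : ℤ, 2 * m ≠ n) (l : ℂ) (hz : 0 < z.im) :
    whittakerM (-l) m (-z) = -I * exp (-(Real.pi * m * I)) * whittakerM l m z := by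
  have hexp : exp (-(Real.pi * (m + 1 / 2) * I)) = -I * exp (-(Real.pi * m * I)) := by
    rw [← exp_neg_pi_div_two_mul_I, ← exp_add]
    congr 1
    ring
  rw [whittakerM_eq, whittakerM_eq, whittakerFactor_neg hm, neg_cpow_of_im_pos hz, hexp, mul_assoc]

lemma wronsk_linearCombination {U : Set ℂ} {u w : ℂ → ℂ} (hU : IsOpen U)
    (hu : DifferentiableOn ℂ u U) (hw : DifferentiableOn ℂ w U) (hz : z ∈ U) (A B C D : ℂ) :
    wronsk (fun z => A * u z + B * w z) (fun z => C * u z + D * w z) z =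
      (A * D - B * C) * wronsk u w z := by
  rw [wronsk, wronsk, (hasDerivAt_linearCombination hU hu hw A B hz).deriv,
    (hasDerivAt_linearCombination hU hu hw C D hz).deriv]
  ring

lemma inv_Gamma_half_sub_mul_inv_Gamma_half_add (s : ℂ) :
    (Gamma (1 / 2 - s))⁻¹ * (Gamma (1 / 2 + s))⁻¹ = cos (Real.pi * s) / Real.pi := by
  have hreflection := Gamma_mul_Gamma_one_sub (1 / 2 + s)
  rw [show 1 - (1 / 2 + s) = 1 / 2 - s by ring] at hreflection
  rw [← mul_inv, mul_comm, hreflection, inv_div, mul_add, add_comm, mul_one_div,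
    sin_add_pi_div_two]

lemma mul_Gamma_mul_Gamma_neg {s : ℂ} (hs : s ≠ 0) :
    s * (Gamma s * Gamma (-s)) = -(Real.pi / sin (Real.pi * s)) := by
  rw [← Gamma_mul_Gamma_one_sub, sub_eq_neg_add, Gamma_add_one _ (neg_ne_zero.2 hs)]
  ring

lemma exp_mul_cos_add_sub_exp_neg_mul_cos_neg_add (s t : ℂ) :
    exp (s * I) * cos (s + t) - exp (-(s * I)) * cos (-s + t) = I * exp (t * I) * sin (2 * s) := by
  simp only [cos, sin, two_mul, add_mul, neg_mul, neg_add, neg_neg, exp_add, exp_neg]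
  field_simp
  ring_nf
  simp only [I_sq]
  ring

lemma whittakerCoeff_mul (l m : ℂ) :
    whittakerCoeff l m * whittakerCoeff (-l) (-m) =
      Gamma (2 * m) * Gamma (-(2 * m)) * cos (Real.pi * (m + l)) / Real.pi := by
  rw [mul_div_assoc, ← inv_Gamma_half_sub_mul_inv_Gamma_half_add, whittakerCoeff, whittakerCoeff,
    neg_mul_neg, sub_neg_eq_add, sub_neg_eq_add, sub_sub, add_assoc, neg_mul]
  ring

lemma whittakerCoeff_det (hm : ∀ n : ℤ, 2 * m ≠ n) (l : ℂ) :
    2 * m * (whittakerCoeff l m * whittakerCoeff (-l) (-m) * exp (Real.pi * m * I)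
      - whittakerCoeff l (-m) * whittakerCoeff (-l) m * exp (-(Real.pi * m * I)))
      = -I * exp (Real.pi * l * I) := by
  have hm0 : 2 * m ≠ 0 := fun h => hm 0 (by rw [h, Int.cast_zero])
  have hpi : (Real.pi : ℂ) ≠ 0 := ofReal_ne_zero.2 Real.pi_ne_zero
  have hsin : sin (Real.pi * (2 * m)) ≠ 0 := sin_ne_zero_iff.2 fun n h => hm n <| by
    rw [mul_comm] at h
    exact mul_right_cancel₀ hpi h
  have hsnd := whittakerCoeff_mul l (-m)
  rw [neg_neg, mul_neg, neg_neg] at hsnd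
  have hcos := exp_mul_cos_add_sub_exp_neg_mul_cos_neg_add (Real.pi * m) (Real.pi * l)
  rw [← mul_add, neg_mul_eq_mul_neg (Real.pi : ℂ) m, ← mul_add, mul_left_comm] at hcos
  have hGamma := mul_Gamma_mul_Gamma_neg hm0
  calc _ = 2 * m * (Gamma (2 * m) * Gamma (-(2 * m))) / Real.pi *
        (exp (Real.pi * m * I) * cos (Real.pi * (m + l))
          - exp (-(Real.pi * m * I)) * cos (Real.pi * (-m + l))) := by
        rw [whittakerCoeff_mul, hsnd]
        ring
    _ = -I * exp (Real.pi * l * I) := by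
        rw [hcos, hGamma]
        generalize sin (Real.pi * (2 * m)) = x at hsin ⊢
        field_simp

lemma wronsk_congr_right {u w w₁ : ℂ → ℂ} (h : w =ᶠ[𝓝 z] w₁) :
    wronsk u w z = wronsk u w₁ z := by
  rw [wronsk, wronsk, h.deriv_eq, h.self_of_nhds]

theorem wronsk_whittakerW_of_im_pos (hm : ∀ n : ℤ, 2 * m ≠ n) (l : ℂ) (hz : 0 < z.im) :
    wronsk (whittakerW l m) (fun z => whittakerW (-l) m (-z)) z = exp (Real.pi * l * I) := by
  have hslit : z ∈ slitPlane := .inr hz.ne'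
  have hconnection : (fun z => whittakerW (-l) m (-z)) =ᶠ[𝓝 z] fun z =>
      whittakerCoeff (-l) m * (-I * exp (-(Real.pi * m * I))) * whittakerM l m z
        + whittakerCoeff (-l) (-m) * (-I * exp (Real.pi * m * I)) * whittakerM l (-m) z := by
    filter_upwards [(isOpen_lt continuous_const continuous_im).mem_nhds hz] with x hx
    simp only [whittakerW_eq]
    rw [whittakerM_neg_of_im_pos hm l hx,
      whittakerM_neg_of_im_pos (two_mul_neg_ne_intCast hm) l hx,
      show -(Real.pi * -m * I) = Real.pi * m * I by ring]
    ring
  rw [wronsk_congr_right hconnection, whittakerW_eq, wronsk_linearCombination isOpen_slitPlane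
    (differentiableOn_whittakerM l m) (differentiableOn_whittakerM l (-m)) hslit,
    wronsk_whittakerM hm l hslit]
  linear_combination I * whittakerCoeff_det hm l - exp (Real.pi * l * I) * I_sq

lemma wronsk_comp_neg (u w : ℂ → ℂ) (z : ℂ) :
    wronsk (fun z => u (-z)) (fun z => w (-z)) z = wronsk w u (-z) := by
  rw [wronsk, wronsk, deriv_comp_neg, deriv_comp_neg]
  ring

theorem wronsk_whittakerW_ne_zero (hm : ∀ n : ℤ, 2 * m ≠ n) (l : ℂ) (hz : z.im ≠ 0) :
    wronsk (whittakerW l m) (fun z => whittakerW (-l) m (-z)) z ≠ 0 := by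
  rcases hz.lt_or_gt with him | him
  · have hreflect := wronsk_comp_neg (fun z => whittakerW l m (-z)) (whittakerW (-l) m) z
    have hpos := wronsk_whittakerW_of_im_pos hm (-l) (z := -z) (by simpa using him)
    simp only [neg_neg] at hreflect hpos
    rw [hreflect, hpos]
    exact exp_ne_zero _
  · rw [wronsk_whittakerW_of_im_pos hm l him]
    exact exp_ne_zero _

end WhittakerW

section ReciprocalCoefficient

variable {J : Set ℝ} {r₀ v₀ : E3} {k ω t : ℝ} {h : ℝ → ℝ} {μ : ℂ}

lemma hasDerivAt_whitZ (k ω : ℝ) (v₀ : E3) (t : ℝ) :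
    HasDerivAt (whitZ k ω v₀) (2 * speed v₀ * k * ω / (2 * I * (ω : ℂ) ^ 2)) t :=
  ((((hasDerivAt_id t).ofReal_comp.const_mul (2 * speed v₀ * k * ω : ℂ)).add_const
    (speed v₀ * k : ℂ)).div_const (2 * I * (ω : ℂ) ^ 2)).congr_deriv (by simp)

lemma whitZ_im_ne_zero (hw : wedge r₀ v₀ ≠ 0) (hk : k ≠ 0) (hω : ω ≠ 0)
    (ht : 1 + 2 * ω * t ≠ 0) : (whitZ k ω v₀ t).im ≠ 0 := by
  have hb := (speed_pos hw).ne'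
  have hω' : (ω : ℂ) ≠ 0 := ofReal_ne_zero.2 hω
  have hz : whitZ k ω v₀ t =
      ((-(speed v₀ * k * (1 + 2 * ω * t) / (2 * ω ^ 2)) : ℝ) : ℂ) * I := by
    rw [whitZ]
    push_cast
    field_simp
    ring_nf
    simp only [I_sq]
    ring
  rw [hz, im_ofReal_mul, I_im, mul_one]
  exact neg_ne_zero.2 (div_ne_zero (mul_ne_zero (mul_ne_zero hb hk) ht) (by simp [hω]))

lemma whitMuSq_neg (hw : wedge r₀ v₀ ≠ 0) (hk : k ≠ 0) (hω : ω ≠ 0) :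
    whitMuSq k ω r₀ v₀ < 0 := by
  have hc := parC_pos hw
  have hsq : 4 * beta r₀ v₀ * ω - speed v₀ ^ 2 - 4 * alpha r₀ * ω ^ 2 =
      -((speed v₀ - 2 * ω * parA r₀ v₀) ^ 2 + 4 * ω ^ 2 * parC r₀ v₀ ^ 2) := by
    rw [← speed_mul_parA hw, ← parC_sq_add_parA_sq hw]
    ring
  rw [whitMuSq, hsq]
  refine div_neg_of_neg_of_pos (mul_neg_of_pos_of_neg (by positivity) ?_) (by positivity)
  exact neg_neg_of_pos (by positivity)

lemma two_mul_ne_intCast_of_sq_neg {x : ℝ} (hx : x < 0) (hμ : μ ^ 2 = x) (n : ℤ) :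
    2 * μ ≠ n := fun h => by
  have hn : (n : ℝ) ^ 2 = 4 * x := by
    have hsq : (n : ℂ) ^ 2 = 4 * x := by
      rw [← h, ← hμ]
      ring
    exact_mod_cast hsq
  linarith [sq_nonneg (n : ℝ)]

lemma hasDerivAt_one_add_two_mul (ω t : ℝ) :
    HasDerivAt (fun t : ℝ => 1 + 2 * ω * t) (2 * ω) t := by
  simpa using ((hasDerivAt_id t).const_mul (2 * ω)).const_add 1

lemma hasDerivAt_reciprocal (hh : ∀ t, h t = 2 * k / (1 + 2 * ω * t)) (ht : 1 + 2 * ω * t ≠ 0) :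
    HasDerivAt h (-(4 * k * ω) / (1 + 2 * ω * t) ^ 2) t := by
  rw [show h = fun t => 2 * k / (1 + 2 * ω * t) from funext hh]
  exact ((hasDerivAt_const t (2 * k)).div (hasDerivAt_one_add_two_mul ω t) ht).congr_deriv (by ring)

lemma reciprocal_ne_zero (hk : k ≠ 0) (hh : ∀ t, h t = 2 * k / (1 + 2 * ω * t))
    (ht : 1 + 2 * ω * t ≠ 0) : h t ≠ 0 :=
  hh t ▸ div_ne_zero (mul_ne_zero two_ne_zero hk) ht

lemma hasDerivAt_deriv_reciprocal (hh : ∀ t, h t = 2 * k / (1 + 2 * ω * t))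
    (ht : 1 + 2 * ω * t ≠ 0) :
    HasDerivAt (deriv h) (16 * k * ω ^ 2 / (1 + 2 * ω * t) ^ 3) t := by
  have hlin := hasDerivAt_one_add_two_mul ω t
  have hU : IsOpen {t : ℝ | 1 + 2 * ω * t ≠ 0} :=
    isOpen_ne_fun (by fun_prop) continuous_const
  refine (((hasDerivAt_const t (-(4 * k * ω))).fun_div (hlin.fun_pow 2)
    (pow_ne_zero 2 ht)).congr_deriv ?_).congr_of_eventuallyEq
    (deriv_eventuallyEq_of_isOpen hU (fun _ hs => hasDerivAt_reciprocal hh hs) ht)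
  field_simp
  ring

lemma whittaker_potential (hw : wedge r₀ v₀ ≠ 0) (hk : k ≠ 0) (hω : ω ≠ 0)
    (hh : ∀ t, h t = 2 * k / (1 + 2 * ω * t)) (hμ : μ ^ 2 = (whitMuSq k ω r₀ v₀ : ℂ))
    (ht : 1 + 2 * ω * t ≠ 0) :
    I * speed v₀ * h t / 2 - (chi r₀ v₀ t : ℂ) * ((h t : ℂ) / 2) ^ 2
        + 3 / 4 * ((deriv h t / h t : ℝ) : ℂ) ^ 2
        - 1 / 2 * ((deriv (deriv h) t / h t : ℝ) : ℂ) =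
      -(2 * speed v₀ * k * ω / (2 * I * (ω : ℂ) ^ 2)) ^ 2 *
        (1 / 4 * (1 / whitZ k ω v₀ t ^ 2 - 1) + whitL k ω r₀ v₀ / whitZ k ω v₀ t
          - μ ^ 2 / whitZ k ω v₀ t ^ 2) := by
  have hb : (speed v₀ : ℂ) ≠ 0 := ofReal_ne_zero.2 (speed_pos hw).ne'
  have hk' : (k : ℂ) ≠ 0 := ofReal_ne_zero.2 hk
  have hω' : (ω : ℂ) ≠ 0 := ofReal_ne_zero.2 hω
  obtain ⟨x, hx⟩ : ∃ x, x = 1 + 2 * ω * t := ⟨_, rfl⟩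
  have hx0 : (x : ℂ) ≠ 0 := ofReal_ne_zero.2 (hx ▸ ht)
  have htx : t = (x - 1) / (2 * ω) := by
    rw [hx]
    field
  have hz : whitZ k ω v₀ t = speed v₀ * k * x / (2 * I * (ω : ℂ) ^ 2) := by
    rw [whitZ, hx]
    push_cast
    ring
  rw [hμ, (hasDerivAt_reciprocal hh ht).deriv, (hasDerivAt_deriv_reciprocal hh ht).deriv, hh,
    hz, whitMuSq, whitL, chi, ← hx, htx]
  push_cast
  field_simp
  ring_nf
  simp only [I_sq, I_pow_three]
  ring

theorem solvesSchroedinger_iff_whittakerEqAt (hw : wedge r₀ v₀ ≠ 0) (hk : k ≠ 0)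
    (hω : ω ≠ 0) (hJω : ∀ t ∈ J, 1 + 2 * ω * t ≠ 0)
    (hh : ∀ t, h t = 2 * k / (1 + 2 * ω * t)) (hμ : μ ^ 2 = (whitMuSq k ω r₀ v₀ : ℂ))
    {U : Set ℂ} {y : ℂ → ℂ} (hU : IsOpen U) (hy : DifferentiableOn ℂ y U)
    (hJU : ∀ t ∈ J, whitZ k ω v₀ t ∈ U) :
    SolvesSchroedinger h r₀ v₀ J (fun t => y (whitZ k ω v₀ t)) ↔
      ∀ t ∈ J, WhittakerEqAt (whitL k ω r₀ v₀) μ y (whitZ k ω v₀ t) := by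
  have hb : (speed v₀ : ℂ) ≠ 0 := ofReal_ne_zero.2 (speed_pos hw).ne'
  have hk' : (k : ℂ) ≠ 0 := ofReal_ne_zero.2 hk
  have hω' : (ω : ℂ) ≠ 0 := ofReal_ne_zero.2 hω
  have hζ : (2 * speed v₀ * k * ω / (2 * I * (ω : ℂ) ^ 2)) ^ 2 ≠ 0 := by simp [hb, hk', hω']
  refine forall₂_congr fun t ht => ?_
  have hd := hasDerivAt_comp_affine (hasDerivAt_whitZ k ω v₀) hU hy (hJU t ht)
  have hd₂ := hasDerivAt_deriv_comp_affine (hasDerivAt_whitZ k ω v₀) hU hy (hJU t ht)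
  rw [whittaker_potential hw hk hω hh hμ (hJω t ht), WhittakerEqAt]
  refine ⟨fun H => mul_left_cancel₀ hζ ?_, fun H => ⟨hd.differentiableAt, hd₂.congr_deriv ?_⟩⟩
  · linear_combination hd₂.unique H.2
  · linear_combination (2 * speed v₀ * k * ω / (2 * I * (ω : ℂ) ^ 2)) ^ 2 * H

theorem isGenerating_whittaker (hJ : IsOpen J) (hJ0 : (0 : ℝ) ∈ J) (hw : wedge r₀ v₀ ≠ 0)
    (hk : k ≠ 0) (hω : ω ≠ 0) (hJω : ∀ t ∈ J, 1 + 2 * ω * t ≠ 0)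
    (hh : ∀ t, h t = 2 * k / (1 + 2 * ω * t)) (hμ : μ ^ 2 = (whitMuSq k ω r₀ v₀ : ℂ))
    {u w : ℂ → ℂ} {A B y : ℂ} (hu : u = whittakerW (whitL k ω r₀ v₀) μ)
    (hv : w = fun z => whittakerW (-whitL k ω r₀ v₀) μ (-z))
    (hy : y = phiDerivInit h r₀ v₀ * (I * ω / (speed v₀ * k)))
    (hA : A = coeffFst u w (whitZ k ω v₀ 0) (phiInit h) y)
    (hB : B = coeffSnd u w (whitZ k ω v₀ 0) (phiInit h) y) :
    IsGenerating h r₀ v₀ J (fun t => (h t : ℂ) ^ (1 / 2 : ℂ) *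
      (A * u (whitZ k ω v₀ t) + B * w (whitZ k ω v₀ t))) := by
  have hm := two_mul_ne_intCast_of_sq_neg (whitMuSq_neg hw hk hω) hμ
  have hz : ∀ t ∈ J, whitZ k ω v₀ t ∈ {z : ℂ | z.im ≠ 0} := fun t ht =>
    whitZ_im_ne_zero hw hk hω (hJω t ht)
  have hW : wronsk u w (whitZ k ω v₀ 0) ≠ 0 := by
    rw [hu, hv]
    exact wronsk_whittakerW_ne_zero hm _ (hz 0 hJ0)
  have hU := isOpen_im_ne_zero
  have hdu : DifferentiableOn ℂ u {z | z.im ≠ 0} := by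
    rw [hu]
    exact (differentiableOn_whittakerW _ _).mono fun _ => .inr
  have hdw : DifferentiableOn ℂ w {z | z.im ≠ 0} := hv ▸ differentiableOn_whittakerW_neg _ _
  have hd : DifferentiableOn ℂ (fun z => A * u z + B * w z) {z : ℂ | z.im ≠ 0} :=
    (hdu.const_mul A).add (hdw.const_mul B)
  have hh' : ∀ t ∈ J, DifferentiableAt ℝ h t ∧ DifferentiableAt ℝ (deriv h) t ∧ h t ≠ 0 :=
    fun t ht => ⟨(hasDerivAt_reciprocal hh (hJω t ht)).differentiableAt,
      (hasDerivAt_deriv_reciprocal hh (hJω t ht)).differentiableAt,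
      reciprocal_ne_zero hk hh (hJω t ht)⟩
  refine (isGenerating_iff_solvesSchroedinger hJ hJ0 hh' fun t _ => rfl).2
    ⟨(solvesSchroedinger_iff_whittakerEqAt hw hk hω hJω hh hμ hU hd hz).2 fun t ht => ?_, ?_, ?_⟩
  · exact .linearCombination hU hdu hdw (hz t ht)
      (hu ▸ whittakerEqAt_whittakerW hm _ (.inr (hz t ht)))
      (hv ▸ whittakerEqAt_whittakerW_neg hm _ (hz t ht)) A B
  · rw [hA, hB]
    exact coeff_value hW _ _
  · have hb : (speed v₀ : ℂ) ≠ 0 := ofReal_ne_zero.2 (speed_pos hw).ne'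
    have hk' : (k : ℂ) ≠ 0 := ofReal_ne_zero.2 hk
    have hω' : (ω : ℂ) ≠ 0 := ofReal_ne_zero.2 hω
    rw [(hasDerivAt_comp_affine (hasDerivAt_whitZ k ω v₀) hU hd (hz 0 hJ0)).deriv,
      (hasDerivAt_linearCombination hU hdu hdw A B (hz 0 hJ0)).deriv, hA, hB, coeff_deriv hW, hy]
    field_simp

theorem isGenerating_reciprocal_iff (hJ : IsOpen J) (hJc : J.OrdConnected) (hJ0 : (0 : ℝ) ∈ J)
    (hw : wedge r₀ v₀ ≠ 0) (hk : k ≠ 0) (hω : ω ≠ 0) (hJω : ∀ t ∈ J, 1 + 2 * ω * t ≠ 0)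
    (hh : ∀ t, h t = 2 * k / (1 + 2 * ω * t)) (hμ : μ ^ 2 = (whitMuSq k ω r₀ v₀ : ℂ))
    {u w : ℂ → ℂ} {A B y : ℂ} (hu : u = whittakerW (whitL k ω r₀ v₀) μ)
    (hv : w = fun z => whittakerW (-whitL k ω r₀ v₀) μ (-z))
    (hy : y = phiDerivInit h r₀ v₀ * (I * ω / (speed v₀ * k)))
    (hA : A = coeffFst u w (whitZ k ω v₀ 0) (phiInit h) y)
    (hB : B = coeffSnd u w (whitZ k ω v₀ 0) (phiInit h) y) (f : ℝ → ℂ) :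
    IsGenerating h r₀ v₀ J f ↔ ∀ t ∈ J, f t = (h t : ℂ) ^ (1 / 2 : ℂ) *
      (A * u (whitZ k ω v₀ t) + B * w (whitZ k ω v₀ t)) :=
  isGenerating_iff_eqOn hJ hJc hJ0 hw
    (fun t ht => ⟨(hasDerivAt_reciprocal hh (hJω t ht)).differentiableAt,
      reciprocal_ne_zero hk hh (hJω t ht)⟩)
    (isGenerating_whittaker hJ hJ0 hw hk hω hJω hh hμ hu hv hy hA hB) f

end ReciprocalCoefficient

/-! ### Euler's integral -/

section CutPlane

open Set Filter Topology Metric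

variable {z : ℂ}

/-- The complement of the cut `[1, ∞)`, the domain on which `IsGaussHypergeometric` continues the
hypergeometric series. -/
def cutPlane : Set ℂ := {z | 1 - z ∈ slitPlane}

lemma isOpen_cutPlane : IsOpen cutPlane :=
  isOpen_slitPlane.preimage (continuous_const.sub continuous_id)

lemma zero_mem_cutPlane : (0 : ℂ) ∈ cutPlane := by simp [cutPlane]

lemma one_sub_mul_mem_slitPlane (hz : z ∈ cutPlane) {x : ℝ} (hx : x ∈ Icc (0 : ℝ) 1) :
    1 - z * x ∈ slitPlane := by
  have h := starConvex_one_slitPlane.add_smul_mem (y := -z)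
    (by rwa [← sub_eq_add_neg]) hx.1 hx.2
  rwa [real_smul, show (1 : ℂ) + x * -z = 1 - z * x by ring] at h

lemma isPreconnected_cutPlane : IsPreconnected cutPlane := by
  have hstar : StarConvex ℝ (0 : ℂ) cutPlane := fun z hz a b ha hb hab => by
    simpa [cutPlane, mul_comm] using one_sub_mul_mem_slitPlane hz (x := b) ⟨hb, by linarith⟩
  exact (hstar.isPathConnected zero_mem_cutPlane).isConnected.isPreconnected

lemma ball_subset_cutPlane : ball (0 : ℂ) 1 ⊆ cutPlane := fun z hz => by
  have hz' : ‖-z‖ < 1 := by simpa using hz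
  simpa [cutPlane, sub_eq_add_neg] using mem_slitPlane_of_norm_lt_one hz'

lemma eqOn_cutPlane_of_eqOn_ball {f g : ℂ → ℂ} (hf : DifferentiableOn ℂ f cutPlane)
    (hg : DifferentiableOn ℂ g cutPlane) (h : EqOn f g (ball 0 1)) : EqOn f g cutPlane :=
  (hf.analyticOnNhd isOpen_cutPlane).eqOn_of_preconnected_of_eventuallyEq
    (hg.analyticOnNhd isOpen_cutPlane) isPreconnected_cutPlane zero_mem_cutPlane
    (h.eventuallyEq_of_mem (ball_mem_nhds 0 one_pos))

end CutPlane

section EulerIntegral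

open Set Filter Topology Metric MeasureTheory
open scoped Interval

variable {u v z : ℂ}

/-- Euler's integral `∫₀¹ x^(u-1) (1-x)^(v-1) (1-zx)^(-s) dx`, which is
`B(u, v) F(u, s; u + v; z)`. -/
noncomputable def eulerIntegral (u v s z : ℂ) : ℂ :=
  ∫ x : ℝ in 0..1, (x : ℂ) ^ (u - 1) * (1 - (x : ℂ)) ^ (v - 1) * (1 - z * x) ^ (-s)

lemma continuousOn_one_sub_mul_cpow (s : ℂ) :
    ContinuousOn (fun p : ℂ × ℝ => (1 - p.1 * (p.2 : ℂ)) ^ s) (cutPlane ×ˢ Icc 0 1) :=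
  ContinuousOn.cpow_const (by fun_prop) fun _ hp => one_sub_mul_mem_slitPlane hp.1 hp.2

lemma continuousOn_one_sub_mul_cpow_right (hz : z ∈ cutPlane) (s : ℂ) :
    ContinuousOn (fun x : ℝ => (1 - z * (x : ℂ)) ^ s) (Icc 0 1) :=
  (continuousOn_one_sub_mul_cpow s).comp (f := fun x : ℝ => (z, x)) (by fun_prop)
    fun _ hx => ⟨hz, hx⟩

lemma hasDerivAt_one_sub_mul_cpow (hz : z ∈ cutPlane) (s : ℂ) {x : ℝ} (hx : x ∈ Icc (0 : ℝ) 1) :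
    HasDerivAt (fun z : ℂ => (1 - z * (x : ℂ)) ^ (-s))
      (s * (x * (1 - z * (x : ℂ)) ^ (-(s + 1)))) z := by
  have hlin : HasDerivAt (fun z : ℂ => 1 - z * (x : ℂ)) (-x) z := by
    simpa using ((hasDerivAt_id z).mul_const (x : ℂ)).const_sub 1
  refine (hlin.cpow_const (one_sub_mul_mem_slitPlane hz hx)).congr_deriv ?_
  rw [show -s - 1 = -(s + 1) by ring]
  ring

lemma intervalIntegrable_eulerIntegrand (hu : 0 < u.re) (hv : 0 < v.re) {f : ℝ → ℂ}
    (hf : ContinuousOn f (Icc 0 1)) :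
    IntervalIntegrable (fun x : ℝ => (x : ℂ) ^ (u - 1) * (1 - (x : ℂ)) ^ (v - 1) * f x)
      volume 0 1 :=
  (betaIntegral_convergent hu hv).mul_continuousOn (by rwa [uIcc_of_le zero_le_one])

lemma eulerIntegral_add_one (hu : u ≠ 0) (v s z : ℂ) :
    eulerIntegral (u + 1) v s z =
      ∫ x : ℝ in 0..1, (x : ℂ) ^ (u - 1) * (1 - (x : ℂ)) ^ (v - 1) *
        (x * (1 - z * x) ^ (-s)) := by
  refine intervalIntegral.integral_congr fun x _ => ?_
  have hpow : (x : ℂ) ^ (u + 1 - 1) = (x : ℂ) ^ (u - 1) * x := by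
    rcases eq_or_ne (x : ℂ) 0 with h | h
    · simp [h, hu]
    · rw [add_sub_cancel_right, cpow_sub _ _ h, cpow_one, div_mul_cancel₀ _ h]
  simp only [hpow]
  ring

theorem hasDerivAt_eulerIntegral (hu : 0 < u.re) (hv : 0 < v.re) (s : ℂ) (hz : z ∈ cutPlane) :
    HasDerivAt (eulerIntegral u v s) (s * eulerIntegral (u + 1) v (s + 1) z) z := by
  obtain ⟨ε, hε, hball⟩ := Metric.nhds_basis_closedBall.mem_iff.1 (isOpen_cutPlane.mem_nhds hz)
  have hIcc : ∀ {x : ℝ}, x ∈ Ι (0 : ℝ) 1 → x ∈ Icc (0 : ℝ) 1 := fun hx => by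
    rw [uIoc_of_le zero_le_one] at hx
    exact Ioc_subset_Icc_self hx
  have hderiv : ContinuousOn
      (fun p : ℂ × ℝ => s * (p.2 * (1 - p.1 * (p.2 : ℂ)) ^ (-(s + 1))))
      (closedBall z ε ×ˢ Icc 0 1) :=
    (ContinuousOn.mul (by fun_prop) ((continuousOn_one_sub_mul_cpow _).mono
      (prod_mono_left hball))).const_mul s
  obtain ⟨M, hM⟩ :=
    ((isCompact_closedBall z ε).prod isCompact_Icc).exists_bound_of_continuousOn hderiv
  have hint := intervalIntegral.hasDerivAt_integral_of_dominated_loc_of_deriv_le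
    (μ := volume) (a := 0) (b := 1) (x₀ := z) (s := closedBall z ε)
    (F := fun y (x : ℝ) => (x : ℂ) ^ (u - 1) * (1 - (x : ℂ)) ^ (v - 1) * (1 - y * x) ^ (-s))
    (F' := fun y (x : ℝ) => (x : ℂ) ^ (u - 1) * (1 - (x : ℂ)) ^ (v - 1) *
      (s * (x * (1 - y * x) ^ (-(s + 1)))))
    (bound := fun x : ℝ => ‖(x : ℂ) ^ (u - 1) * (1 - (x : ℂ)) ^ (v - 1)‖ * M)
    (closedBall_mem_nhds z hε)
    (by
      filter_upwards [isOpen_cutPlane.mem_nhds hz] with y hy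
      exact (intervalIntegrable_eulerIntegrand hu hv
        (continuousOn_one_sub_mul_cpow_right hy _)).def'.aestronglyMeasurable)
    (intervalIntegrable_eulerIntegrand hu hv (continuousOn_one_sub_mul_cpow_right hz _))
    (intervalIntegrable_eulerIntegrand hu hv (((by fun_prop : ContinuousOn _ _).mul
      (continuousOn_one_sub_mul_cpow_right hz _)).const_mul s)).def'.aestronglyMeasurable
    (ae_of_all _ fun x hx y hy => by
      rw [norm_mul]
      exact mul_le_mul_of_nonneg_left (hM (y, x) ⟨hy, hIcc hx⟩) (norm_nonneg _))
    ((betaIntegral_convergent hu hv).norm.mul_const M)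
    (ae_of_all _ fun x hx y hy =>
      (hasDerivAt_one_sub_mul_cpow (hball hy) s (hIcc hx)).const_mul _)
  refine hint.2.congr_deriv ?_
  rw [eulerIntegral_add_one (fun h => hu.ne' (by simp [h])), ← intervalIntegral.integral_const_mul]
  exact intervalIntegral.integral_congr fun x _ => by ring

lemma differentiableOn_eulerIntegral (hu : 0 < u.re) (hv : 0 < v.re) (s : ℂ) :
    DifferentiableOn ℂ (eulerIntegral u v s) cutPlane := fun _ hz =>
  (hasDerivAt_eulerIntegral hu hv s hz).differentiableAt.differentiableWithinAt

lemma eulerIntegral_zero (u v s : ℂ) : eulerIntegral u v s 0 = betaIntegral u v := by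
  simp [eulerIntegral, betaIntegral]

lemma betaIntegral_ne_zero (hu : 0 < u.re) (hv : 0 < v.re) : betaIntegral u v ≠ 0 := by
  rw [betaIntegral_eq_Gamma_mul_div u v hu hv]
  have huv : 0 < (u + v).re := add_pos hu hv
  exact div_ne_zero (mul_ne_zero (Gamma_ne_zero_of_re_pos hu) (Gamma_ne_zero_of_re_pos hv))
    (Gamma_ne_zero_of_re_pos huv)

lemma betaIntegral_add_one (hu : 0 < u.re) (hv : 0 < v.re) :
    (u + v) * betaIntegral (u + 1) v = u * betaIntegral u v := by
  have huv : 0 < (u + v).re := add_pos hu hv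
  have hu₀ : u ≠ 0 := fun h => hu.ne' (by simp [h])
  have huv₀ : u + v ≠ 0 := fun h => huv.ne' (by simp [h])
  have hΓ := Gamma_ne_zero_of_re_pos huv
  rw [betaIntegral_eq_Gamma_mul_div u v hu hv, betaIntegral_eq_Gamma_mul_div (u + 1) v
    (by simpa using add_pos hu one_pos) hv, add_right_comm, Gamma_add_one _ hu₀,
    Gamma_add_one _ huv₀]
  field

lemma taylorCoeff_const_mul (s : ℂ) (f : ℂ → ℂ) (n : ℕ) :
    taylorCoeff (fun z => s * f z) n = s * taylorCoeff f n := by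
  rw [taylorCoeff, taylorCoeff, iteratedDeriv_const_mul_field, mul_div_assoc]

lemma taylorCoeff_eulerIntegral_succ (hu : 0 < u.re) (hv : 0 < v.re) (s : ℂ) (n : ℕ) :
    (n + 1) * taylorCoeff (eulerIntegral u v s) (n + 1) =
      s * taylorCoeff (eulerIntegral (u + 1) v (s + 1)) n := by
  rw [← taylorCoeff_deriv, ← taylorCoeff_const_mul]
  refine taylorCoeff_congr ?_ n
  filter_upwards [isOpen_cutPlane.mem_nhds zero_mem_cutPlane] with z hz
  exact (hasDerivAt_eulerIntegral hu hv s hz).deriv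

theorem taylorCoeff_eulerIntegral_recurrence (hu : 0 < u.re) (hv : 0 < v.re) (s : ℂ) (n : ℕ) :
    (n + 1) * (n + (u + v)) * taylorCoeff (eulerIntegral u v s) (n + 1) =
      (n + u) * (n + s) * taylorCoeff (eulerIntegral u v s) n := by
  have hsucc := @taylorCoeff_eulerIntegral_succ
  induction n generalizing u s with
  | zero =>
    have hβ := betaIntegral_add_one hu hv
    have h₀ := hsucc hu hv s 0
    rw [taylorCoeff_zero, eulerIntegral_zero] at *
    push_cast at *
    linear_combination (u + v) * h₀ + s * hβ
  | succ n ih =>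
    have hu' : 0 < (u + 1).re := by simpa using add_pos hu one_pos
    refine mul_left_cancel₀ (Nat.cast_add_one_ne_zero n : (n : ℂ) + 1 ≠ 0) ?_
    have hn := hsucc hu hv s n
    have hn' := hsucc hu hv s (n + 1)
    push_cast at hn' ⊢
    linear_combination (n + 1) * (n + 1 + u + v) * hn' + s * ih hu' (s + 1)
      - (n + 1 + u) * (n + 1 + s) * hn

end EulerIntegral

/-! ### The Gauss hypergeometric function -/

section Gauss

open Set Filter Topology Metric
open scoped Nat

variable {a b c z : ℂ}

lemma one_le_radius_ordinaryHypergeometricSeries (a b c : ℂ) :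
    1 ≤ (ordinaryHypergeometricSeries ℂ a b c).radius := by
  by_cases h : ∀ k : ℕ, (k : ℂ) ≠ -a ∧ (k : ℂ) ≠ -b ∧ (k : ℂ) ≠ -c
  · exact (ordinaryHypergeometricSeries_radius_eq_one ℂ a b c h).ge
  · suffices (ordinaryHypergeometricSeries ℂ a b c).radius = ⊤ by simp [this]
    push Not at h
    obtain ⟨k, hk⟩ := h
    by_cases ha : (k : ℂ) = -a
    · rw [neg_eq_iff_eq_neg.1 ha.symm, ordinaryHypergeometric_radius_top_of_neg_nat₁]
    · by_cases hb : (k : ℂ) = -b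
      · rw [neg_eq_iff_eq_neg.1 hb.symm, ordinaryHypergeometric_radius_top_of_neg_nat₂]
      · rw [neg_eq_iff_eq_neg.1 (hk ha hb).symm, ordinaryHypergeometric_radius_top_of_neg_nat₃]

lemma hasFPowerSeriesOnBall_ordinaryHypergeometric (a b c : ℂ) :
    HasFPowerSeriesOnBall (ordinaryHypergeometric (𝔸 := ℂ) a b c)
      (ordinaryHypergeometricSeries ℂ a b c) 0 1 :=
  have hr := one_le_radius_ordinaryHypergeometricSeries a b c
  ((ordinaryHypergeometricSeries ℂ a b c).hasFPowerSeriesOnBall (one_pos.trans_le hr)).mono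
    one_pos hr

lemma differentiableOn_ordinaryHypergeometric (a b c : ℂ) :
    DifferentiableOn ℂ (ordinaryHypergeometric (𝔸 := ℂ) a b c) (ball 0 1) := by
  have h := (hasFPowerSeriesOnBall_ordinaryHypergeometric a b c).differentiableOn
  rwa [← ENNReal.ofReal_one, eball_ofReal] at h

lemma taylorCoeff_ordinaryHypergeometric_recurrence (hc : ∀ n : ℕ, c ≠ -n) (a b : ℂ) (n : ℕ) :
    (n + 1) * (n + c) * taylorCoeff (ordinaryHypergeometric (𝔸 := ℂ) a b c) (n + 1) =
      (n + a) * (n + b) * taylorCoeff (ordinaryHypergeometric (𝔸 := ℂ) a b c) n := by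
  have hs := (hasFPowerSeriesOnBall_ordinaryHypergeometric a b c).hasFPowerSeriesAt
  have hn : (n : ℂ) + 1 ≠ 0 := Nat.cast_add_one_ne_zero n
  have hf : (n ! : ℂ) ≠ 0 := Nat.cast_ne_zero.2 n.factorial_ne_zero
  have hnc : c + n ≠ 0 := fun h => hc n (eq_neg_of_add_eq_zero_left h)
  rw [taylorCoeff_eq_coeff hs, taylorCoeff_eq_coeff hs, ordinaryHypergeometricSeries,
    FormalMultilinearSeries.coeff_ofScalars, FormalMultilinearSeries.coeff_ofScalars,
    ordinaryHypergeometricCoefficient, ordinaryHypergeometricCoefficient]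
  simp only [ascPochhammer_succ_eval, Nat.factorial_succ, mul_inv]
  push_cast
  field

lemma eqOn_ordinaryHypergeometric_of_recurrence (hc : ∀ n : ℕ, c ≠ -n) {f : ℂ → ℂ}
    (hf : DifferentiableOn ℂ f (ball 0 1)) (h₀ : f 0 = 1)
    (h : ∀ n : ℕ, (n + 1) * (n + c) * taylorCoeff f (n + 1) =
      (n + a) * (n + b) * taylorCoeff f n) :
    EqOn f (ordinaryHypergeometric a b c) (ball 0 1) := by
  refine eqOn_ball_of_taylorCoeff_eq hf (differentiableOn_ordinaryHypergeometric a b c) fun n => ?_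
  induction n with
  | zero => rw [taylorCoeff_zero, taylorCoeff_zero, h₀, ordinaryHypergeometric_zero]
  | succ n ih =>
    have hnc : (n : ℂ) + c ≠ 0 := fun h => hc n (eq_neg_of_add_eq_zero_right h)
    refine mul_left_cancel₀ (mul_ne_zero (Nat.cast_add_one_ne_zero n) hnc) ?_
    rw [h, ih, taylorCoeff_ordinaryHypergeometric_recurrence hc]

theorem ordinaryHypergeometric_equation (hc : ∀ n : ℕ, c ≠ -n) (a b : ℂ)
    (hz : z ∈ ball (0 : ℂ) 1) :
    z * (1 - z) * deriv (deriv (ordinaryHypergeometric a b c)) z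
      + (c - (a + b + 1) * z) * deriv (ordinaryHypergeometric a b c) z
      = a * b * ordinaryHypergeometric a b c z := by
  have h := hasSum_gauss_operator (differentiableOn_ordinaryHypergeometric a b c) hz a b c
  simp only [taylorCoeff_ordinaryHypergeometric_recurrence hc, sub_self, zero_mul] at h
  linear_combination h.unique hasSum_zero

lemma deriv_ordinaryHypergeometric (hc : ∀ n : ℕ, c ≠ -n) (ha : a ≠ 0) (hb : b ≠ 0)
    (hz : z ∈ ball (0 : ℂ) 1) :
    deriv (ordinaryHypergeometric a b c) z =
      a * b / c * ordinaryHypergeometric (a + 1) (b + 1) (c + 1) z := by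
  have hc₀ : c ≠ 0 := by simpa using hc 0
  have hc₁ : ∀ n : ℕ, c + 1 ≠ -n := fun n h => hc (n + 1) (by
    push_cast
    linear_combination h)
  have hrec := taylorCoeff_ordinaryHypergeometric_recurrence hc a b
  have heq : EqOn (fun z => c / (a * b) * deriv (ordinaryHypergeometric a b c) z)
      (ordinaryHypergeometric (a + 1) (b + 1) (c + 1)) (ball 0 1) := by
    have hd := (differentiableOn_ordinaryHypergeometric a b c).deriv isOpen_ball
    refine eqOn_ordinaryHypergeometric_of_recurrence hc₁ (hd.const_mul _) ?_ fun n => ?_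
    · have h₀ := hrec 0
      have h₁ := taylorCoeff_deriv (ordinaryHypergeometric a b c) 0
      rw [taylorCoeff_zero, ordinaryHypergeometric_zero] at h₀
      rw [taylorCoeff_zero] at h₁
      push_cast at h₀ h₁
      rw [h₁]
      field_simp
      linear_combination h₀
    · have hn := hrec (n + 1)
      rw [taylorCoeff_const_mul, taylorCoeff_const_mul, taylorCoeff_deriv, taylorCoeff_deriv]
      push_cast at hn ⊢
      linear_combination c / (a * b) * (n + 1) * hn
  rw [← heq hz]
  field

lemma IsGaussHypergeometric.eqOn_ball {F : ℂ → ℂ} (hF : IsGaussHypergeometric a b c F) :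
    EqOn F (ordinaryHypergeometric a b c) (ball 0 1) := fun z hz => hF.2 z (by simpa using hz)

lemma IsGaussHypergeometric.map_zero {F : ℂ → ℂ} (hF : IsGaussHypergeometric a b c F) :
    F 0 = 1 := by
  rw [hF.2 0 (by simp), ordinaryHypergeometric_zero]

theorem IsGaussHypergeometric.equation {F : ℂ → ℂ} (hF : IsGaussHypergeometric a b c F)
    (hc : ∀ n : ℕ, c ≠ -n) (hz : z ∈ cutPlane) :
    z * (1 - z) * deriv (deriv F) z + (c - (a + b + 1) * z) * deriv F z = a * b * F z := by
  have hF₀ : DifferentiableOn ℂ F cutPlane := hF.1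
  have hF₁ := hF₀.deriv isOpen_cutPlane
  have hF₂ := hF₁.deriv isOpen_cutPlane
  refine eqOn_cutPlane_of_eqOn_ball
    (f := fun z => z * (1 - z) * deriv (deriv F) z + (c - (a + b + 1) * z) * deriv F z)
    (by fun_prop) (hF₀.const_mul (a * b)) (fun x hx => ?_) hz
  have hev := hF.eqOn_ball.eventuallyEq_of_mem (isOpen_ball.mem_nhds hx)
  simp only [hev.deriv.deriv_eq, hev.deriv_eq, hev.eq_of_nhds]
  exact ordinaryHypergeometric_equation hc a b hx

theorem isGaussHypergeometric_eulerIntegral (ha : 0 < a.re) (hac : a.re < c.re) (b : ℂ) :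
    IsGaussHypergeometric a b c
      (fun z => (betaIntegral a (c - a))⁻¹ * eulerIntegral a (c - a) b z) := by
  have hca : 0 < (c - a).re := by simpa using hac
  have hd : DifferentiableOn ℂ
      (fun z => (betaIntegral a (c - a))⁻¹ * eulerIntegral a (c - a) b z) cutPlane :=
    (differentiableOn_eulerIntegral ha hca b).const_mul _
  refine ⟨hd, fun z hz => ?_⟩
  refine eqOn_ordinaryHypergeometric_of_recurrence (ne_neg_natCast_of_re_pos (ha.trans hac))
    (hd.mono ball_subset_cutPlane) ?_ (fun n => ?_) (by simpa using hz)
  · rw [eulerIntegral_zero, inv_mul_cancel₀ (betaIntegral_ne_zero ha hca)]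
  · have h := taylorCoeff_eulerIntegral_recurrence ha hca b n
    rw [add_sub_cancel] at h
    rw [taylorCoeff_const_mul, taylorCoeff_const_mul]
    linear_combination (betaIntegral a (c - a))⁻¹ * h

/-- Since `F'(a, b; c; z) = (a b / c) F(a + 1, b + 1; c + 1; z)`, the differential equation
expresses `F(a, b; c; z)` through `F(a + 1, b + 1; c + 1; z)` and its derivative. -/
theorem IsGaussHypergeometric.of_add_one {G : ℂ → ℂ}
    (hG : IsGaussHypergeometric (a + 1) (b + 1) (c + 1) G) (hc : ∀ n : ℕ, c ≠ -n) (ha : a ≠ 0)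
    (hb : b ≠ 0) :
    IsGaussHypergeometric a b c
      (fun z => (z * (1 - z) * deriv G z + (c - (a + b + 1) * z) * G z) / c) := by
  have hG₀ : DifferentiableOn ℂ G cutPlane := hG.1
  have hG₁ := hG₀.deriv isOpen_cutPlane
  refine ⟨show DifferentiableOn ℂ _ cutPlane from DifferentiableOn.div_const (by fun_prop) _,
    fun z hz => ?_⟩
  have hz' : z ∈ ball (0 : ℂ) 1 := by simpa using hz
  have hSG : ∀ x ∈ ball (0 : ℂ) 1,
      deriv (ordinaryHypergeometric a b c) x = a * b / c * G x := fun x hx => by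
    rw [deriv_ordinaryHypergeometric hc ha hb hx, hG.eqOn_ball hx]
  have hSG' : deriv (deriv (ordinaryHypergeometric a b c)) z = a * b / c * deriv G z := by
    rw [(EqOn.eventuallyEq_of_mem hSG (isOpen_ball.mem_nhds hz')).deriv_eq,
      deriv_const_mul_field]
  have heq := ordinaryHypergeometric_equation hc a b hz'
  rw [hSG', hSG z hz'] at heq
  refine mul_left_cancel₀ (mul_ne_zero ha hb) ?_
  linear_combination heq

theorem exists_isGaussHypergeometric (ha : -1 < a.re) (hac : a.re < c.re) (hc : ∀ n : ℕ, c ≠ -n)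
    (ha₀ : a ≠ 0) (hb₀ : b ≠ 0) : ∃ F, IsGaussHypergeometric a b c F := by
  have ha' : 0 < (a + 1).re := by simpa using neg_lt_iff_pos_add.1 ha
  have hac' : (a + 1).re < (c + 1).re := by simpa using hac
  exact ⟨_, (isGaussHypergeometric_eulerIntegral ha' hac' (b + 1)).of_add_one hc ha₀ hb₀⟩

end Gauss

/-! ### The pair `F(z)`, `F(1 - z)` and the coefficient `k / r²` -/

section GaussPair

open Set Filter Topology Metric

variable {z : ℂ}

/-- The complement of the cuts `(-∞, 0]` and `[1, ∞)`, the common domain of `F(z)` and `F(1 - z)`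
for `F` holomorphic on `cutPlane`. -/
def doubleCutPlane : Set ℂ := slitPlane ∩ cutPlane

lemma isOpen_doubleCutPlane : IsOpen doubleCutPlane := isOpen_slitPlane.inter isOpen_cutPlane

lemma one_sub_mem_cutPlane (hz : z ∈ slitPlane) : 1 - z ∈ cutPlane := by
  simpa [cutPlane] using hz

lemma one_sub_mem_doubleCutPlane (hz : z ∈ doubleCutPlane) : 1 - z ∈ doubleCutPlane :=
  ⟨hz.2, one_sub_mem_cutPlane hz.1⟩

lemma mem_doubleCutPlane_of_re (h₀ : 0 < z.re) (h₁ : z.re < 1) : z ∈ doubleCutPlane :=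
  ⟨Or.inl h₀, Or.inl (by simpa using h₁)⟩

lemma half_mem_doubleCutPlane : ((1 / 2 : ℝ) : ℂ) ∈ doubleCutPlane :=
  mem_doubleCutPlane_of_re (by norm_num) (by rw [ofReal_re]; norm_num)

lemma isPreconnected_doubleCutPlane : IsPreconnected doubleCutPlane := by
  have hslit : StarConvex ℝ ((1 / 2 : ℝ) : ℂ) slitPlane :=
    starConvex_ofReal_slitPlane (by norm_num)
  have hcut : StarConvex ℝ ((1 / 2 : ℝ) : ℂ) cutPlane := fun z hz a b ha hb hab => by
    have hab' : (a : ℂ) + b = 1 := by exact_mod_cast hab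
    change 1 - (a • ((1 / 2 : ℝ) : ℂ) + b • z) ∈ slitPlane
    convert hslit hz ha hb hab using 1
    simp only [real_smul]
    push_cast
    linear_combination -hab'
  exact ((hslit.inter hcut).isPathConnected half_mem_doubleCutPlane).isConnected.isPreconnected

lemma mem_slitPlane_or_mem_cutPlane (z : ℂ) : z ∈ slitPlane ∨ z ∈ cutPlane := by
  rcases lt_or_ge 0 z.re with h | h
  · exact Or.inl (Or.inl h)
  · exact Or.inr (Or.inl (by simpa using h.trans_lt one_pos))

lemma exists_differentiable_eqOn_cutPlane {f g : ℂ → ℂ} (hf : DifferentiableOn ℂ f cutPlane)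
    (hg : DifferentiableOn ℂ g slitPlane) (hfg : EqOn f g doubleCutPlane) :
    ∃ H : ℂ → ℂ, Differentiable ℂ H ∧ EqOn H f cutPlane := by
  classical
  set H : ℂ → ℂ := cutPlane.piecewise f g
  have hHf : EqOn H f cutPlane := piecewise_eqOn _ f g
  have hHg : EqOn H g slitPlane := fun z hz => by
    by_cases h : z ∈ cutPlane
    · exact (hHf h).trans (hfg ⟨hz, h⟩)
    · exact piecewise_eq_of_notMem _ f g h
  refine ⟨H, fun z => ?_, hHf⟩
  rcases mem_slitPlane_or_mem_cutPlane z with hz | hz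
  · have hz' := isOpen_slitPlane.mem_nhds hz
    exact (hg.differentiableAt hz').congr_of_eventuallyEq (hHg.eventuallyEq_of_mem hz')
  · have hz' := isOpen_cutPlane.mem_nhds hz
    exact (hf.differentiableAt hz').congr_of_eventuallyEq (hHf.eventuallyEq_of_mem hz')

lemma deriv_one_sub (F : ℂ → ℂ) : deriv (fun z => F (1 - z)) = fun z => -deriv F (1 - z) :=
  funext fun z => deriv_comp_const_sub F 1 z

lemma deriv_deriv_one_sub (F : ℂ → ℂ) :
    deriv (deriv fun z => F (1 - z)) = fun z => deriv (deriv F) (1 - z) := by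
  funext z
  rw [deriv_one_sub, deriv.fun_neg, deriv_comp_const_sub, neg_neg]

lemma differentiableOn_comp_one_sub {F : ℂ → ℂ} (hF : DifferentiableOn ℂ F cutPlane) :
    DifferentiableOn ℂ (fun z => F (1 - z)) slitPlane :=
  hF.comp (by fun_prop) fun _ => one_sub_mem_cutPlane

lemma mul_one_sub_mul_wronsk_eq {u w : ℂ → ℂ} {q : ℂ} (hu : DifferentiableOn ℂ u doubleCutPlane)
    (hw : DifferentiableOn ℂ w doubleCutPlane)
    (hue : ∀ z ∈ doubleCutPlane,
      z * (1 - z) * deriv (deriv u) z + (1 - 2 * z) * deriv u z = q * u z)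
    (hwe : ∀ z ∈ doubleCutPlane,
      z * (1 - z) * deriv (deriv w) z + (1 - 2 * z) * deriv w z = q * w z)
    {x y : ℂ} (hx : x ∈ doubleCutPlane) (hy : y ∈ doubleCutPlane) :
    x * (1 - x) * wronsk u w x = y * (1 - y) * wronsk u w y := by
  have hd : ∀ z ∈ doubleCutPlane,
      HasDerivAt (fun z => z * (1 - z) * wronsk u w z) 0 z := fun z hz => by
    have h₀ : z ≠ 0 := slitPlane_ne_zero hz.1
    have h₁ : 1 - z ≠ 0 := slitPlane_ne_zero hz.2
    have hsolve : ∀ y₀ y₁ y₂ : ℂ, z * (1 - z) * y₂ + (1 - 2 * z) * y₁ = q * y₀ →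
        y₂ = -(1 - 2 * z) / (z * (1 - z)) * y₁ + q / (z * (1 - z)) * y₀ := fun y₀ y₁ y₂ h => by
      field_simp
      linear_combination h
    have hW := hasDerivAt_wronsk isOpen_doubleCutPlane hu hw hz (hsolve _ _ _ (hue z hz))
      (hsolve _ _ _ (hwe z hz))
    refine (((hasDerivAt_id' z).fun_mul ((hasDerivAt_id' z).const_sub 1)).fun_mul hW).congr_deriv ?_
    field
  exact isOpen_doubleCutPlane.is_const_of_deriv_eq_zero isPreconnected_doubleCutPlane
    (fun z hz => (hd z hz).differentiableAt.differentiableWithinAt) (fun z hz => (hd z hz).deriv)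
    hx hy

lemma exists_eqOn_const_mul_of_wronsk_eq_zero {U : Set ℂ} {u w : ℂ → ℂ} (hU : IsOpen U)
    (hUc : IsPreconnected U) (hu : DifferentiableOn ℂ u U) (hw : DifferentiableOn ℂ w U)
    (hW : ∀ z ∈ U, wronsk u w z = 0) (hz : z ∈ U) (huz : u z ≠ 0) :
    ∃ C : ℂ, EqOn w (fun z => C * u z) U := by
  have hne : ∀ᶠ x in 𝓝 z, u x ≠ 0 :=
    (hu.differentiableAt (hU.mem_nhds hz)).continuousAt.eventually_ne huz
  obtain ⟨δ, hδ, hball⟩ := Metric.mem_nhds_iff.1 (inter_mem hne (hU.mem_nhds hz))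
  have hquot : ∀ x ∈ ball z δ, HasDerivAt (fun x => w x / u x) 0 x := fun x hx => by
    obtain ⟨hux, hxU⟩ := hball hx
    refine (((hw.differentiableAt (hU.mem_nhds hxU)).hasDerivAt).fun_div
      (hu.differentiableAt (hU.mem_nhds hxU)).hasDerivAt hux).congr_deriv ?_
    rw [div_eq_zero_iff, ← hW x hxU, wronsk]
    exact Or.inl (by ring)
  obtain ⟨C, hC⟩ := isOpen_ball.exists_is_const_of_deriv_eq_zero (convex_ball z δ).isPreconnected
    (fun x hx => (hquot x hx).differentiableAt.differentiableWithinAt)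
    fun x hx => (hquot x hx).deriv
  refine ⟨C, (hw.analyticOnNhd hU).eqOn_of_preconnected_of_eventuallyEq
    ((hu.const_mul C).analyticOnNhd hU) hUc hz ?_⟩
  filter_upwards [ball_mem_nhds z hδ] with x hx
  exact (div_eq_iff (hball hx).1).1 (hC x hx)

lemma not_differentiable_of_eqOn_ordinaryHypergeometric {a b c : ℂ}
    (habc : ∀ k : ℕ, (k : ℂ) ≠ -a ∧ (k : ℂ) ≠ -b ∧ (k : ℂ) ≠ -c) {H : ℂ → ℂ}
    (hH : EqOn H (ordinaryHypergeometric a b c) (ball 0 1)) : ¬ Differentiable ℂ H := fun hd => by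
  have hent := hd.hasFPowerSeriesOnBall 0 (R := 1) one_pos
  have hser := (hasFPowerSeriesOnBall_ordinaryHypergeometric a b c).hasFPowerSeriesAt
  have heq := hent.hasFPowerSeriesAt.eq_formalMultilinearSeries
    (hser.congr (hH.eventuallyEq_of_mem (ball_mem_nhds 0 one_pos)).symm)
  have hle := hent.r_le
  rw [heq, ordinaryHypergeometricSeries_radius_eq_one ℂ a b c habc] at hle
  simp at hle

lemma IsGaussHypergeometric.exists_ne_zero {a b c : ℂ} {F : ℂ → ℂ}
    (hF : IsGaussHypergeometric a b c F) : ∃ z ∈ doubleCutPlane, F z ≠ 0 := by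
  by_contra! h
  have hzero : EqOn F 0 cutPlane :=
    (hF.1.analyticOnNhd isOpen_cutPlane).eqOn_zero_of_preconnected_of_eventuallyEq_zero
      isPreconnected_cutPlane half_mem_doubleCutPlane.2
      (eventually_of_mem (isOpen_doubleCutPlane.mem_nhds half_mem_doubleCutPlane) h)
  exact one_ne_zero (hF.map_zero.symm.trans (hzero zero_mem_cutPlane))

variable {p : ℂ} {F : ℂ → ℂ}

lemma IsGaussHypergeometric.legendre_equation (hF : IsGaussHypergeometric (-p) (1 + p) 1 F)
    (hz : z ∈ cutPlane) :
    z * (1 - z) * deriv (deriv F) z + (1 - 2 * z) * deriv F z = -p * (1 + p) * F z := by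
  linear_combination hF.equation (ne_neg_natCast_of_re_pos (by simp)) hz

lemma IsGaussHypergeometric.legendre_equation_one_sub
    (hF : IsGaussHypergeometric (-p) (1 + p) 1 F) (hz : z ∈ slitPlane) :
    z * (1 - z) * deriv (deriv fun z => F (1 - z)) z
      + (1 - 2 * z) * deriv (fun z => F (1 - z)) z = -p * (1 + p) * F (1 - z) := by
  rw [deriv_deriv_one_sub, deriv_one_sub]
  linear_combination hF.legendre_equation (one_sub_mem_cutPlane hz)

/-- If the Wronskian vanished somewhere, then `F(1 - z)` would be a multiple of `F(z)`, and the two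
would glue to an entire function, although the series of `F` has radius of convergence `1`. -/
theorem wronsk_gauss_ne_zero (hp : ∀ n : ℤ, p ≠ n) (hF : IsGaussHypergeometric (-p) (1 + p) 1 F)
    (hz : z ∈ doubleCutPlane) : wronsk F (fun z => F (1 - z)) z ≠ 0 := fun h₀ => by
  have hF' := differentiableOn_comp_one_sub hF.1
  have hW : ∀ x ∈ doubleCutPlane, wronsk F (fun z => F (1 - z)) x = 0 := fun x hx => by
    have hconst := mul_one_sub_mul_wronsk_eq (hF.1.mono inter_subset_right)
      (hF'.mono inter_subset_left) (fun z hz => hF.legendre_equation hz.2)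
      (fun z hz => hF.legendre_equation_one_sub hz.1) hx hz
    rw [h₀, mul_zero] at hconst
    exact (mul_eq_zero.1 hconst).resolve_left
      (mul_ne_zero (slitPlane_ne_zero hx.1) (slitPlane_ne_zero hx.2))
  obtain ⟨z₁, hz₁, hFz₁⟩ := hF.exists_ne_zero
  obtain ⟨C, hC⟩ := exists_eqOn_const_mul_of_wronsk_eq_zero isOpen_doubleCutPlane
    isPreconnected_doubleCutPlane (hF.1.mono inter_subset_right) (hF'.mono inter_subset_left) hW
    hz₁ hFz₁
  obtain ⟨H, hH, hHF⟩ := exists_differentiable_eqOn_cutPlane hF.1 (hF'.const_mul C) fun x hx => by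
    simpa using hC (one_sub_mem_doubleCutPlane hx)
  refine not_differentiable_of_eqOn_ordinaryHypergeometric (fun k => ⟨?_, ?_, ?_⟩)
    ((hHF.mono ball_subset_cutPlane).trans hF.eqOn_ball) hH
  · exact fun h => hp k (by simpa using h.symm)
  · refine fun h => hp (-(k + 1)) ?_
    push_cast
    linear_combination h
  · exact fun h => ne_neg_natCast_of_re_pos (c := 1) (by simp) k (neg_eq_iff_eq_neg.1 h.symm)

end GaussPair

section InverseSquareCase

open Set

variable {J : Set ℝ} {r₀ v₀ : E3} {b k : ℝ}

lemma hypZ_eq (hw : wedge r₀ v₀ ≠ 0) (t : ℝ) : hypZ r₀ v₀ t =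
    1 / 2 + I * ((parA r₀ v₀ + speed v₀ * t) / (2 * parC r₀ v₀)) := by
  have hb : (speed v₀ : ℂ) ≠ 0 := ofReal_ne_zero.2 (speed_pos hw).ne'
  have hc : (parC r₀ v₀ : ℂ) ≠ 0 := ofReal_ne_zero.2 (parC_pos hw).ne'
  rw [hypZ, ← speed_mul_parA hw]
  push_cast
  field_simp
  ring_nf
  simp only [I_sq]
  ring

lemma hasDerivAt_hypZ (hw : wedge r₀ v₀ ≠ 0) (t : ℝ) :
    HasDerivAt (hypZ r₀ v₀) (I * speed v₀ / (2 * parC r₀ v₀)) t := by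
  rw [funext (hypZ_eq hw)]
  refine ((((hasDerivAt_id' t).ofReal_comp.const_mul (speed v₀ : ℂ)).const_add
    (parA r₀ v₀ : ℂ)).div_const (2 * parC r₀ v₀ : ℂ)).const_mul I |>.const_add (1 / 2)
    |>.congr_deriv ?_
  push_cast
  ring

lemma hypZ_re (hw : wedge r₀ v₀ ≠ 0) (t : ℝ) : (hypZ r₀ v₀ t).re = 1 / 2 := by
  have h : hypZ r₀ v₀ t =
      1 / 2 + I * ((parA r₀ v₀ + speed v₀ * t) / (2 * parC r₀ v₀) : ℝ) := by
    rw [hypZ_eq hw]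
    push_cast
    rfl
  rw [h, add_re, re_mul_ofReal, I_re]
  norm_num

lemma hypZ_mem_doubleCutPlane (hw : wedge r₀ v₀ ≠ 0) (t : ℝ) : hypZ r₀ v₀ t ∈ doubleCutPlane := by
  refine mem_doubleCutPlane_of_re ?_ ?_ <;> rw [hypZ_re hw] <;> norm_num

lemma parA_add_speed_mul_eq (hw : wedge r₀ v₀ ≠ 0) (t : ℝ) :
    (parA r₀ v₀ : ℂ) + speed v₀ * t = I * parC r₀ v₀ * (1 - 2 * hypZ r₀ v₀ t) := by
  have hc : (parC r₀ v₀ : ℂ) ≠ 0 := ofReal_ne_zero.2 (parC_pos hw).ne'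
  rw [hypZ_eq hw]
  field_simp
  ring_nf
  simp only [I_sq]
  ring

lemma chi_eq_hypZ (hw : wedge r₀ v₀ ≠ 0) (t : ℝ) :
    (chi r₀ v₀ t : ℂ) =
      4 * (parC r₀ v₀ : ℂ) ^ 2 * (hypZ r₀ v₀ t * (1 - hypZ r₀ v₀ t)) := by
  rw [chi_eq hw]
  push_cast
  rw [parA_add_speed_mul_eq hw]
  ring_nf
  simp only [I_sq]
  ring

lemma chi_zero (r₀ v₀ : E3) : chi r₀ v₀ 0 = alpha r₀ := by simp [chi]

lemma hypZ_mul_one_sub_ne_zero (hw : wedge r₀ v₀ ≠ 0) (t : ℝ) :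
    hypZ r₀ v₀ t * (1 - hypZ r₀ v₀ t) ≠ 0 := fun h =>
  ofReal_ne_zero.2 (chi_pos hw t).ne' (by rw [chi_eq_hypZ hw, h, mul_zero])

lemma hasDerivAt_div_chi (hw : wedge r₀ v₀ ≠ 0) (k t : ℝ) :
    HasDerivAt (fun t => k / chi r₀ v₀ t) (-(k * deriv (chi r₀ v₀) t) / chi r₀ v₀ t ^ 2) t :=
  ((hasDerivAt_const t k).div (hasDerivAt_chi r₀ v₀ t).differentiableAt.hasDerivAt
    (chi_pos hw t).ne').congr_deriv (by ring)

lemma logDeriv_div_chi (hw : wedge r₀ v₀ ≠ 0) (hk : k ≠ 0) (t : ℝ) :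
    ((deriv (fun t => k / chi r₀ v₀ t) t / (k / chi r₀ v₀ t) : ℝ) : ℂ) =
      -(I * speed v₀ / (2 * parC r₀ v₀)) * (1 - 2 * hypZ r₀ v₀ t)
        / (hypZ r₀ v₀ t * (1 - hypZ r₀ v₀ t)) := by
  have hc : (parC r₀ v₀ : ℂ) ≠ 0 := ofReal_ne_zero.2 (parC_pos hw).ne'
  have hz := hypZ_mul_one_sub_ne_zero hw t
  have hχ := (chi_pos hw t).ne'
  have hlog : deriv (fun t => k / chi r₀ v₀ t) t / (k / chi r₀ v₀ t) =
      -(2 * speed v₀ * (parA r₀ v₀ + speed v₀ * t)) / chi r₀ v₀ t := by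
    rw [(hasDerivAt_div_chi hw k t).deriv, deriv_chi, ← speed_mul_parA hw]
    field
  rw [hlog]
  push_cast
  rw [parA_add_speed_mul_eq hw, chi_eq_hypZ hw, div_eq_div_iff (mul_ne_zero (by simp [hc]) hz) hz]
  field

lemma gauss_potential (hw : wedge r₀ v₀ ≠ 0) (k t : ℝ) :
    -(chi r₀ v₀ t : ℂ) * (((k / chi r₀ v₀ t : ℝ) : ℂ) / 2) ^ 2
        + I * speed v₀ * ((k / chi r₀ v₀ t : ℝ) : ℂ) / 2 =
      (I * speed v₀ / (2 * parC r₀ v₀)) ^ 2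
          * (k * (k - 2 * I * speed v₀) * ((2 * speed v₀ : ℂ) ^ 2)⁻¹)
        / (hypZ r₀ v₀ t * (1 - hypZ r₀ v₀ t)) := by
  have hb : (speed v₀ : ℂ) ≠ 0 := ofReal_ne_zero.2 (speed_pos hw).ne'
  have hc : (parC r₀ v₀ : ℂ) ≠ 0 := ofReal_ne_zero.2 (parC_pos hw).ne'
  have hz₀ := left_ne_zero_of_mul (hypZ_mul_one_sub_ne_zero hw t)
  have hz₁ := right_ne_zero_of_mul (hypZ_mul_one_sub_ne_zero hw t)
  push_cast
  rw [chi_eq_hypZ hw]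
  field_simp
  simp only [I_sq]
  ring

theorem solvesLinear_iff_hypEqAt (hw : wedge r₀ v₀ ≠ 0) (hk : k ≠ 0)
    {U : Set ℂ} {y : ℂ → ℂ} (hU : IsOpen U) (hy : DifferentiableOn ℂ y U)
    (hJU : ∀ t ∈ J, hypZ r₀ v₀ t ∈ U) :
    SolvesLinear (fun t => k / chi r₀ v₀ t) r₀ v₀ J (fun t => y (hypZ r₀ v₀ t)) ↔
      ∀ t ∈ J, HypEqAt k (speed v₀) y (hypZ r₀ v₀ t) := by
  have hb : (speed v₀ : ℂ) ≠ 0 := ofReal_ne_zero.2 (speed_pos hw).ne'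
  have hc : (parC r₀ v₀ : ℂ) ≠ 0 := ofReal_ne_zero.2 (parC_pos hw).ne'
  refine forall₂_congr fun t ht => ?_
  have hd := hasDerivAt_comp_affine (hasDerivAt_hypZ hw) hU hy (hJU t ht)
  have hd₂ := hasDerivAt_deriv_comp_affine (hasDerivAt_hypZ hw) hU hy (hJU t ht)
  have hz := hypZ_mul_one_sub_ne_zero hw t
  rw [logDeriv_div_chi hw hk, gauss_potential hw, hd.deriv, HypEqAt]
  set z := hypZ r₀ v₀ t
  set ζ := I * speed v₀ / (2 * parC r₀ v₀)
  have hζ : ζ ≠ 0 := div_ne_zero (mul_ne_zero I_ne_zero hb) (mul_ne_zero two_ne_zero hc)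
  have hfac : ζ ^ 2 / (z * (1 - z)) ≠ 0 := div_ne_zero (pow_ne_zero 2 hζ) hz
  have hz₀ := left_ne_zero_of_mul hz
  have hz₁ := right_ne_zero_of_mul hz
  refine ⟨fun H => mul_left_cancel₀ hfac ?_, fun H => ⟨hd.differentiableAt, hd₂.congr_deriv ?_⟩⟩
  · have hy₂ := hd₂.unique H.2
    field_simp at hy₂ ⊢
    linear_combination hy₂
  · generalize k * (k - 2 * I * speed v₀) * ((2 * speed v₀ : ℂ) ^ 2)⁻¹ = q at H ⊢
    field_simp
    linear_combination H

lemma HypEqAt.linearCombination {u w : ℂ → ℂ} {z : ℂ} {U : Set ℂ} (hU : IsOpen U)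
    (hdu : DifferentiableOn ℂ u U) (hdw : DifferentiableOn ℂ w U) (hz : z ∈ U)
    (hu : HypEqAt k b u z) (hw : HypEqAt k b w z) (A B : ℂ) :
    HypEqAt k b (fun z => A * u z + B * w z) z := by
  rw [HypEqAt] at *
  rw [(hasDerivAt_linearCombination hU hdu hdw A B hz).deriv,
    (hasDerivAt_deriv_linearCombination hU hdu hdw A B hz).deriv]
  linear_combination A * hu + B * hw

lemma hypEqAt_iff_legendre_equation (hb : b ≠ 0) {u : ℂ → ℂ} {z : ℂ} :
    HypEqAt k b u z ↔ z * (1 - z) * deriv (deriv u) z + (1 - 2 * z) * deriv u z =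
      -(I * k / (2 * b)) * (1 + I * k / (2 * b)) * u z := by
  have hb' : (b : ℂ) ≠ 0 := ofReal_ne_zero.2 hb
  have hq : -(I * k / (2 * b)) * (1 + I * k / (2 * b)) =
      k * (k - 2 * I * b) * ((2 * b : ℂ) ^ 2)⁻¹ := by
    field_simp
    ring_nf
    simp only [I_sq]
    ring
  rw [HypEqAt, hq, sub_eq_zero]

theorem isGenerating_gauss (hw : wedge r₀ v₀ ≠ 0) (hk : k ≠ 0) {u w : ℂ → ℂ}
    (hdu : DifferentiableOn ℂ u doubleCutPlane) (hdw : DifferentiableOn ℂ w doubleCutPlane)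
    (hpair : ∀ z ∈ doubleCutPlane, HypEqAt k (speed v₀) u z ∧ HypEqAt k (speed v₀) w z ∧
      wronsk u w z ≠ 0) {A B y : ℂ}
    (hy : y = parA r₀ v₀ * parC r₀ v₀ * k / (speed v₀ * alpha r₀))
    (hA : A = coeffFst u w (hypZ r₀ v₀ 0) 1 y) (hB : B = coeffSnd u w (hypZ r₀ v₀ 0) 1 y) :
    IsGenerating (fun t => k / chi r₀ v₀ t) r₀ v₀ J
      (fun t => A * u (hypZ r₀ v₀ t) + B * w (hypZ r₀ v₀ t)) := by
  have hU := isOpen_doubleCutPlane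
  have hz := hypZ_mem_doubleCutPlane hw
  have hW := (hpair _ (hz 0)).2.2
  have hd : DifferentiableOn ℂ (fun z => A * u z + B * w z) doubleCutPlane :=
    (hdu.const_mul A).add (hdw.const_mul B)
  refine ⟨(solvesLinear_iff_hypEqAt hw hk hU hd fun t _ => hz t).2 fun t _ => ?_,
    hA ▸ hB ▸ coeff_value hW _ _, ?_⟩
  · obtain ⟨hu, hv, -⟩ := hpair _ (hz t)
    exact .linearCombination hU hdu hdw (hz t) hu hv A B
  · have hb : (speed v₀ : ℂ) ≠ 0 := ofReal_ne_zero.2 (speed_pos hw).ne'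
    have hc : (parC r₀ v₀ : ℂ) ≠ 0 := ofReal_ne_zero.2 (parC_pos hw).ne'
    rw [(hasDerivAt_comp_affine (hasDerivAt_hypZ hw) hU hd (hz 0)).deriv,
      (hasDerivAt_linearCombination hU hdu hdw A B (hz 0)).deriv, hA, hB, coeff_deriv hW, hy]
    simp only [chi_zero]
    push_cast
    field

theorem exists_gauss_representation (hJ : IsOpen J) (hJc : J.OrdConnected) (hJ0 : (0 : ℝ) ∈ J)
    (hw : wedge r₀ v₀ ≠ 0) (hk : k ≠ 0) :
    ∃ F : ℂ → ℂ,
      IsGaussHypergeometric (-I * k / (2 * speed v₀)) (1 + I * k / (2 * speed v₀)) 1 F ∧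
      (∀ z ∈ slitPlane, 1 - z ∈ slitPlane →
        HypEqAt k (speed v₀) F z ∧ HypEqAt k (speed v₀) (fun z => F (1 - z)) z ∧
        wronsk F (fun z => F (1 - z)) z ≠ 0) ∧
      ∀ A B y : ℂ, y = parA r₀ v₀ * parC r₀ v₀ * k / (speed v₀ * alpha r₀) →
        A = coeffFst F (fun z => F (1 - z)) (hypZ r₀ v₀ 0) 1 y →
        B = coeffSnd F (fun z => F (1 - z)) (hypZ r₀ v₀ 0) 1 y →
        ∀ f : ℝ → ℂ, IsGenerating (fun t => k / chi r₀ v₀ t) r₀ v₀ J f ↔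
          ∀ t ∈ J, f t = A * F (hypZ r₀ v₀ t) + B * F (1 - hypZ r₀ v₀ t) := by
  have hb := (speed_pos hw).ne'
  set p : ℂ := I * k / (2 * speed v₀) with hp
  have hpI : p = ((k / (2 * speed v₀) : ℝ) : ℂ) * I := by
    rw [hp]
    push_cast
    ring
  have hp_re : p.re = 0 := by rw [hpI, re_ofReal_mul, I_re, mul_zero]
  have hp_im : p.im ≠ 0 := by
    rw [hpI, im_ofReal_mul, I_im, mul_one]
    exact div_ne_zero hk (mul_ne_zero two_ne_zero hb)
  have hp_int : ∀ n : ℤ, p ≠ n := fun n h => hp_im (by rw [h, intCast_im])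
  have hp₁ : 1 + p ≠ 0 := fun h => hp_int (-1) (by push_cast; linear_combination h)
  obtain ⟨F, hF⟩ := exists_isGaussHypergeometric (a := -p) (b := 1 + p) (c := 1)
    (by simp [hp_re]) (by simp [hp_re]) (ne_neg_natCast_of_re_pos (by simp))
    (neg_ne_zero.2 fun h => hp_im (by rw [h, zero_im])) hp₁
  have hpair : ∀ z ∈ doubleCutPlane, HypEqAt k (speed v₀) F z ∧
      HypEqAt k (speed v₀) (fun z => F (1 - z)) z ∧ wronsk F (fun z => F (1 - z)) z ≠ 0 :=
    fun z hz => ⟨(hypEqAt_iff_legendre_equation hb).2 (hF.legendre_equation hz.2),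
      (hypEqAt_iff_legendre_equation hb).2 (hF.legendre_equation_one_sub hz.1),
      wronsk_gauss_ne_zero hp_int hF hz⟩
  have hpa : -I * k / (2 * speed v₀) = -p := by ring
  refine ⟨F, hpa ▸ hF, fun z hz hz' => hpair z ⟨hz, hz'⟩, fun A B y hy hA hB f => ?_⟩
  exact isGenerating_iff_eqOn hJ hJc hJ0 hw
    (fun t _ => ⟨(hasDerivAt_div_chi hw k t).differentiableAt, div_ne_zero hk (chi_pos hw t).ne'⟩)
    (isGenerating_gauss hw hk (hF.1.mono inter_subset_right)
      ((differentiableOn_comp_one_sub hF.1).mono inter_subset_left) hpair hy hA hB) f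

end InverseSquareCase

end VectorNewton

theorem mainTheorem6 (J : Set ℝ) (hJ : IsOpen J) (hJc : J.OrdConnected) (hJ0 : (0 : ℝ) ∈ J)
    (r₀ v₀ : E3) :
    -- conservation laws
    (∀ (H : ℝ → ℝ → ℝ) (r : ℝ → E3), IsMotion H J r → r 0 = r₀ → deriv r 0 = v₀ →
      ∀ t ∈ J, ‖deriv r t‖ = speed v₀ ∧ ‖r t‖ ^ 2 = chi r₀ v₀ t ∧
        inner ℝ (r t) (deriv r t) = beta r₀ v₀ + speed v₀ ^ 2 * t) ∧
    -- representation of the motion through three solutions of the third-order equation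
    (∀ (H : ℝ → ℝ → ℝ) (h : ℝ → ℝ), (∀ t, h t = H t (chi r₀ v₀ t)) →
      (∀ t ∈ J, DifferentiableAt ℝ h t ∧ h t ≠ 0) →
      (∃ F₀ F₁ F₂ : ℝ → ℝ, SolvesThirdOrder h r₀ v₀ J 1 0 0 F₀ ∧
        SolvesThirdOrder h r₀ v₀ J 0 1 0 F₁ ∧ SolvesThirdOrder h r₀ v₀ J 0 0 (h 0) F₂) ∧
      ∀ F₀ F₁ F₂ : ℝ → ℝ, SolvesThirdOrder h r₀ v₀ J 1 0 0 F₀ →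
        SolvesThirdOrder h r₀ v₀ J 0 1 0 F₁ → SolvesThirdOrder h r₀ v₀ J 0 0 (h 0) F₂ →
        ∀ r : ℝ → E3, (IsMotion H J r ∧ r 0 = r₀ ∧ deriv r 0 = v₀) ↔
          ∀ t ∈ J, r t = F₀ t • r₀ + F₁ t • v₀ + F₂ t • wedge r₀ v₀) ∧
    -- the three solutions expressed through `f`
    (wedge r₀ v₀ ≠ 0 →
      ∀ (H : ℝ → ℝ → ℝ) (h : ℝ → ℝ), (∀ t, h t = H t (chi r₀ v₀ t)) →
      (∀ t ∈ J, DifferentiableAt ℝ h t ∧ h t ≠ 0) →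
      (∃ f : ℝ → ℂ, IsGenerating h r₀ v₀ J f) ∧
      (∀ f₁ f₂ : ℝ → ℂ, IsGenerating h r₀ v₀ J f₁ → IsGenerating h r₀ v₀ J f₂ →
        Set.EqOn f₁ f₂ J) ∧
      (∀ f g : ℝ → ℂ, SolvesSystem h r₀ v₀ J f g ↔
        IsGenerating h r₀ v₀ J f ∧ Set.EqOn g (companion h r₀ v₀ f) J) ∧
      ∀ f : ℝ → ℂ, IsGenerating h r₀ v₀ J f →
        ∀ g : ℝ → ℂ, g = companion h r₀ v₀ f →
        (∀ t ∈ J, g t * (starRingEnd ℂ) (g t) = 1 - f t * (starRingEnd ℂ) (f t)) ∧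
        ∃ F₀ F₁ F₂ : ℝ → ℝ,
          (∀ t ∈ J, (F₀ t : ℂ) = pairF0 r₀ v₀ t (f t) (g t) ∧
            (F₁ t : ℂ) = pairF1 r₀ v₀ t (f t) (g t) ∧
            (F₂ t : ℂ) = pairF2 r₀ v₀ t (f t) (g t) ∧
            (F₀ t : ℂ) = singleF0 r₀ v₀ t (h t) (f t) (deriv f t) ∧
            (F₁ t : ℂ) = singleF1 r₀ v₀ t (h t) (f t) (deriv f t) ∧
            (F₂ t : ℂ) = singleF2 r₀ v₀ t (h t) (f t) (deriv f t)) ∧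
          SolvesThirdOrder h r₀ v₀ J 1 0 0 F₀ ∧ SolvesThirdOrder h r₀ v₀ J 0 1 0 F₁ ∧
          SolvesThirdOrder h r₀ v₀ J 0 0 (h 0) F₂ ∧
          ∀ r : ℝ → E3, (IsMotion H J r ∧ r 0 = r₀ ∧ deriv r 0 = v₀) ↔
            ∀ t ∈ J, r t = F₀ t • r₀ + F₁ t • v₀ + F₂ t • wedge r₀ v₀) ∧
    -- the equivalent equation of Schrödinger type
    (∀ h : ℝ → ℝ,
      (∀ t ∈ J, DifferentiableAt ℝ h t ∧ DifferentiableAt ℝ (deriv h) t ∧ h t ≠ 0) →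
      ∀ f φ : ℝ → ℂ, (∀ t ∈ J, f t = (h t : ℂ) ^ (1 / 2 : ℂ) * φ t) →
        (IsGenerating h r₀ v₀ J f ↔
          SolvesSchroedinger h r₀ v₀ J φ ∧ φ 0 = phiInit h ∧ deriv φ 0 = phiDerivInit h r₀ v₀)) ∧
    -- `ĥ = k`: parabolic cylinder functions
    (∀ k : ℝ, wedge r₀ v₀ ≠ 0 → k ≠ 0 →
      ∀ (u w : ℂ → ℂ) (A B : ℂ),
        u = parabolicCylinder (cylP k r₀ v₀) →
        w = (fun τ => parabolicCylinder (cylP k r₀ v₀) (-τ)) →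
        A = coeffFst u w (cylTau k r₀ v₀ 0) 1 (cylK k r₀ v₀) →
        B = coeffSnd u w (cylTau k r₀ v₀ 0) 1 (cylK k r₀ v₀) →
        (∀ τ, wronsk u w τ ≠ 0) ∧
        ∀ f : ℝ → ℂ, IsGenerating (fun _ => k) r₀ v₀ J f ↔
          ∀ t ∈ J, f t = A * u (cylTau k r₀ v₀ t) + B * w (cylTau k r₀ v₀ t)) ∧
    -- `ĥ = k / r²`: hypergeometric functions
    (∀ k : ℝ, wedge r₀ v₀ ≠ 0 → k ≠ 0 →
      (∀ (U : Set ℂ) (fh : ℂ → ℂ), IsOpen U → DifferentiableOn ℂ fh U →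
        (∀ t ∈ J, hypZ r₀ v₀ t ∈ U) →
        (SolvesLinear (fun t => k / chi r₀ v₀ t) r₀ v₀ J (fun t => fh (hypZ r₀ v₀ t)) ↔
          ∀ t ∈ J, HypEqAt k (speed v₀) fh (hypZ r₀ v₀ t))) ∧
      ∃ F : ℂ → ℂ,
        IsGaussHypergeometric (-Complex.I * k / (2 * speed v₀))
          (1 + Complex.I * k / (2 * speed v₀)) 1 F ∧
        (∀ z ∈ Complex.slitPlane, 1 - z ∈ Complex.slitPlane →
          HypEqAt k (speed v₀) F z ∧ HypEqAt k (speed v₀) (fun z => F (1 - z)) z ∧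
          wronsk F (fun z => F (1 - z)) z ≠ 0) ∧
        ∀ A B y : ℂ,
          y = parA r₀ v₀ * parC r₀ v₀ * k / (speed v₀ * alpha r₀) →
          A = coeffFst F (fun z => F (1 - z)) (hypZ r₀ v₀ 0) 1 y →
          B = coeffSnd F (fun z => F (1 - z)) (hypZ r₀ v₀ 0) 1 y →
          ∀ f : ℝ → ℂ, IsGenerating (fun t => k / chi r₀ v₀ t) r₀ v₀ J f ↔
            ∀ t ∈ J, f t = A * F (hypZ r₀ v₀ t) + B * F (1 - hypZ r₀ v₀ t)) ∧
    -- `h = 2 k / (1 + 2 ω t)`: Whittaker functions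
    (∀ k ω : ℝ, wedge r₀ v₀ ≠ 0 → k ≠ 0 → ω ≠ 0 → (∀ t ∈ J, 1 + 2 * ω * t ≠ 0) →
      ∀ h : ℝ → ℝ, (∀ t, h t = 2 * k / (1 + 2 * ω * t)) →
      ∀ μ : ℂ, μ ^ 2 = (whitMuSq k ω r₀ v₀ : ℂ) →
      (∀ (U : Set ℂ) (φh : ℂ → ℂ), IsOpen U → DifferentiableOn ℂ φh U →
        (∀ t ∈ J, whitZ k ω v₀ t ∈ U) →
        (SolvesSchroedinger h r₀ v₀ J (fun t => φh (whitZ k ω v₀ t)) ↔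
          ∀ t ∈ J, WhittakerEqAt (whitL k ω r₀ v₀) μ φh (whitZ k ω v₀ t))) ∧
      ∀ (u w : ℂ → ℂ) (A B y : ℂ),
        u = whittakerW (whitL k ω r₀ v₀) μ →
        w = (fun z => whittakerW (-whitL k ω r₀ v₀) μ (-z)) →
        y = phiDerivInit h r₀ v₀ * (Complex.I * ω / (speed v₀ * k)) →
        A = coeffFst u w (whitZ k ω v₀ 0) (phiInit h) y →
        B = coeffSnd u w (whitZ k ω v₀ 0) (phiInit h) y →
        (∀ z : ℂ, z.im ≠ 0 →
          WhittakerEqAt (whitL k ω r₀ v₀) μ u z ∧ WhittakerEqAt (whitL k ω r₀ v₀) μ w z ∧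
          wronsk u w z ≠ 0) ∧
        ∀ f : ℝ → ℂ, IsGenerating h r₀ v₀ J f ↔
          ∀ t ∈ J, f t = (h t : ℂ) ^ (1 / 2 : ℂ) *
            (A * u (whitZ k ω v₀ t) + B * w (whitZ k ω v₀ t))) := by
  refine ⟨fun H r hr h₀ h₁ t ht => hr.conservation hJc hJ0 h₀ h₁ ht, fun H h hH hh => ⟨?_, ?_⟩,
    fun hw H h hH hh => ⟨exists_isGenerating hJ hJc hJ0 hw hh,
      fun f₁ f₂ h₁ h₂ => h₁.eqOn hJ hJc hJ0 hw hh h₂, solvesSystem_iff hJ hJ0 hw hh, ?_⟩,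
    fun h hh f φ hfφ => isGenerating_iff_solvesSchroedinger hJ hJ0 hh hfφ,
    fun k hw hk u w A B hu hv hA hB =>
      ⟨?_, isGenerating_const_iff hJ hJc hJ0 hw hk hu hv hA hB⟩,
    fun k hw hk => ⟨fun U y hU hy hJU => solvesLinear_iff_hypEqAt hw hk hU hy hJU,
      exists_gauss_representation hJ hJc hJ0 hw hk⟩,
    fun k ω hw hk hω hJω h hh μ hμ =>
      ⟨fun U y hU hy hJU => solvesSchroedinger_iff_whittakerEqAt hw hk hω hJω hh hμ hU hy hJU,
        fun u w A B y hu hv hy hA hB =>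
          ⟨?_, isGenerating_reciprocal_iff hJ hJc hJ0 hw hk hω hJω hh hμ hu hv hy hA hB⟩⟩⟩
  · obtain ⟨F₀, hF₀⟩ := exists_solvesThirdOrder hJ hJc hJ0 hh 1 0 0
    obtain ⟨F₁, hF₁⟩ := exists_solvesThirdOrder hJ hJc hJ0 hh 0 1 0
    obtain ⟨F₂, hF₂⟩ := exists_solvesThirdOrder hJ hJc hJ0 hh 0 0 (h 0)
    exact ⟨F₀, F₁, F₂, hF₀, hF₁, hF₂⟩
  · exact fun F₀ F₁ F₂ hF₀ hF₁ hF₂ =>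
      isMotion_iff_eq_combination hJc hJ0 hh hF₀ hF₁ hF₂ hJ fun t _ => hH t
  · intro f hf g hg
    obtain ⟨hfg, F₀, F₁, F₂, hF, hF₀, hF₁, hF₂⟩ := hf.exists_basicSolutions hJ hJc hJ0 hw hh hg
    exact ⟨hfg, F₀, F₁, F₂, hF, hF₀, hF₁, hF₂,
      isMotion_iff_eq_combination hJc hJ0 hh hF₀ hF₁ hF₂ hJ fun t _ => hH t⟩
  · exact hu ▸ hv ▸ wronsk_parabolicCylinder_ne_zero fun n h => cylP_im_ne_zero hw hk (by simp [h])
  · have hm := two_mul_ne_intCast_of_sq_neg (whitMuSq_neg hw hk hω) hμ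
    rw [hu, hv]
    exact fun z hz => ⟨whittakerEqAt_whittakerW hm _ (.inr hz),
      whittakerEqAt_whittakerW_neg hm _ hz, wronsk_whittakerW_ne_zero hm _ hz⟩
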